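/- **Setting.** Let $P$ be a probability measure on a measurable space $\mathcal X$, let $n\ge 1$, let $X_1,\dots,X_n$ be i.i.d. with law $P$, and let $\mathbb G_n(f)=n^{-1/2}\sum_{i=1}^n (f(X_i)-Pf)$, where $Pf=\int f\,dP$. Let $\mathcal F$ be a countable class of measurable functions $f:\mathcal X\to\mathbb R$ with $\sup_x|f(x)|\le 1$, and for $\sigma>0$ let $\mathcal F(\sigma)=\{f\in\mathcal F: Pf^2\le\sigma^2\}$. For a norm (or squared norm) $\rho$ on measurable functions, $\mathcal N_{[\,]}(\epsilon,\mathcal F,\rho)$ is the minimal number of brackets $[\ell,u]=\{f:\ell\le f\le u\}$, with $\ell,u$ measurable, $\rho(\ell),\rho(u)<\infty$ and $\rho(u-\ell)<\epsilon$, needed to cover $\mathcal F$; $\mathcal N(\epsilon,\mathcal F,\rho)$ is the minimal number of balls $\{f:\rho(f-g)<\epsilon\}$, with $g$ measurable (not necessarily in $\mathcal F$) and $\rho(g)<\infty$, needed to cover $\mathcal F$. Both are $+\infty$ if no finite number suffices. Write $a\wedge b=\min\{a,b\}$; $\log$ is the natural logarithm. In (1)–(3), $L>0$ is a fixed constant.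 **(1)** Let $p\in[1,\infty)$, $\alpha>0$, $\alpha\ne p\wedge 2$. There is a constant $C=C(\alpha,p,L)$ such that for all $n\geq 1$ and $\sigma>0$, and all $P$ and $\mathcal F$ as above: if $\sup_{f\in\mathcal F}\|f\|_{L_p(P)}\le\sigma$ and $\log\mathcal N_{[\,]}(\epsilon,\mathcal F,L_p(P))\le L\epsilon^{-\alpha}$ for all $\epsilon>0$, then $$\mathbb E\sup_{f\in\mathcal F}|\mathbb G_n(f)|\le C\inf_{0\le\gamma\le\sigma/2}\Big\{\big(\sigma\mathbf 1_{\alpha<p\wedge2}+\gamma\mathbf 1_{\alpha>p\wedge 2}\big)^{\{(p\wedge2)-\alpha\}/2}+n^{-1/2}\sigma^{-\alpha}+\sqrt n\,\gamma\Big\}$$ (with $0^{-a}=\infty$ for $a>0$). Moreover, up to multiplicative constants depending only on $\alpha$ and $p$, uniformly in $n\ge1$ and $\sigma>0$, the infimum is of the same order as $$\begin{cases}\sigma^{\{(p\wedge2)-\alpha\}/2}+n^{-1/2}\sigma^{-\alpha}, & \alpha<p\wedge 2,\\ n^{\frac{\alpha-p\wedge2}{2(\alpha+2-p\wedge2)}}+\sigma^{-\frac{\alpha-p\wedge2}{2}}+n^{-1/2}\sigma^{-\alpha},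 & \alpha>p\wedge2.\end{cases}$$ **(2)** Let $\alpha>0$, $\alpha\neq1$, $K>0$. There is a constant $C=C(\alpha,L,K)$ such that for all $n\geq 1$, $\sigma>0$ with $\sigma^2\ge Kn^{-1/(\alpha+1)}$, and all $P$ and $\mathcal F$ as above: if $$\log\mathcal N_{[\,]}\big(\epsilon^2,\mathcal F,\rho_\alpha\big)\le L\epsilon^{-2\alpha}\quad\text{for all }\epsilon\in(0,1],\qquad \rho_\alpha=\begin{cases}\|\cdot\|_{L_1(P)},&\alpha>1,\\ \|\cdot\|_{L_2(P)}^2,&\alpha<1,\end{cases}\tag{A}$$ then $$\mathbb E\sup_{f\in\mathcal F(\sigma)}|\mathbb G_n(f)|\le C\max\big\{\sigma^{1-\alpha},n^{(\alpha-1)/(2(\alpha+1))}\big\}.$$ **(3)** Let $\alpha>0$, $\alpha\neq1$, $K>0$. There is a constant $c=c(\alpha,L,K)>0$ such that for all $n\geq 1$, $\sigma>0$ with $\sigma^2\ge Kn^{-1/(\alpha+1)}$ (and $\sigma\le1$ in the case $\alpha<1$), and all $P$ and $\mathcal F$ as above: if (A) holds and $\mathcal F$ is $\alpha$-full, i.e.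 $$\max\big\{1,\log\mathcal N(\epsilon/2,\mathcal F(\epsilon),L_2(P))\big\}\ge L^{-1}\epsilon^{-2\alpha}\quad\text{for all }\epsilon\in(0,1],$$ then $$\mathbb E\sup_{f\in\mathcal F(\sigma)}|\mathbb G_n(f)|\ge c\max\big\{\sigma^{1-\alpha},n^{(\alpha-1)/(2(\alpha+1))}\big\}.$$ -/

import Mathlib

open MeasureTheory ProbabilityTheory
open scoped ENNReal

universe u v

namespace EmpProc

variable {𝒳 Ω : Type*} [MeasurableSpace 𝒳] [MeasurableSpace Ω]

/-- `X 0, …, X (n-1)` are i.i.d. random variables on `(Ω, μ)` with common law `P`. -/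
def IsIIDSample {n : ℕ} (μ : Measure Ω) (P : Measure 𝒳) (X : Fin n → Ω → 𝒳) : Prop :=
  (∀ i, Measurable (X i)) ∧ iIndepFun X μ ∧ ∀ i, μ.map (X i) = P

/-- The empirical process `𝔾ₙ(f) = n^{-1/2} ∑ᵢ (f(Xᵢ) - P f)`. -/
noncomputable def empG {n : ℕ} (P : Measure 𝒳) (X : Fin n → Ω → 𝒳)
    (f : 𝒳 → ℝ) (ω : Ω) : ℝ :=
  (Real.sqrt n)⁻¹ * ∑ i, (f (X i ω) - ∫ x, f x ∂P)

/-- `𝔼 sup_{f ∈ F} |𝔾ₙ(f)|`, with values in `[0, ∞]`. -/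
noncomputable def expectedSup {n : ℕ} (μ : Measure Ω) (P : Measure 𝒳) (X : Fin n → Ω → 𝒳)
    (F : Set (𝒳 → ℝ)) : ℝ≥0∞ :=
  ∫⁻ ω, ⨆ f ∈ F, ENNReal.ofReal |empG P X f ω| ∂μ

/-- A countable class of measurable functions whose sup-norm is at most `1`. -/
def IsUnitClass (F : Set (𝒳 → ℝ)) : Prop :=
  F.Countable ∧ (∀ f ∈ F, Measurable f) ∧ ∀ f ∈ F, ∀ x, |f x| ≤ 1

/-- The localized class `F(σ) = {f ∈ F : P f² ≤ σ²}`. -/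
def localized (P : Measure 𝒳) (F : Set (𝒳 → ℝ)) (σ : ℝ) : Set (𝒳 → ℝ) :=
  {f ∈ F | ∫ x, f x ^ 2 ∂P ≤ σ ^ 2}

/-- `(ℓ, u)` is an `ε`-bracket when the size of functions is measured by `size`
(a norm, or the square of a norm): `ℓ` and `u` have finite size and `size (u - ℓ) < ε`. -/
def IsBracket (size : (𝒳 → ℝ) → ℝ≥0∞) (ε : ℝ) (b : (𝒳 → ℝ) × (𝒳 → ℝ)) : Prop :=
  (Measurable b.1 ∧ size b.1 < ∞) ∧ (Measurable b.2 ∧ size b.2 < ∞) ∧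
    size (b.2 - b.1) < ENNReal.ofReal ε

/-- The bracketing number: the minimal number of `ε`-brackets needed to cover `F`
(`⊤` if no finite number suffices). -/
noncomputable def bracketingNumber (size : (𝒳 → ℝ) → ℝ≥0∞) (F : Set (𝒳 → ℝ)) (ε : ℝ) : ℕ∞ :=
  ⨅ (B : Set ((𝒳 → ℝ) × (𝒳 → ℝ)))
    (_ : (∀ b ∈ B, IsBracket size ε b) ∧ ∀ f ∈ F, ∃ b ∈ B, b.1 ≤ f ∧ f ≤ b.2), B.encard

/-- The covering number: the minimal number of open balls of radius `ε` needed to cover `F`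
(`⊤` if no finite number suffices). The centers need not lie in `F`, but have finite size. -/
noncomputable def coveringNumber (size : (𝒳 → ℝ) → ℝ≥0∞) (F : Set (𝒳 → ℝ)) (ε : ℝ) : ℕ∞ :=
  ⨅ (T : Set (𝒳 → ℝ))
    (_ : (∀ g ∈ T, Measurable g ∧ size g < ∞) ∧
      ∀ f ∈ F, ∃ g ∈ T, size (f - g) < ENNReal.ofReal ε), T.encard

/-- The logarithm of a covering or bracketing number, with `log ∞ = ∞` and `log 0 = -∞`. -/
noncomputable def logNum (N : ℕ∞) : EReal := ENNReal.log (N : ℝ≥0∞)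

/-- The `L_p(P)` norm, `1 ≤ p < ∞`. -/
noncomputable def lpSize (P : Measure 𝒳) (p : ℝ) (f : 𝒳 → ℝ) : ℝ≥0∞ :=
  eLpNorm f (ENNReal.ofReal p) P

/-- `‖·‖_{L₁(P)}` if `α > 1`, and `‖·‖_{L₂(P)}²` if `α < 1`. -/
noncomputable def mixedSize (P : Measure 𝒳) (α : ℝ) (f : 𝒳 → ℝ) : ℝ≥0∞ :=
  if 1 < α then lpSize P 1 f else lpSize P 2 f ^ 2

/-- `log N_[](ε², F, L₁(P) 1_{α>1} + L₂²(P) 1_{α<1}) ≤ L ε^{-2α}`. -/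
def EntropyUpper (P : Measure 𝒳) (F : Set (𝒳 → ℝ)) (α L : ℝ) : Prop :=
  ∀ ε : ℝ, 0 < ε → ε ≤ 1 →
    logNum (bracketingNumber (mixedSize P α) F (ε ^ 2)) ≤ ((L * ε ^ (-2 * α) : ℝ) : EReal)

/-- `α`-fullness: `log N(ε/2, F(ε), L₂(P)) ≥ L⁻¹ ε^{-2α}`, where `log x` stands for
`log (max e x)`. -/
def AlphaFull (P : Measure 𝒳) (F : Set (𝒳 → ℝ)) (α L : ℝ) : Prop :=
  ∀ ε : ℝ, 0 < ε → ε ≤ 1 →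
    ((L⁻¹ * ε ^ (-2 * α) : ℝ) : EReal) ≤
      max 1 (logNum (coveringNumber (lpSize P 2) (localized P F ε) (ε / 2)))

/-- The infimum over `0 ≤ γ ≤ σ/2` of
`(σ 1_{α<p∧2} + γ 1_{α>p∧2})^{((p∧2)-α)/2} + n^{-1/2} σ^{-α} + √n γ`.
It is computed in `[0, ∞]`, where `0` to a negative power is `∞`. -/
noncomputable def chainingBound (α p : ℝ) (n : ℕ) (σ : ℝ) : ℝ≥0∞ :=
  ⨅ γ ∈ Set.Icc (0 : ℝ) (σ / 2),
    (ENNReal.ofReal ((if α < min p 2 then σ else 0) + (if min p 2 < α then γ else 0))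
        ^ ((min p 2 - α) / 2)
      + ENNReal.ofReal ((n : ℝ) ^ (-(1 / 2) : ℝ) * σ ^ (-α))
      + ENNReal.ofReal (Real.sqrt n * γ))

/-- The explicit form of the bound, in the two cases `α < p∧2` and `α > p∧2`. -/
noncomputable def explicitBound (α p : ℝ) (n : ℕ) (σ : ℝ) : ℝ :=
  if α < min p 2 then
    σ ^ ((min p 2 - α) / 2) + (n : ℝ) ^ (-(1 / 2) : ℝ) * σ ^ (-α)
  else
    (n : ℝ) ^ ((α - min p 2) / (2 * (α + 2 - min p 2))) + σ ^ (-((α - min p 2) / 2))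
      + (n : ℝ) ^ (-(1 / 2) : ℝ) * σ ^ (-α)

/-- The rate `max {σ^{1-α}, n^{(α-1)/(2(α+1))}}`. -/
noncomputable def localRate (α : ℝ) (n : ℕ) (σ : ℝ) : ℝ :=
  max (σ ^ (1 - α)) ((n : ℝ) ^ ((α - 1) / (2 * (α + 1))))

end EmpProc

set_option linter.unusedSectionVars false

namespace EmpProc

/-! ### Exponential moments of `𝔾ₙ` and maxima over finite families. -/

section Basics

variable {𝒳 Ω : Type*} [MeasurableSpace 𝒳] [MeasurableSpace Ω]
  {P : Measure 𝒳} {μ : Measure Ω} {n : ℕ} {X : Fin n → Ω → 𝒳}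

/-! The upper bounds come from bracketing chaining with adaptive truncation. A function is followed
through nested brackets at dyadic scales `δ₀ 2^{-k}` of the second moment. Passing from level `k` to
level `k + 1` adds a link dominated by the bracket width. The chain is stopped at points where this
width exceeds a threshold `t k`. The threshold is tuned so that three quantities coincide up to
constants: the sub-Gaussian and the linear Bernstein term of the link, and the mean of the width
above the threshold. All equal `√(v k * H (k + 1))`, where `v k` bounds second moments and `H` is
the cumulative entropy (`hasEnvelope_chaining`). With `v k ~ δ` and entropy `~ δ^{-α}` the series is
geometric with terms `δ^{(1-α)/2}`. It is governed by the coarsest scale if `α < 1` and by the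
cutoff `γ` if `α > 1` (`exists_expectedSup_le`). Both upper bounds are instances. An `L_p` bracket
of size `ε` gives scale `δ = ε^{p∧2}`, and in the localized bound `δ = ε²`. What remains is the
choice of `γ`.

The lower bound rests on a Sudakov minoration for sums of independent bounded vectors, proved by
interpolation with the soft maximum `β⁻¹ log ∑ exp (β zᵢ)` (`sudakov_minoration`). Adding an
independent centered summand never lowers its expectation, and raises it by a multiple of `β d` as
long as the Gibbs weights are spread out, where `d` bounds the squared separation of the coordinates
from below. If the weights ever concentrate, the soft maximum is already close to the true maximum,
so the entropy `β⁻¹ log |T|` it started from must have become part of the maximum.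

Fullness supplies, in `F(ε)`, about `exp (c ε^{-2α})` functions separated by order `ε` in `L₂(P)`.
Since `𝔾ₙ` ignores constants, the separation has to hold modulo constants
(`exists_separated_or_coveringNumber_le`). The choice `β ~ ε^{-(1+α)}` balances `β⁻¹ ε^{-2α}`
against `β ε²` and yields `ε^{1-α}`. The condition on `σ` makes this `β` compatible with the bound
`2/√n` on the summands, up to constants. Taking `ε` proportional to `σ` if `α < 1`, and to
`n^{-1/(2(α+1))}` if `α > 1`, gives the rate. -/

theorem integrable_of_abs_le [IsFiniteMeasure P] {g : 𝒳 → ℝ} (hg : Measurable g) {b : ℝ}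
    (hb : ∀ x, |g x| ≤ b) : Integrable g P :=
  Integrable.of_bound hg.aestronglyMeasurable b (ae_of_all _ hb)

theorem abs_integral_le_of_abs_le [IsProbabilityMeasure P] {g : 𝒳 → ℝ} {b : ℝ}
    (hb : ∀ x, |g x| ≤ b) : |∫ x, g x ∂P| ≤ b := by
  have := norm_integral_le_of_norm_le_const (μ := P) (f := g) (C := b) (ae_of_all _ hb)
  simpa using this

theorem measurable_empG (hX : ∀ i, Measurable (X i)) {g : 𝒳 → ℝ} (hg : Measurable g) :
    Measurable (empG P X g) := by
  unfold empG
  have := fun i => hg.comp (hX i)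
  simp only [Function.comp_def] at this
  fun_prop

theorem empG_add {f g : 𝒳 → ℝ} (hf : Integrable f P) (hg : Integrable g P) (ω : Ω) :
    empG P X (f + g) ω = empG P X f ω + empG P X g ω := by
  unfold empG
  simp only [Pi.add_apply]
  rw [integral_add hf hg, ← mul_add, ← Finset.sum_add_distrib]
  congr 1
  exact Finset.sum_congr rfl fun i _ => by ring

theorem empG_eq (g : 𝒳 → ℝ) (ω : Ω) :
    empG P X g ω = (√n)⁻¹ * ∑ i, g (X i ω) - √n * ∫ x, g x ∂P := by
  unfold empG
  rw [Finset.sum_sub_distrib, mul_sub]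
  congr 1
  rcases Nat.eq_zero_or_pos n with rfl | h
  · simp
  · have h0 : √(n : ℝ) ≠ 0 := (Real.sqrt_pos.2 (by exact_mod_cast h)).ne'
    simp only [Finset.sum_const, Finset.card_univ, Fintype.card_fin, nsmul_eq_mul]
    rw [← mul_assoc]
    congr 1
    rw [inv_mul_eq_iff_eq_mul₀ h0, Real.mul_self_sqrt (Nat.cast_nonneg n)]

/-- The empirical part and the mean part of `𝔾ₙ` are each monotone on nonnegative functions;
comparing them separately costs only the mean of the majorant. In the chaining this replaces an
uncountable family of remainders by finitely many bracket widths. -/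
theorem abs_empG_le_of_le {g h : 𝒳 → ℝ} (hg : Integrable g P) (hh : Integrable h P)
    (h0 : ∀ x, 0 ≤ g x) (hle : ∀ x, g x ≤ h x) (ω : Ω) :
    |empG P X g ω| ≤ |empG P X h ω| + √n * ∫ x, h x ∂P := by
  have hs : (√n)⁻¹ * ∑ i, g (X i ω) ≤ (√n)⁻¹ * ∑ i, h (X i ω) :=
    mul_le_mul_of_nonneg_left (Finset.sum_le_sum fun i _ => hle _) (by positivity)
  have hs0 : 0 ≤ (√n)⁻¹ * ∑ i, g (X i ω) :=
    mul_nonneg (by positivity) (Finset.sum_nonneg fun i _ => h0 _)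
  have hi : √n * ∫ x, g x ∂P ≤ √n * ∫ x, h x ∂P :=
    mul_le_mul_of_nonneg_left (integral_mono hg hh hle) (by positivity)
  have hi0 : 0 ≤ √n * ∫ x, g x ∂P := mul_nonneg (by positivity) (integral_nonneg h0)
  have := le_abs_self (empG P X h ω)
  have h1 := abs_nonneg (empG P X h ω)
  have h2 := empG_eq (P := P) (X := X) h ω
  rw [abs_le]
  constructor <;> rw [empG_eq g] <;> linarith

/-- Bernstein's bound on the moment generating function of `𝔾ₙ(g)`. -/
theorem integral_exp_empG_le [IsProbabilityMeasure P]
    (hX : IsIIDSample μ P X) (hn : 1 ≤ n) {g : 𝒳 → ℝ} (hg : Measurable g) {b v t : ℝ}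
    (hb : ∀ x, |g x| ≤ b) (hv : ∫ x, g x ^ 2 ∂P ≤ v) (ht : 2 * |t| * b ≤ √n) :
    ∫ ω, Real.exp (t * empG P X g ω) ∂μ ≤ Real.exp (t ^ 2 * v) := by
  obtain ⟨hXm, hXi, hXP⟩ := hX
  have hn0 : (0 : ℝ) < n := by exact_mod_cast hn
  have hsn : 0 < √(n : ℝ) := Real.sqrt_pos.2 hn0
  set m := ∫ x, g x ∂P with hm
  set s := t / √n with hs
  have hmb : |m| ≤ b := abs_integral_le_of_abs_le hb
  have hc : Measurable fun x => g x - m := hg.sub_const m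
  have hcb : ∀ x, |g x - m| ≤ 2 * b := fun x =>
    (abs_sub _ _).trans (by linarith [hb x])
  have hint : Integrable g P := integrable_of_abs_le hg hb
  have hint2 : Integrable (fun x => g x ^ 2) P :=
    integrable_of_abs_le (hg.pow_const 2) (b := b ^ 2) fun x => by
      rw [abs_pow]; exact pow_le_pow_left₀ (abs_nonneg _) (hb x) 2
  have hcint2 : Integrable (fun x => (g x - m) ^ 2) P :=
    integrable_of_abs_le (hc.pow_const 2) (b := (2 * b) ^ 2) fun x => by
      rw [abs_pow]; exact pow_le_pow_left₀ (abs_nonneg _) (hcb x) 2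
  -- The restriction on `t` keeps each exponent in `[-1, 1]`, where `exp y ≤ 1 + y + y ^ 2`; the
  -- linear term then integrates to zero.
  have hY : ∀ x, |s * (g x - m)| ≤ 1 := fun x => by
    rw [abs_mul, hs, abs_div, abs_of_pos hsn, div_mul_eq_mul_div, div_le_one hsn]
    calc |t| * |g x - m| ≤ |t| * (2 * b) := mul_le_mul_of_nonneg_left (hcb x) (abs_nonneg _)
      _ ≤ √n := by linarith
  have hvar : ∫ x, (g x - m) ^ 2 ∂P ≤ v := by
    have : ∫ x, (g x - m) ^ 2 ∂P = ∫ x, g x ^ 2 ∂P - m ^ 2 := by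
      have : (fun x => (g x - m) ^ 2) = fun x => g x ^ 2 - 2 * m * g x + m ^ 2 := by
        funext x; ring
      have i1 : Integrable (fun x => 2 * m * g x) P := hint.const_mul _
      have i2 : Integrable (fun x => g x ^ 2 - 2 * m * g x) P := hint2.sub i1
      rw [this, integral_add i2 (integrable_const _), integral_sub hint2 i1,
        integral_const_mul, ← hm]
      simp
      ring
    nlinarith [sq_nonneg m]
  have hone : ∫ x, Real.exp (s * (g x - m)) ∂P ≤ Real.exp (s ^ 2 * v) := by
    have h1 : ∫ x, Real.exp (s * (g x - m)) ∂P
        ≤ ∫ x, (1 + s * (g x - m) + s ^ 2 * (g x - m) ^ 2) ∂P := by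
      refine integral_mono ?_ ?_ fun x => ?_
      · exact integrable_of_abs_le (by fun_prop) (b := Real.exp 1) fun x => by
          rw [Real.abs_exp]
          exact Real.exp_le_exp.2 ((le_abs_self _).trans (hY x))
      · exact ((integrable_const _).add ((hint.sub (integrable_const _)).const_mul _)).add
          (hcint2.const_mul _)
      · have := (abs_le.1 (Real.abs_exp_sub_one_sub_id_le (hY x))).2
        simp only
        nlinarith
    have h2 : ∫ x, (1 + s * (g x - m) + s ^ 2 * (g x - m) ^ 2) ∂P
        = 1 + s ^ 2 * ∫ x, (g x - m) ^ 2 ∂P := by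
      have i1 : Integrable (fun x => s * (g x - m)) P :=
        (hint.sub (integrable_const _)).const_mul _
      have i2 : Integrable (fun x => 1 + s * (g x - m)) P := (integrable_const _).add i1
      rw [integral_add i2 (hcint2.const_mul _), integral_add (integrable_const _) i1,
        integral_const_mul, integral_const_mul, integral_sub hint (integrable_const _)]
      simp [← hm]
    have h3 := Real.add_one_le_exp (s ^ 2 * v)
    have h4 : s ^ 2 * ∫ x, (g x - m) ^ 2 ∂P ≤ s ^ 2 * v :=
      mul_le_mul_of_nonneg_left hvar (sq_nonneg s)
    linarith
  have hind : iIndepFun (fun i ω => g (X i ω) - m) μ :=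
    hXi.comp (fun _ x => g x - m) fun _ => hc
  have hmgf := hind.mgf_sum (t := s) (fun i => hc.comp (hXm i)) Finset.univ
  have hexp : ∫ ω, Real.exp (t * empG P X g ω) ∂μ
      = mgf (∑ i, fun ω => g (X i ω) - m) μ s := by
    unfold mgf
    refine integral_congr_ae (ae_of_all _ fun ω => ?_)
    simp only [Finset.sum_apply, empG, hs, ← hm]
    congr 1
    ring
  rw [hexp, hmgf]
  have hfac : ∀ i : Fin n, mgf (fun ω => g (X i ω) - m) μ s ≤ Real.exp (s ^ 2 * v) := fun i => by
    refine le_trans (le_of_eq ?_) hone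
    unfold mgf
    rw [← hXP i, integral_map (hXm i).aemeasurable (by fun_prop)]
  calc ∏ i : Fin n, mgf (fun ω => g (X i ω) - m) μ s
      ≤ ∏ _i : Fin n, Real.exp (s ^ 2 * v) :=
        Finset.prod_le_prod (fun i _ => mgf_nonneg) fun i _ => hfac i
    _ = Real.exp (t ^ 2 * v) := by
      rw [Finset.prod_const, Finset.card_univ, Fintype.card_fin, ← Real.exp_nat_mul]
      congr 1
      rw [hs, div_pow, Real.sq_sqrt hn0.le]
      field_simp

theorem integrable_exp_empG [IsProbabilityMeasure P] [IsFiniteMeasure μ]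
    (hX : IsIIDSample μ P X) {g : 𝒳 → ℝ} (hg : Measurable g) {b : ℝ}
    (hb : ∀ x, |g x| ≤ b) (t : ℝ) : Integrable (fun ω => Real.exp (t * empG P X g ω)) μ := by
  have hm := measurable_empG (P := P) hX.1 hg
  refine integrable_of_abs_le (by fun_prop) (b := Real.exp (|t| * ((√n)⁻¹ * (n * (2 * b)))))
    fun ω => ?_
  rw [Real.abs_exp]
  refine Real.exp_le_exp.2 ((le_abs_self _).trans ?_)
  rw [abs_mul]
  refine mul_le_mul_of_nonneg_left ?_ (abs_nonneg _)
  unfold empG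
  rw [abs_mul, abs_of_nonneg (by positivity : 0 ≤ (√(n : ℝ))⁻¹)]
  refine mul_le_mul_of_nonneg_left ?_ (by positivity)
  refine (Finset.abs_sum_le_sum_abs _ _).trans ?_
  refine (Finset.sum_le_card_nsmul _ _ (2 * b) fun i _ => ?_).trans (by simp)
  exact (abs_sub _ _).trans (by linarith [hb (X i ω), abs_integral_le_of_abs_le (P := P) hb])

/-- The functions `𝔾ₙ(g)`, `g ∈ S`, have a common integrable envelope with mean at most `B`. -/
def HasEnvelope (μ : Measure Ω) (P : Measure 𝒳) (X : Fin n → Ω → 𝒳) (S : Set (𝒳 → ℝ))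
    (B : ℝ) : Prop :=
  ∃ W : Ω → ℝ, Integrable W μ ∧ (∀ g ∈ S, ∀ ω, |empG P X g ω| ≤ W ω) ∧ ∫ ω, W ω ∂μ ≤ B

/-- An explicit integrable majorant stands in for the supremum, so measurability of the supremum
never enters. -/
theorem HasEnvelope.expectedSup_le {S : Set (𝒳 → ℝ)} {B : ℝ} (h : HasEnvelope μ P X S B) :
    expectedSup μ P X S ≤ ENNReal.ofReal B := by
  obtain ⟨W, hW, hle, hB⟩ := h
  rcases S.eq_empty_or_nonempty with rfl | ⟨g, hg⟩
  · simp [expectedSup]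
  calc expectedSup μ P X S ≤ ∫⁻ ω, ENNReal.ofReal (W ω) ∂μ :=
        lintegral_mono fun ω => iSup₂_le fun g hg => ENNReal.ofReal_le_ofReal (hle g hg ω)
    _ = ENNReal.ofReal (∫ ω, W ω ∂μ) :=
        (ofReal_integral_eq_lintegral_ofReal hW
          (ae_of_all _ fun ω => (abs_nonneg _).trans (hle g hg ω))).symm
    _ ≤ _ := ENNReal.ofReal_le_ofReal hB

/-- The maximal inequality for finitely many bounded functions. -/
theorem hasEnvelope_of_finite [IsProbabilityMeasure P] [IsProbabilityMeasure μ]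
    (hX : IsIIDSample μ P X) (hn : 1 ≤ n) {S : Set (𝒳 → ℝ)} (hS : S.Finite) {H b v : ℝ}
    (hH : 1 ≤ H) (hcard : (S.ncard : ℝ) ≤ Real.exp H) (hb0 : 0 < b) (hv0 : 0 < v)
    (hm : ∀ g ∈ S, Measurable g) (hb : ∀ g ∈ S, ∀ x, |g x| ≤ b)
    (hv : ∀ g ∈ S, ∫ x, g x ^ 2 ∂P ≤ v) :
    HasEnvelope μ P X S (3 * √(v * H) + 6 * (b * H / √n)) := by
  classical
  have hn0 : (0 : ℝ) < n := by exact_mod_cast hn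
  have hsn : 0 < √(n : ℝ) := Real.sqrt_pos.2 hn0
  have hH0 : 0 < H := by linarith
  -- The first entry equates the Bernstein exponent `t ^ 2 * v` with the entropy `H`; the second is
  -- the largest `t` allowed by the moment generating function bound.
  set t := min (√(H / v)) (√n / (2 * b)) with ht
  have ht0 : 0 < t := lt_min (Real.sqrt_pos.2 (by positivity)) (by positivity)
  have htv : t ^ 2 * v ≤ H := by
    have : t ^ 2 ≤ H / v := by
      rw [← Real.sq_sqrt (by positivity : 0 ≤ H / v)]
      exact pow_le_pow_left₀ ht0.le (min_le_left _ _) 2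
    rwa [le_div_iff₀ hv0] at this
  have htb : 2 * |t| * b ≤ √n := by
    have : t ≤ √n / (2 * b) := min_le_right _ _
    rw [le_div_iff₀ (by positivity)] at this
    rw [abs_of_pos ht0]
    linarith
  set Φ : Ω → ℝ := fun ω => ∑ g ∈ hS.toFinset,
    (Real.exp (t * empG P X g ω) + Real.exp (-t * empG P X g ω)) with hΦ
  have hΦi : Integrable Φ μ := by
    refine integrable_finsetSum _ fun g hg => ?_
    rw [Set.Finite.mem_toFinset] at hg
    exact (integrable_exp_empG hX (hm g hg) (hb g hg) _).add
      (integrable_exp_empG hX (hm g hg) (hb g hg) _)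
  -- Bound for the mean of `Φ`: at most `exp H` functions, two signs, and `exp (t ^ 2 * v) ≤ exp H`
  -- each.
  set c := 2 * Real.exp (2 * H) with hc
  have hc0 : 0 < c := by positivity
  have hΦc : ∫ ω, Φ ω ∂μ ≤ c := by
    rw [integral_finsetSum _ fun g hg => by
      rw [Set.Finite.mem_toFinset] at hg
      exact (integrable_exp_empG hX (hm g hg) (hb g hg) _).add
        (integrable_exp_empG hX (hm g hg) (hb g hg) _)]
    have hterm : ∀ g ∈ hS.toFinset, ∫ ω, (Real.exp (t * empG P X g ω)
        + Real.exp (-t * empG P X g ω)) ∂μ ≤ 2 * Real.exp H := fun g hg => by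
      rw [Set.Finite.mem_toFinset] at hg
      rw [integral_add (integrable_exp_empG hX (hm g hg) (hb g hg) _)
        (integrable_exp_empG hX (hm g hg) (hb g hg) _)]
      have h1 := integral_exp_empG_le hX hn (hm g hg) (hb g hg) (hv g hg) htb
      have h2 := integral_exp_empG_le hX hn (hm g hg) (hb g hg) (hv g hg) (t := -t)
        (by rwa [abs_neg])
      rw [neg_sq] at h2
      have h3 := Real.exp_le_exp.2 htv
      linarith
    refine (Finset.sum_le_card_nsmul _ _ _ hterm).trans ?_
    rw [nsmul_eq_mul, ← Set.ncard_eq_toFinset_card S hS, hc, two_mul H, Real.exp_add]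
    nlinarith [Real.exp_pos H]
  -- The tangent to `log` at `c` replaces Jensen's inequality: it dominates `log Φ` pointwise and is
  -- affine in `Φ`, so its mean is at most `log c ≤ 3 * H`.
  refine ⟨fun ω => t⁻¹ * (Real.log c - 1 + Φ ω / c), ?_, fun g hg ω => ?_, ?_⟩
  · exact ((integrable_const _).add (hΦi.div_const c)).const_mul _
  · have hle : Real.exp (t * |empG P X g ω|) ≤ Φ ω := by
      have h1 : Real.exp (t * |empG P X g ω|) ≤
          Real.exp (t * empG P X g ω) + Real.exp (-t * empG P X g ω) := by
        rcases abs_cases (empG P X g ω) with ⟨h, _⟩ | ⟨h, _⟩ <;> rw [h]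
        · linarith [Real.exp_pos (-t * empG P X g ω)]
        · rw [mul_neg, ← neg_mul]
          linarith [Real.exp_pos (t * empG P X g ω)]
      refine h1.trans (Finset.single_le_sum
        (f := fun g => Real.exp (t * empG P X g ω) + Real.exp (-t * empG P X g ω))
        (fun g _ => by positivity) (hS.mem_toFinset.2 hg))
    have hpos : 0 < Φ ω := (Real.exp_pos _).trans_le hle
    have h1 : t * |empG P X g ω| ≤ Real.log (Φ ω) := (Real.le_log_iff_exp_le hpos).2 hle
    have h2 := Real.log_le_sub_one_of_pos (div_pos hpos hc0)
    rw [Real.log_div hpos.ne' hc0.ne'] at h2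
    rw [le_inv_mul_iff₀ ht0]
    linarith
  · rw [integral_const_mul, integral_add (integrable_const _) (hΦi.div_const c), integral_div]
    simp only [integral_const, probReal_univ, one_smul]
    have h1 : (∫ ω, Φ ω ∂μ) / c ≤ 1 := (div_le_one hc0).2 hΦc
    have h2 : Real.log c ≤ 3 * H := by
      rw [hc, Real.log_mul (by norm_num) (Real.exp_pos _).ne', Real.log_exp]
      have := Real.log_two_lt_d9
      linarith
    have h3 : t⁻¹ ≤ √(v / H) + 2 * b / √n := by
      rcases min_choice (√(H / v)) (√n / (2 * b)) with h | h <;> rw [ht, h]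
      · rw [← Real.sqrt_inv, inv_div]
        have : 0 ≤ 2 * b / √n := by positivity
        linarith
      · rw [inv_div]
        have := Real.sqrt_nonneg (v / H)
        linarith
    have h4 : √(v / H) * H = √(v * H) := by
      have : v * H = v / H * H ^ 2 := by field_simp
      rw [this, Real.sqrt_mul (by positivity), Real.sqrt_sq hH0.le]
    calc t⁻¹ * (Real.log c - 1 + (∫ ω, Φ ω ∂μ) / c) ≤ t⁻¹ * (3 * H) :=
          mul_le_mul_of_nonneg_left (by linarith) (by positivity)
      _ ≤ (√(v / H) + 2 * b / √n) * (3 * H) := mul_le_mul_of_nonneg_right h3 (by positivity)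
      _ = 3 * √(v * H) + 6 * (b * H / √n) := by rw [← h4]; ring

end Basics

/-! ### Nested brackets and adaptive truncation. -/

section Chaining

variable {𝒳 Ω : Type*} [MeasurableSpace 𝒳] [MeasurableSpace Ω]
  {P : Measure 𝒳} {μ : Measure Ω} {n : ℕ} {X : Fin n → Ω → 𝒳}

theorem HasEnvelope.of_le_add [IsProbabilityMeasure μ] {S S₁ S₂ : Set (𝒳 → ℝ)} {B₁ B₂ c : ℝ}
    (h₁ : HasEnvelope μ P X S₁ B₁) (h₂ : HasEnvelope μ P X S₂ B₂)
    (h : ∀ f ∈ S, ∃ g₁ ∈ S₁, ∃ g₂ ∈ S₂, ∀ ω,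
      |empG P X f ω| ≤ |empG P X g₁ ω| + |empG P X g₂ ω| + c) :
    HasEnvelope μ P X S (B₁ + B₂ + c) := by
  obtain ⟨W₁, hi₁, hW₁, hB₁⟩ := h₁
  obtain ⟨W₂, hi₂, hW₂, hB₂⟩ := h₂
  refine ⟨fun ω => W₁ ω + W₂ ω + c, (hi₁.add hi₂).add (integrable_const c), fun f hf ω => ?_, ?_⟩
  · obtain ⟨g₁, hg₁, g₂, hg₂, hle⟩ := h f hf
    linarith [hle ω, hW₁ g₁ hg₁ ω, hW₂ g₂ hg₂ ω]
  · have : Integrable (fun ω => W₁ ω + W₂ ω) μ := hi₁.add hi₂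
    rw [integral_add this (integrable_const c), integral_add hi₁ hi₂]
    simp
    linarith

theorem HasEnvelope.of_le [IsProbabilityMeasure μ] {S S₁ : Set (𝒳 → ℝ)} {B₁ c : ℝ}
    (h₁ : HasEnvelope μ P X S₁ B₁)
    (h : ∀ f ∈ S, ∃ g₁ ∈ S₁, ∀ ω, |empG P X f ω| ≤ |empG P X g₁ ω| + c) :
    HasEnvelope μ P X S (B₁ + c) := by
  obtain ⟨W₁, hi₁, hW₁, hB₁⟩ := h₁
  refine ⟨fun ω => W₁ ω + c, hi₁.add (integrable_const c), fun f hf ω => ?_, ?_⟩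
  · obtain ⟨g₁, hg₁, hle⟩ := h f hf
    linarith [hle ω, hW₁ g₁ hg₁ ω]
  · rw [integral_add hi₁ (integrable_const c)]
    simp
    linarith

theorem HasEnvelope.mono {S : Set (𝒳 → ℝ)} {B B' : ℝ}
    (h : HasEnvelope μ P X S B) (hB : B ≤ B') : HasEnvelope μ P X S B' := by
  obtain ⟨W, hi, hW, hWB⟩ := h
  exact ⟨W, hi, hW, hWB.trans hB⟩

/-- Cardinalities multiply when a level of the chain is computed from the previous level and one new
bracket, so log-cardinalities add. -/
theorem image_pair_finite {α β γ δ : Type*} {S : Set α} {s : α → β} {t : α → γ}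
    (hs : (s '' S).Finite) (ht : (t '' S).Finite) (φ : β → γ → δ) :
    ((fun a => φ (s a) (t a)) '' S).Finite ∧
      ((fun a => φ (s a) (t a)) '' S).ncard ≤ (s '' S).ncard * (t '' S).ncard := by
  have hsub : (fun a => φ (s a) (t a)) '' S ⊆
      (fun p : β × γ => φ p.1 p.2) '' ((s '' S) ×ˢ (t '' S)) := by
    rintro _ ⟨a, ha, rfl⟩
    exact ⟨(s a, t a), ⟨⟨a, ha, rfl⟩, ⟨a, ha, rfl⟩⟩, rfl⟩
  have hfin := hs.prod ht
  refine ⟨(hfin.image _).subset hsub, ?_⟩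
  calc _ ≤ _ := Set.ncard_le_ncard hsub (hfin.image _)
    _ ≤ _ := Set.ncard_image_le hfin
    _ = _ := Set.ncard_prod

theorem image_comp_finite {α β δ : Type*} {S : Set α} {s : α → β}
    (hs : (s '' S).Finite) (φ : β → δ) :
    ((fun a => φ (s a)) '' S).Finite ∧ ((fun a => φ (s a)) '' S).ncard ≤ (s '' S).ncard := by
  have : (fun a => φ (s a)) '' S = φ '' (s '' S) := (Set.image_image φ s S).symm
  rw [this]
  exact ⟨hs.image _, Set.ncard_image_le hs⟩

/-- Refine the bracket `(s.1.1, s.1.2)` by `b` and remove the points where its width is more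
than `t`. -/
def chainStep (t : ℝ) (s : ((𝒳 → ℝ) × (𝒳 → ℝ)) × Set 𝒳) (b : (𝒳 → ℝ) × (𝒳 → ℝ)) :
    ((𝒳 → ℝ) × (𝒳 → ℝ)) × Set 𝒳 :=
  ((fun x => max (s.1.1 x) (b.1 x), fun x => min (s.1.2 x) (b.2 x)),
    s.2 ∩ {x | s.1.2 x - s.1.1 x ≤ t})

/-- The nested brackets of `f` and the sets on which all earlier widths are small. -/
def chain (t : ℕ → ℝ) (br : ℕ → (𝒳 → ℝ) → (𝒳 → ℝ) × (𝒳 → ℝ)) :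
    ℕ → (𝒳 → ℝ) → ((𝒳 → ℝ) × (𝒳 → ℝ)) × Set 𝒳
  | 0, f => (br 0 f, Set.univ)
  | k + 1, f => chainStep (t k) (chain t br k f) (br (k + 1) f)

/-- `b` is a bracket of `f` whose two functions are measurable with values in `[-1, 1]`. -/
def IsUnitBracket (f : 𝒳 → ℝ) (b : (𝒳 → ℝ) × (𝒳 → ℝ)) : Prop :=
  Measurable b.1 ∧ Measurable b.2 ∧ ∀ x, -1 ≤ b.1 x ∧ b.1 x ≤ f x ∧ f x ≤ b.2 x ∧ b.2 x ≤ 1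

variable {F : Set (𝒳 → ℝ)} {t : ℕ → ℝ} {br : ℕ → (𝒳 → ℝ) → (𝒳 → ℝ) × (𝒳 → ℝ)}

theorem isUnitBracket_chain {f : 𝒳 → ℝ} (hbr : ∀ k, IsUnitBracket f (br k f)) (k : ℕ) :
    IsUnitBracket f (chain t br k f).1 ∧ MeasurableSet (chain t br k f).2 := by
  induction k with
  | zero => exact ⟨hbr 0, MeasurableSet.univ⟩
  | succ k ih =>
    obtain ⟨⟨h1, h2, h3⟩, h4⟩ := ih
    obtain ⟨g1, g2, g3⟩ := hbr (k + 1)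
    refine ⟨⟨h1.max g1, h2.min g2, fun x => ⟨?_, ?_, ?_, ?_⟩⟩,
      h4.inter (measurableSet_le (h2.sub h1) measurable_const)⟩
    · exact (h3 x).1.trans (le_max_left _ _)
    · exact max_le (h3 x).2.1 (g3 x).2.1
    · exact le_min (h3 x).2.2.1 (g3 x).2.2.1
    · exact (min_le_left _ _).trans (h3 x).2.2.2

theorem chain_width_le (k : ℕ) (f : 𝒳 → ℝ) (x : 𝒳) :
    (chain t br k f).1.2 x - (chain t br k f).1.1 x ≤ (br k f).2 x - (br k f).1 x := by
  cases k with
  | zero => exact le_rfl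
  | succ k => exact sub_le_sub (min_le_right _ _) (le_max_right _ _)

theorem chain_width_succ_le (k : ℕ) (f : 𝒳 → ℝ) (x : 𝒳) :
    (chain t br (k + 1) f).1.2 x - (chain t br (k + 1) f).1.1 x
      ≤ (chain t br k f).1.2 x - (chain t br k f).1.1 x :=
  sub_le_sub (min_le_left _ _) (le_max_left _ _)

/-- Level `k` is determined by the first `k + 1` brackets, including the truncation set, which
depends only on widths. Hence its entropy is at most the partial sum of the `h j`, which `H k`
dominates. -/
theorem chain_finite {h H : ℕ → ℝ} (hfin : ∀ k, (br k '' F).Finite)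
    (hcard : ∀ k, ((br k '' F).ncard : ℝ) ≤ Real.exp (h k))
    (hH0 : h 0 ≤ H 0) (hH : ∀ k, H k + h (k + 1) ≤ H (k + 1)) (k : ℕ) :
    (chain t br k '' F).Finite ∧ ((chain t br k '' F).ncard : ℝ) ≤ Real.exp (H k) := by
  induction k with
  | zero =>
    obtain ⟨h1, h2⟩ := image_comp_finite (hfin 0) (fun b => (b, (Set.univ : Set 𝒳)))
    refine ⟨h1, le_trans (le_trans (Nat.cast_le.2 h2) (hcard 0)) (Real.exp_le_exp.2 hH0)⟩
  | succ k ih =>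
    obtain ⟨h1, h2⟩ := image_pair_finite ih.1 (hfin (k + 1)) (chainStep (t k))
    refine ⟨h1, le_trans (Nat.cast_le.2 h2) ?_⟩
    rw [Nat.cast_mul]
    calc _ ≤ Real.exp (H k) * Real.exp (h (k + 1)) :=
          mul_le_mul ih.2 (hcard _) (Nat.cast_nonneg _) (Real.exp_pos _).le
      _ = Real.exp (H k + h (k + 1)) := (Real.exp_add _ _).symm
      _ ≤ _ := Real.exp_le_exp.2 (hH k)

/-- The link between two consecutive levels of the chain. -/
noncomputable def chainLink (s : ((𝒳 → ℝ) × (𝒳 → ℝ)) × Set 𝒳)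
    (s' : ((𝒳 → ℝ) × (𝒳 → ℝ)) × Set 𝒳) : 𝒳 → ℝ :=
  s'.2.indicator fun x => s'.1.1 x - s.1.1 x

/-- The width of the bracket on a set `A`. -/
noncomputable def chainWidth (s : ((𝒳 → ℝ) × (𝒳 → ℝ)) × Set 𝒳) (A : Set 𝒳) : 𝒳 → ℝ :=
  (s.2 ∩ A).indicator fun x => s.1.2 x - s.1.1 x

/-- The distance of `f` to the lower end of the bracket. -/
noncomputable def chainRem (s : ((𝒳 → ℝ) × (𝒳 → ℝ)) × Set 𝒳) (f : 𝒳 → ℝ) : 𝒳 → ℝ :=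
  s.2.indicator fun x => f x - s.1.1 x

theorem integral_sq_mono [IsProbabilityMeasure P] {f g : 𝒳 → ℝ} (hf : Measurable f)
    (hg : Measurable g) {b : ℝ} (hb : ∀ x, |g x| ≤ b) (hfg : ∀ x, |f x| ≤ |g x|) :
    ∫ x, f x ^ 2 ∂P ≤ ∫ x, g x ^ 2 ∂P := by
  have aux : ∀ k : 𝒳 → ℝ, Measurable k → (∀ x, |k x| ≤ b) → Integrable (fun x => k x ^ 2) P :=
    fun k hk hkb => integrable_of_abs_le (hk.pow_const 2) (b := b ^ 2) fun x => by
      rw [abs_pow]; exact pow_le_pow_left₀ (abs_nonneg _) (hkb x) 2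
  refine integral_mono (aux f hf fun x => (hfg x).trans (hb x)) (aux g hg hb) fun x => ?_
  exact sq_le_sq.2 (hfg x)

/-- Chaining with adaptive truncation. -/
theorem hasEnvelope_chaining [IsProbabilityMeasure P] [IsProbabilityMeasure μ]
    (hX : IsIIDSample μ P X) (hn : 1 ≤ n) {h H v e : ℕ → ℝ}
    (hF : ∀ f ∈ F, Measurable f) (hF2 : ∀ f ∈ F, ∫ x, f x ^ 2 ∂P ≤ v 0)
    (hbr : ∀ f ∈ F, ∀ k, IsUnitBracket f (br k f))
    (hbv : ∀ f ∈ F, ∀ k, ∫ x, ((br k f).2 x - (br k f).1 x) ^ 2 ∂P ≤ v k)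
    (hbe : ∀ f ∈ F, ∀ k, ∫ x, ((br k f).2 x - (br k f).1 x) ∂P ≤ e k)
    (hfin : ∀ k, (br k '' F).Finite) (hcard : ∀ k, ((br k '' F).ncard : ℝ) ≤ Real.exp (h k))
    (hv : ∀ k, 0 < v k) (hh : ∀ k, 1 ≤ h k)
    (hH0 : h 0 ≤ H 0) (hH : ∀ k, H k + h (k + 1) ≤ H (k + 1)) (K : ℕ) :
    HasEnvelope μ P X F (18 * (H 0 / √n)
      + 25 * ∑ k ∈ Finset.range (K + 1), √(v k * H (k + 1)) + √n * e K) := by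
  have hn0 : (0 : ℝ) < n := by exact_mod_cast hn
  have hsn : 0 < √(n : ℝ) := Real.sqrt_pos.2 hn0
  have hH1 : ∀ k, 1 ≤ H k := fun k => by
    induction k with
    | zero => exact (hh 0).trans hH0
    | succ k ih => linarith [hH k, hh (k + 1)]
  have hHm : ∀ k, H k ≤ H (k + 1) := fun k => by linarith [hH k, hh (k + 1)]
  set D : ℕ → ℝ := fun k => √(v k * H (k + 1)) with hD
  have hD0 : ∀ k, 0 ≤ D k := fun k => Real.sqrt_nonneg _
  have hDle : ∀ k, √(v k * H k) ≤ D k := fun k =>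
    Real.sqrt_le_sqrt (mul_le_mul_of_nonneg_left (hHm k) (hv k).le)
  -- This threshold equalizes the two truncation costs: the linear Bernstein term `t k * H (k + 1) /
  -- √n` of the link and the mean `√n * (v k / t k)` of the width above the threshold are both
  -- exactly `D k`.
  set t : ℕ → ℝ := fun k => √n * √(v k / H (k + 1)) with ht
  have hvH : ∀ k, 0 < v k / H (k + 1) := fun k =>
    div_pos (hv k) (zero_lt_one.trans_le (hH1 _))
  have ht0 : ∀ k, 0 < t k := fun k => mul_pos hsn (Real.sqrt_pos.2 (hvH k))
  have hsq : ∀ k, √(v k / H (k + 1)) * H (k + 1) = D k := fun k => by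
    have hp := zero_lt_one.trans_le (hH1 (k + 1))
    have : v k * H (k + 1) = v k / H (k + 1) * H (k + 1) ^ 2 := by field_simp
    rw [hD]
    simp only
    rw [this, Real.sqrt_mul (hvH k).le, Real.sqrt_sq hp.le]
  have htD : ∀ k, t k * H (k + 1) / √n = D k := fun k => by
    rw [← hsq, ht]
    field_simp
  have htv : ∀ k, √n * (v k / t k) = D k := fun k => by
    have h1 : v k = √(v k / H (k + 1)) * D k := by
      rw [← hsq, ← mul_assoc, Real.mul_self_sqrt (hvH k).le]
      exact (div_mul_cancel₀ _ (zero_lt_one.trans_le (hH1 _)).ne').symm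
    have h2 := Real.sqrt_pos.2 (hvH k)
    rw [ht]
    simp only
    nth_rewrite 1 [h1]
    field_simp
  -- Sup-norm bound for the width on the surviving set: `2` at level `0` since the brackets lie in
  -- `[-1, 1]`, and the threshold of the preceding level afterwards.
  set M : ℕ → ℝ := fun k => Nat.casesOn k 2 t with hM
  have hM0 : ∀ k, 0 < M k := fun k => by
    cases k with
    | zero => exact two_pos
    | succ k => exact ht0 k
  have hcb := fun f hf => isUnitBracket_chain (t := t) (hbr f hf)
  have hcf := chain_finite (t := t) hfin hcard hH0 hH
  have hw0 : ∀ f ∈ F, ∀ k x, 0 ≤ (chain t br k f).1.2 x - (chain t br k f).1.1 x :=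
    fun f hf k x => by
      have := (hcb f hf k).1.2.2 x
      linarith
  have hw2 : ∀ f ∈ F, ∀ k x, (chain t br k f).1.2 x - (chain t br k f).1.1 x ≤ 2 :=
    fun f hf k x => by
      have := (hcb f hf k).1.2.2 x
      linarith
  have hwM : ∀ f ∈ F, ∀ k, ∀ x ∈ (chain t br k f).2,
      (chain t br k f).1.2 x - (chain t br k f).1.1 x ≤ M k := fun f hf k x hx => by
    cases k with
    | zero => exact hw2 f hf 0 x
    | succ k => exact (chain_width_succ_le k f x).trans hx.2
  have hwm : ∀ f ∈ F, ∀ k, Measurable fun x =>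
      (chain t br k f).1.2 x - (chain t br k f).1.1 x := fun f hf k =>
    (hcb f hf k).1.2.1.sub (hcb f hf k).1.1
  have hbrm : ∀ f ∈ F, ∀ k, Measurable fun x => (br k f).2 x - (br k f).1 x := fun f hf k =>
    (hbr f hf k).2.1.sub (hbr f hf k).1
  have hbr2 : ∀ f ∈ F, ∀ k x, |(br k f).2 x - (br k f).1 x| ≤ 2 := fun f hf k x => by
    have := (hbr f hf k).2.2 x
    rw [abs_le]
    constructor <;> linarith
  have hwv : ∀ f ∈ F, ∀ k, ∀ g : 𝒳 → ℝ, Measurable g →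
      (∀ x, |g x| ≤ (chain t br k f).1.2 x - (chain t br k f).1.1 x) →
      ∫ x, g x ^ 2 ∂P ≤ v k := fun f hf k g hg hgle =>
    (integral_sq_mono hg (hbrm f hf k) (hbr2 f hf k) fun x =>
      ((hgle x).trans (chain_width_le k f x)).trans (le_abs_self _)).trans (hbv f hf k)
  have hwidth_abs : ∀ f ∈ F, ∀ k A x, |chainWidth (chain t br k f) A x|
      ≤ (chain t br k f).1.2 x - (chain t br k f).1.1 x := fun f hf k A x => by
    unfold chainWidth
    by_cases hx : x ∈ (chain t br k f).2 ∩ A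
    · rw [Set.indicator_of_mem hx, abs_of_nonneg (hw0 f hf k x)]
    · rw [Set.indicator_of_notMem hx, abs_zero]
      exact hw0 f hf k x
  have hwidth_M : ∀ f ∈ F, ∀ k A x, |chainWidth (chain t br k f) A x| ≤ M k :=
    fun f hf k A x => by
      unfold chainWidth
      by_cases hx : x ∈ (chain t br k f).2 ∩ A
      · rw [Set.indicator_of_mem hx, abs_of_nonneg (hw0 f hf k x)]
        exact hwM f hf k x hx.1
      · rw [Set.indicator_of_notMem hx, abs_zero]
        exact (hM0 k).le
  have hwidth_m : ∀ f ∈ F, ∀ k A, MeasurableSet A →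
      Measurable (chainWidth (chain t br k f) A) := fun f hf k A hA =>
    (hwm f hf k).indicator ((hcb f hf k).2.inter hA)
  have hwidth_i : ∀ f ∈ F, ∀ k A, MeasurableSet A →
      Integrable (chainWidth (chain t br k f) A) P := fun f hf k A hA =>
    integrable_of_abs_le (hwidth_m f hf k A hA) (hwidth_M f hf k A)
  have hrem_m : ∀ f ∈ F, ∀ k, Measurable (chainRem (chain t br k f) f) := fun f hf k =>
    ((hF f hf).sub (hcb f hf k).1.1).indicator (hcb f hf k).2
  have hrem_le : ∀ f ∈ F, ∀ k (A : Set 𝒳), ∀ x, |A.indicator (chainRem (chain t br k f) f) x|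
      ≤ 2 := fun f hf k A x => by
    have h1 := (hcb f hf k).1.2.2 x
    unfold chainRem
    rw [Set.indicator_indicator]
    by_cases hx : x ∈ A ∩ (chain t br k f).2
    · rw [Set.indicator_of_mem hx, abs_le]
      constructor <;> linarith
    · rw [Set.indicator_of_notMem hx, abs_zero]
      exact two_pos.le
  -- the sets where the truncation stops the chain
  set A : ℕ → (𝒳 → ℝ) → Set 𝒳 := fun k f =>
    {x | t k < (chain t br k f).1.2 x - (chain t br k f).1.1 x} with hA
  have hAm : ∀ f ∈ F, ∀ k, MeasurableSet (A k f) := fun f hf k =>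
    measurableSet_lt measurable_const (hwm f hf k)
  have hE_big : ∀ k, HasEnvelope μ P X
      ((fun f => chainWidth (chain t br k f) (A k f)) '' F) (3 * D k + 6 * (M k * H k / √n)) := by
    intro k
    obtain ⟨h1, h2⟩ := image_comp_finite (hcf k).1
      (fun s => chainWidth s {x | t k < s.1.2 x - s.1.1 x})
    refine (hasEnvelope_of_finite hX hn h1 (hH1 k) ((Nat.cast_le.2 h2).trans (hcf k).2)
      (hM0 k) (hv k) ?_ ?_ ?_).mono (by linarith [hDle k])
    · rintro _ ⟨f, hf, rfl⟩
      exact hwidth_m f hf k _ (hAm f hf k)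
    · rintro _ ⟨f, hf, rfl⟩
      exact hwidth_M f hf k _
    · rintro _ ⟨f, hf, rfl⟩
      exact hwv f hf k _ (hwidth_m f hf k _ (hAm f hf k)) (hwidth_abs f hf k _)
  have hE_last : ∀ k, HasEnvelope μ P X
      ((fun f => chainWidth (chain t br k f) Set.univ) '' F)
      (3 * D k + 6 * (M k * H k / √n)) := by
    intro k
    obtain ⟨h1, h2⟩ := image_comp_finite (hcf k).1 (fun s => chainWidth s Set.univ)
    refine (hasEnvelope_of_finite hX hn h1 (hH1 k) ((Nat.cast_le.2 h2).trans (hcf k).2)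
      (hM0 k) (hv k) ?_ ?_ ?_).mono (by linarith [hDle k])
    · rintro _ ⟨f, hf, rfl⟩
      exact hwidth_m f hf k _ MeasurableSet.univ
    · rintro _ ⟨f, hf, rfl⟩
      exact hwidth_M f hf k _
    · rintro _ ⟨f, hf, rfl⟩
      exact hwv f hf k _ (hwidth_m f hf k _ MeasurableSet.univ) (hwidth_abs f hf k _)
  have hlink_m : ∀ f ∈ F, ∀ k,
      Measurable (chainLink (chain t br k f) (chain t br (k + 1) f)) := fun f hf k =>
    ((hcb f hf (k + 1)).1.1.sub (hcb f hf k).1.1).indicator (hcb f hf (k + 1)).2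
  have hlink_w : ∀ f ∈ F, ∀ k x, |(chain t br (k + 1) f).1.1 x - (chain t br k f).1.1 x|
      ≤ (chain t br k f).1.2 x - (chain t br k f).1.1 x := fun f hf k x => by
    have h1 := (hcb f hf (k + 1)).1.2.2 x
    have h2 := (hcb f hf k).1.2.2 x
    have h3 : (chain t br k f).1.1 x ≤ (chain t br (k + 1) f).1.1 x := le_max_left _ _
    rw [abs_of_nonneg (by linarith)]
    linarith
  have hlink_t : ∀ f ∈ F, ∀ k x,
      |chainLink (chain t br k f) (chain t br (k + 1) f) x| ≤ t k := fun f hf k x => by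
    unfold chainLink
    by_cases hx : x ∈ (chain t br (k + 1) f).2
    · rw [Set.indicator_of_mem hx]
      exact (hlink_w f hf k x).trans hx.2
    · rw [Set.indicator_of_notMem hx, abs_zero]
      exact (ht0 k).le
  have hlink_abs : ∀ f ∈ F, ∀ k x, |chainLink (chain t br k f) (chain t br (k + 1) f) x|
      ≤ (chain t br k f).1.2 x - (chain t br k f).1.1 x := fun f hf k x => by
    unfold chainLink
    by_cases hx : x ∈ (chain t br (k + 1) f).2
    · rw [Set.indicator_of_mem hx]
      exact hlink_w f hf k x
    · rw [Set.indicator_of_notMem hx, abs_zero]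
      exact hw0 f hf k x
  have hE_link : ∀ k, HasEnvelope μ P X
      ((fun f => chainLink (chain t br k f) (chain t br (k + 1) f)) '' F) (9 * D k) := by
    intro k
    obtain ⟨h1, h2⟩ := image_pair_finite (hcf k).1 (hfin (k + 1))
      (fun s b => chainLink s (chainStep (t k) s b))
    have h3 : (((fun f => chainLink (chain t br k f) (chain t br (k + 1) f)) '' F).ncard : ℝ)
        ≤ Real.exp (H (k + 1)) := by
      refine (Nat.cast_le.2 h2).trans ?_
      rw [Nat.cast_mul]
      calc _ ≤ Real.exp (H k) * Real.exp (h (k + 1)) :=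
            mul_le_mul (hcf k).2 (hcard _) (Nat.cast_nonneg _) (Real.exp_pos _).le
        _ = Real.exp (H k + h (k + 1)) := (Real.exp_add _ _).symm
        _ ≤ _ := Real.exp_le_exp.2 (hH k)
    refine (hasEnvelope_of_finite hX hn h1 (hH1 (k + 1)) h3 (ht0 k) (hv k) ?_ ?_ ?_).mono
      (by rw [htD]; simp only [hD]; linarith)
    · rintro _ ⟨f, hf, rfl⟩
      exact hlink_m f hf k
    · rintro _ ⟨f, hf, rfl⟩
      exact hlink_t f hf k
    · rintro _ ⟨f, hf, rfl⟩
      exact hwv f hf k _ (hlink_m f hf k) (hlink_abs f hf k)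
  have hrem0 : ∀ f ∈ F, ∀ k (B : Set 𝒳), ∀ x, 0 ≤ B.indicator (chainRem (chain t br k f) f) x :=
    fun f hf k B x => Set.indicator_nonneg (fun y _ => Set.indicator_nonneg
      (fun y _ => by linarith [(hcb f hf k).1.2.2 y]) y) x
  have hremw : ∀ f ∈ F, ∀ k (B : Set 𝒳), ∀ x, B.indicator (chainRem (chain t br k f) f) x
      ≤ chainWidth (chain t br k f) B x := fun f hf k B x => by
    unfold chainRem chainWidth
    rw [Set.indicator_indicator, Set.inter_comm]
    exact Set.indicator_le_indicator (by linarith [(hcb f hf k).1.2.2 x])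
  have hrem_i : ∀ f ∈ F, ∀ k (B : Set 𝒳), MeasurableSet B →
      Integrable (B.indicator (chainRem (chain t br k f) f)) P := fun f hf k B hB =>
    integrable_of_abs_le ((hrem_m f hf k).indicator hB) (hrem_le f hf k B)
  have hlink_i : ∀ f ∈ F, ∀ k,
      Integrable (chainLink (chain t br k f) (chain t br (k + 1) f)) P := fun f hf k =>
    integrable_of_abs_le (hlink_m f hf k) (hlink_t f hf k)
  -- Where the width exceeds `t k` the chain stops and the remainder stays as it is. Elsewhere on
  -- the surviving set the remainder splits into a link and the next remainder.
  have hrem_eq : ∀ f k, chainRem (chain t br k f) f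
      = (A k f).indicator (chainRem (chain t br k f) f)
        + (chainLink (chain t br k f) (chain t br (k + 1) f)
          + Set.univ.indicator (chainRem (chain t br (k + 1) f) f)) := fun f k => by
    funext x
    have hmem : x ∈ (chain t br (k + 1) f).2 ↔ x ∈ (chain t br k f).2 ∧ x ∉ A k f := by
      simp only [hA, Set.mem_ofPred_eq, not_lt]
      exact Iff.rfl
    simp only [Pi.add_apply, Set.indicator_univ, chainRem, chainLink]
    by_cases h1 : x ∈ (chain t br k f).2 <;> by_cases h2 : x ∈ A k f
    · have h3 : x ∉ (chain t br (k + 1) f).2 := fun h => (hmem.1 h).2 h2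
      simp [h1, h2, h3]
    · have h3 : x ∈ (chain t br (k + 1) f).2 := hmem.2 ⟨h1, h2⟩
      simp [h1, h2, h3]
    · have h3 : x ∉ (chain t br (k + 1) f).2 := fun h => h1 (hmem.1 h).1
      simp [h1, h2, h3]
    · have h3 : x ∉ (chain t br (k + 1) f).2 := fun h => h1 (hmem.1 h).1
      simp [h1, h2, h3]
  -- On `A k f` the width `w` satisfies `t k * w ≤ w ^ 2`, as in Markov's inequality.
  have hbigP : ∀ f ∈ F, ∀ k, √n * ∫ x, chainWidth (chain t br k f) (A k f) x ∂P ≤ D k := by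
    intro f hf k
    rw [← htv k]
    refine mul_le_mul_of_nonneg_left ?_ hsn.le
    rw [le_div_iff₀ (ht0 k), mul_comm, ← integral_const_mul]
    refine le_trans (integral_mono ((hwidth_i f hf k _ (hAm f hf k)).const_mul _) ?_ fun x => ?_)
      (hwv f hf k _ (hwm f hf k) fun x => (abs_of_nonneg (hw0 f hf k x)).le)
    · exact integrable_of_abs_le ((hwm f hf k).pow_const 2) (b := 2 ^ 2) fun x => by
        rw [abs_of_nonneg (sq_nonneg _)]
        exact pow_le_pow_left₀ (hw0 f hf k x) (hw2 f hf k x) 2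
    · simp only [chainWidth]
      by_cases hx : x ∈ (chain t br k f).2 ∩ A k f
      · rw [Set.indicator_of_mem hx, sq]
        exact mul_le_mul_of_nonneg_right (le_of_lt hx.2) (hw0 f hf k x)
      · rw [Set.indicator_of_notMem hx, mul_zero]
        positivity
  have hlastP : ∀ f ∈ F, ∀ k, ∫ x, chainWidth (chain t br k f) Set.univ x ∂P ≤ e k := by
    intro f hf k
    refine le_trans (integral_mono (hwidth_i f hf k _ MeasurableSet.univ)
      (integrable_of_abs_le (hbrm f hf k) (hbr2 f hf k)) fun x => ?_) (hbe f hf k)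
    exact (le_abs_self _).trans ((hwidth_abs f hf k _ x).trans (chain_width_le k f x))
  -- Induction on the number `m` of levels still to be descended, for all starting levels. One step
  -- costs `19 * D k`: `3` and `1` for the variance and mean of the stopped part, `9` for the link,
  -- and `6` because the leading term at level `k + 1` equals `6 * D k`.
  have hrec : ∀ m k, HasEnvelope μ P X ((fun f => chainRem (chain t br k f) f) '' F)
      (6 * (M k * H k / √n) + 19 * ∑ j ∈ Finset.range m, D (k + j) + 3 * D (k + m)
        + √n * e (k + m)) := by
    intro m
    induction m with
    | zero =>
      intro k
      refine ((hE_last k).of_le (c := √n * e k) ?_).mono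
        (by simp only [Finset.range_zero, Finset.sum_empty, add_zero]; linarith)
      rintro _ ⟨f, hf, rfl⟩
      refine ⟨_, ⟨f, hf, rfl⟩, fun ω => ?_⟩
      have h1 := abs_empG_le_of_le (X := X) (hrem_i f hf k _ MeasurableSet.univ)
        (hwidth_i f hf k _ MeasurableSet.univ) (hrem0 f hf k _) (hremw f hf k _) ω
      rw [Set.indicator_univ] at h1
      have h2 := mul_le_mul_of_nonneg_left (hlastP f hf k) hsn.le
      exact h1.trans (by linarith)
    | succ m ih =>
      intro k
      have h1 := (hE_big k).of_le_add (c := D k) (S := (fun f => (A k f).indicator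
          (chainRem (chain t br k f) f) + chainLink (chain t br k f) (chain t br (k + 1) f)) '' F)
          (hE_link k) (by
        rintro _ ⟨f, hf, rfl⟩
        refine ⟨_, ⟨f, hf, rfl⟩, _, ⟨f, hf, rfl⟩, fun ω => ?_⟩
        rw [empG_add (hrem_i f hf k _ (hAm f hf k)) (hlink_i f hf k)]
        refine (abs_add_le _ _).trans ?_
        have h1 := abs_empG_le_of_le (X := X) (hrem_i f hf k _ (hAm f hf k))
          (hwidth_i f hf k _ (hAm f hf k)) (hrem0 f hf k _) (hremw f hf k _) ω
        have h2 := hbigP f hf k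
        linarith)
      refine (h1.of_le_add (c := 0) (ih (k + 1)) ?_).mono ?_
      · rintro _ ⟨f, hf, rfl⟩
        refine ⟨_, ⟨f, hf, rfl⟩, _, ⟨f, hf, rfl⟩, fun ω => ?_⟩
        have h2 := hrem_eq f k
        rw [← add_assoc, Set.indicator_univ] at h2
        have h3 := hrem_i f hf (k + 1) _ MeasurableSet.univ
        rw [Set.indicator_univ] at h3
        have h4 := empG_add (X := X)
          ((hrem_i f hf k _ (hAm f hf k)).add (hlink_i f hf k)) h3 ω
        rw [← h2] at h4
        rw [h4, add_zero]
        exact abs_add_le _ _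
      · have h2 : M (k + 1) * H (k + 1) / √n = D k := htD k
        rw [h2, Finset.sum_range_succ']
        have h3 : ∀ j, k + 1 + j = k + (j + 1) := fun j => by ring
        simp only [h3, add_zero]
        linarith
  -- The lower bracket functions at level `0` are not small by the width bound alone. Their second
  -- moment is controlled through `ℓ ^ 2 ≤ 2 f ^ 2 + 2 (u - ℓ) ^ 2`, whence the variance `4 * v 0`.
  have hE_0 : HasEnvelope μ P X ((fun f => (br 0 f).1) '' F) (6 * D 0 + 6 * (H 0 / √n)) := by
    obtain ⟨h1, h2⟩ := image_comp_finite (hfin 0) Prod.fst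
    have h4 : √(4 * v 0 * H 0) ≤ 2 * D 0 := by
      have : √(4 * v 0 * H 0) = 2 * √(v 0 * H 0) := by
        rw [mul_assoc, Real.sqrt_mul (by norm_num)]
        congr 1
        rw [show (4 : ℝ) = 2 ^ 2 by norm_num, Real.sqrt_sq two_pos.le]
      rw [this]
      linarith [hDle 0]
    refine (hasEnvelope_of_finite hX hn h1 (hH1 0) (b := 1) (v := 4 * v 0)
      (((Nat.cast_le.2 h2).trans (hcard 0)).trans (Real.exp_le_exp.2 hH0)) one_pos
      (by linarith [hv 0]) ?_ ?_ ?_).mono (by rw [one_mul]; linarith)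
    · rintro _ ⟨f, hf, rfl⟩
      exact (hbr f hf 0).1
    · rintro _ ⟨f, hf, rfl⟩ x
      have := (hbr f hf 0).2.2 x
      rw [abs_le]
      constructor <;> linarith
    · rintro _ ⟨f, hf, rfl⟩
      have h5 : ∀ x, (br 0 f).1 x ^ 2 ≤ 2 * f x ^ 2 + 2 * ((br 0 f).2 x - (br 0 f).1 x) ^ 2 :=
        fun x => by
          have := (hbr f hf 0).2.2 x
          nlinarith [sq_nonneg (f x + (f x - (br 0 f).1 x))]
      have h6 : Integrable (fun x => 2 * f x ^ 2) P :=
        (integrable_of_abs_le ((hF f hf).pow_const 2) (b := 1) fun x => by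
          have := (hbr f hf 0).2.2 x
          rw [abs_of_nonneg (sq_nonneg _)]
          nlinarith).const_mul _
      have h7 : Integrable (fun x => 2 * ((br 0 f).2 x - (br 0 f).1 x) ^ 2) P :=
        (integrable_of_abs_le ((hbrm f hf 0).pow_const 2) (b := 2 ^ 2) fun x => by
          rw [abs_pow]
          exact pow_le_pow_left₀ (abs_nonneg _) (hbr2 f hf 0 x) 2).const_mul _
      calc ∫ x, (br 0 f).1 x ^ 2 ∂P
          ≤ ∫ x, (2 * f x ^ 2 + 2 * ((br 0 f).2 x - (br 0 f).1 x) ^ 2) ∂P := by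
            refine integral_mono ?_ (h6.add h7) h5
            refine integrable_of_abs_le ((hbr f hf 0).1.pow_const 2) (b := 1) fun x => ?_
            have := (hbr f hf 0).2.2 x
            rw [abs_of_nonneg (sq_nonneg _)]
            nlinarith
        _ = 2 * ∫ x, f x ^ 2 ∂P + 2 * ∫ x, ((br 0 f).2 x - (br 0 f).1 x) ^ 2 ∂P := by
            rw [integral_add h6 h7, integral_const_mul, integral_const_mul]
        _ ≤ 4 * v 0 := by linarith [hF2 f hf, hbv f hf 0]
  refine (hE_0.of_le_add (c := 0) (hrec K 0) ?_).mono ?_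
  · intro f hf
    refine ⟨_, ⟨f, hf, rfl⟩, _, ⟨f, hf, rfl⟩, fun ω => ?_⟩
    have h1 : f = (br 0 f).1 + chainRem (chain t br 0 f) f := by
      funext x
      simp [chainRem, chain]
    have h2 : Integrable (br 0 f).1 P :=
      integrable_of_abs_le (hbr f hf 0).1 (b := 1) fun x => by
        have := (hbr f hf 0).2.2 x
        rw [abs_le]
        constructor <;> linarith
    have h3 : Integrable (chainRem (chain t br 0 f) f) P := by
      simpa using hrem_i f hf 0 _ MeasurableSet.univ
    have h4 := empG_add (X := X) h2 h3 ω
    rw [← h1] at h4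
    rw [h4, add_zero]
    exact abs_add_le _ _
  · have h1 : M 0 * H 0 / √n = 2 * (H 0 / √n) := mul_div_assoc 2 (H 0) (√n)
    have h2 : D 0 ≤ ∑ k ∈ Finset.range (K + 1), D k :=
      Finset.single_le_sum (fun k _ => hD0 k) (by simp)
    have h3 := Finset.sum_nonneg fun k (_ : k ∈ Finset.range K) => hD0 k
    rw [Finset.sum_range_succ] at h2 ⊢
    rw [h1]
    simp only [zero_add]
    linarith [hD0 K]

end Chaining

/-! ### Dyadic summation and passage from bracketing numbers to unit brackets. -/

section UpperBound

variable {𝒳 Ω : Type*} [MeasurableSpace 𝒳] [MeasurableSpace Ω]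
  {P : Measure 𝒳} {μ : Measure Ω} {n : ℕ} {X : Fin n → Ω → 𝒳}

/-- At every scale `δ ≤ δ₀`, the class `F` is covered by at most `exp (L δ^{-α})` unit brackets
whose widths have second moment at most `2δ` and mean at most `e δ`. -/
def HasUnitBrackets (P : Measure 𝒳) (F : Set (𝒳 → ℝ)) (L α δ₀ : ℝ) (e : ℝ → ℝ) : Prop :=
  ∀ δ : ℝ, 0 < δ → δ ≤ δ₀ → ∃ br : (𝒳 → ℝ) → (𝒳 → ℝ) × (𝒳 → ℝ),
    (br '' F).Finite ∧ ((br '' F).ncard : ℝ) ≤ Real.exp (L * δ ^ (-α)) ∧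
    ∀ f ∈ F, IsUnitBracket f (br f) ∧ ∫ x, ((br f).2 x - (br f).1 x) ^ 2 ∂P ≤ 2 * δ ∧
      ∫ x, ((br f).2 x - (br f).1 x) ∂P ≤ e δ

/-- A geometric sum is comparable to its largest term: the first one if `s > 0`, and if `s < 0` the
last one, whose scale is at least `γ / 2`. -/
theorem sum_dyadic_rpow_le {s : ℝ} (hs : s ≠ 0) :
    ∃ c : ℝ, 0 < c ∧ ∀ (δ₀ γ : ℝ) (K : ℕ), 0 < δ₀ → 0 < γ → γ / 2 ≤ δ₀ * (1 / 2) ^ K →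
      ∑ k ∈ Finset.range (K + 1), (δ₀ * (1 / 2) ^ k) ^ s
        ≤ c * (if 0 < s then δ₀ else γ) ^ s := by
  set q : ℝ := (1 / 2 : ℝ) ^ s with hq
  have hq0 : 0 < q := by positivity
  have hterm : ∀ δ₀ : ℝ, 0 < δ₀ → ∀ k : ℕ, (δ₀ * (1 / 2) ^ k) ^ s = δ₀ ^ s * q ^ k :=
    fun δ₀ h k => by
      rw [Real.mul_rpow h.le (by positivity), hq, ← Real.rpow_natCast, ← Real.rpow_natCast,
        ← Real.rpow_mul (by norm_num), ← Real.rpow_mul (by norm_num), mul_comm (k : ℝ)]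
  rcases lt_or_gt_of_ne hs with hneg | hpos
  · have hq1 : 1 < q := Real.one_lt_rpow_of_pos_of_lt_one_of_neg (by norm_num) (by norm_num) hneg
    refine ⟨q ^ 2 / (q - 1), by have := sub_pos.2 hq1; positivity, fun δ₀ γ K h0 hγ hK => ?_⟩
    rw [if_neg hneg.not_gt, Finset.sum_congr rfl fun k _ => hterm δ₀ h0 k, ← Finset.mul_sum,
      geom_sum_eq hq1.ne']
    have h1 : δ₀ ^ s * q ^ K ≤ γ ^ s * q := by
      rw [← hterm δ₀ h0, hq, ← Real.mul_rpow hγ.le (by norm_num)]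
      exact Real.rpow_le_rpow_of_nonpos (by positivity) (by linarith) hneg.le
    have h2 : 0 < q - 1 := sub_pos.2 hq1
    have h3 : 0 < δ₀ ^ s := Real.rpow_pos_of_pos h0 _
    rw [← mul_div_assoc, div_mul_eq_mul_div]
    refine div_le_div_of_nonneg_right ?_ h2.le
    have h4 : δ₀ ^ s * q ^ K * q ≤ γ ^ s * q * q := mul_le_mul_of_nonneg_right h1 hq0.le
    rw [pow_succ, mul_sub, mul_one, ← mul_assoc]
    linarith
  · have hq1 : q < 1 := Real.rpow_lt_one (by norm_num) (by norm_num) hpos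
    refine ⟨(1 - q)⁻¹, inv_pos.2 (sub_pos.2 hq1), fun δ₀ γ K h0 hγ hK => ?_⟩
    rw [if_pos hpos, Finset.sum_congr rfl fun k _ => hterm δ₀ h0 k, ← Finset.mul_sum, mul_comm]
    exact mul_le_mul_of_nonneg_right (geom_sum_le hq0.le hq1 _) (by positivity)
where
  geom_sum_le {q : ℝ} (h0 : 0 ≤ q) (h1 : q < 1) (m : ℕ) :
      ∑ k ∈ Finset.range m, q ^ k ≤ (1 - q)⁻¹ := by
    rw [← tsum_geometric_of_lt_one h0 h1]
    exact (summable_geometric_of_lt_one h0 h1).sum_le_tsum _ fun k _ => pow_nonneg h0 k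

/-- The bracketing maximal inequality in terms of the scales `δ` of the second moments. -/
theorem exists_expectedSup_le {α L : ℝ} (hα : 0 < α) (hα1 : α ≠ 1) (hL : 1 ≤ L) :
    ∃ C : ℝ, 0 < C ∧
      ∀ {𝒳 : Type u} {Ω : Type v} [MeasurableSpace 𝒳] [MeasurableSpace Ω]
        {P : Measure 𝒳} {μ : Measure Ω} [IsProbabilityMeasure P] [IsProbabilityMeasure μ]
        {n : ℕ} {X : Fin n → Ω → 𝒳} {F : Set (𝒳 → ℝ)} {δ₀ γ : ℝ} {e : ℝ → ℝ},
        1 ≤ n → IsIIDSample μ P X → (∀ f ∈ F, Measurable f) →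
        (∀ f ∈ F, ∫ x, f x ^ 2 ∂P ≤ 2 * δ₀) → HasUnitBrackets P F L α δ₀ e →
        (∀ x y, 0 < x → x ≤ y → y ≤ δ₀ → e x ≤ e y) →
        0 ≤ e γ → 0 < γ → γ ≤ δ₀ → δ₀ ≤ 1 →
        expectedSup μ P X F ≤ ENNReal.ofReal (C * ((if α < 1 then δ₀ else γ) ^ ((1 - α) / 2)
          + (√n)⁻¹ * δ₀ ^ (-α) + √n * e γ)) := by
  have hs : (1 - α) / 2 ≠ 0 := by
    intro h
    exact hα1 (by linarith)
  obtain ⟨c, hc0, hc⟩ := sum_dyadic_rpow_le hs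
  set r : ℝ := 2 ^ α with hr
  have hr1 : 1 < r := Real.one_lt_rpow (by norm_num) hα
  -- Entropies grow by the factor `r` per level, so their partial sums are a multiple of the last
  -- term; `A` is the exact solution of `A + L * r = A * r`, the recursion for `H`.
  set A : ℝ := L * r / (r - 1) with hA
  have hrm : 0 < r - 1 := sub_pos.2 hr1
  have hAL : A * (r - 1) = L * r := div_mul_cancel₀ _ hrm.ne'
  have hA1 : L ≤ A := by
    rw [hA, le_div_iff₀ hrm]
    nlinarith
  have hA0 : 0 < A := by linarith
  refine ⟨18 * A + 25 * √(2 * A * r) * c + 1, by positivity, ?_⟩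
  intro 𝒳 Ω _ _ P μ _ _ n X F δ₀ γ e hn hX hF hF2 hbr he he0 hγ hγδ hδ1
  have hδ0 : 0 < δ₀ := hγ.trans_le hγδ
  set δ : ℕ → ℝ := fun k => δ₀ * (1 / 2) ^ k with hδ
  have hδp : ∀ k, 0 < δ k := fun k => by positivity
  have hδle : ∀ k, δ k ≤ δ₀ := fun k =>
    mul_le_of_le_one_right hδ0.le (pow_le_one₀ (by norm_num) (by norm_num))
  have hδs : ∀ k, δ (k + 1) ^ (-α) = r * δ k ^ (-α) := fun k => by
    have h1 : δ (k + 1) = 2⁻¹ * δ k := by simp only [hδ, pow_succ]; ring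
    rw [h1, Real.mul_rpow (by norm_num) (hδp k).le, hr, Real.rpow_neg (by norm_num),
      ← Real.inv_rpow (by norm_num), inv_inv]
  -- The last level `m + 1` is the first dyadic scale strictly below `γ`, so it lies in `[γ / 2,
  -- γ]`.
  obtain ⟨m, hm1, hm2⟩ := exists_nat_pow_near_of_lt_one (div_pos hγ hδ0)
    ((div_le_one hδ0).2 hγδ) (by norm_num : (0 : ℝ) < 1 / 2) (by norm_num)
  set K := m + 1
  have hK1 : δ K ≤ γ := by
    rw [lt_div_iff₀ hδ0] at hm1
    simp only [hδ]
    linarith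
  have hK2 : γ / 2 ≤ δ K := by
    rw [div_le_iff₀ hδ0] at hm2
    simp only [hδ, K, pow_succ]
    linarith
  choose br hfin hcard hbr' using fun k => hbr (δ k) (hδp k) (hδle k)
  have key := hasEnvelope_chaining hX hn (br := br) (h := fun k => L * δ k ^ (-α))
    (H := fun k => A * δ k ^ (-α)) (v := fun k => 2 * δ k) (e := fun k => e (δ k)) hF
    (by simpa [hδ] using hF2) (fun f hf k => (hbr' k f hf).1) (fun f hf k => (hbr' k f hf).2.1)
    (fun f hf k => (hbr' k f hf).2.2) hfin hcard (fun k => by have := hδp k; positivity)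
    (fun k => one_le_mul_of_one_le_of_one_le hL
      (Real.one_le_rpow_of_pos_of_le_one_of_nonpos (hδp k) ((hδle k).trans hδ1) (by linarith)))
    (mul_le_mul_of_nonneg_right hA1 (Real.rpow_pos_of_pos (hδp 0) _).le)
    (fun k => by
      simp only [hδs]
      have : 0 < δ k ^ (-α) := Real.rpow_pos_of_pos (hδp k) _
      apply le_of_eq
      linear_combination (-δ k ^ (-α)) * hAL) K
  refine key.expectedSup_le.trans (ENNReal.ofReal_le_ofReal ?_)
  have hD : ∀ k, √(2 * δ k * (A * δ (k + 1) ^ (-α)))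
      = √(2 * A * r) * δ k ^ ((1 - α) / 2) := fun k => by
    have h1 : 2 * δ k * (A * δ (k + 1) ^ (-α)) = 2 * A * r * δ k ^ (1 - α) := by
      rw [hδs, sub_eq_add_neg, Real.rpow_add (hδp k), Real.rpow_one]
      ring
    rw [h1, Real.sqrt_mul (by positivity), Real.sqrt_eq_rpow (δ k ^ (1 - α)),
      ← Real.rpow_mul (hδp k).le]
    congr 2
    ring
  have h0 : δ 0 = δ₀ := by simp [hδ]
  simp only [hD, ← Finset.mul_sum, h0]
  have h1 := hc δ₀ γ K hδ0 hγ hK2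
  have h2 : (if 0 < (1 - α) / 2 then δ₀ else γ) = if α < 1 then δ₀ else γ := by
    congr 1
    apply propext
    constructor <;> intro h <;> linarith
  rw [h2] at h1
  have h3 : e (δ K) ≤ e γ := he _ _ (hδp K) hK1 hγδ
  have h4 : (√n)⁻¹ * δ₀ ^ (-α) = δ₀ ^ (-α) / √n := by rw [div_eq_inv_mul]
  have h5 : 0 ≤ δ₀ ^ (-α) / √n := by positivity
  have h6 : √n * e (δ K) ≤ √n * e γ := mul_le_mul_of_nonneg_left h3 (Real.sqrt_nonneg _)
  have h7 : 0 ≤ √n * e γ := mul_nonneg (Real.sqrt_nonneg _) he0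
  have h8 : 0 ≤ (if α < 1 then δ₀ else γ) ^ ((1 - α) / 2) :=
    Real.rpow_nonneg (by split_ifs <;> positivity) _
  have h9 : 0 ≤ √(2 * A * r) := Real.sqrt_nonneg _
  have h10 := mul_le_mul_of_nonneg_left h1 h9
  rw [h4, mul_div_assoc]
  have h11 := mul_nonneg (mul_nonneg h9 hc0.le) h5
  have h12 := mul_nonneg (mul_nonneg h9 hc0.le) h7
  have h13 := mul_nonneg hA0.le h8
  have h14 := mul_nonneg hA0.le h7
  linarith

/-- A finite log bound makes the infimum a natural number `N`; being below `N + 1` then produces a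
cover with at most `N` brackets, from which one bracket per function is chosen. -/
theorem exists_brackets {size : (𝒳 → ℝ) → ℝ≥0∞} {F : Set (𝒳 → ℝ)} {ε h : ℝ}
    (hN : logNum (bracketingNumber size F ε) ≤ (h : EReal)) :
    ∃ br : (𝒳 → ℝ) → (𝒳 → ℝ) × (𝒳 → ℝ), (br '' F).Finite ∧
      ((br '' F).ncard : ℝ) ≤ Real.exp h ∧
      ∀ f ∈ F, IsBracket size ε (br f) ∧ (br f).1 ≤ f ∧ f ≤ (br f).2 := by
  classical
  have hexp : ((bracketingNumber size F ε : ℕ∞) : ℝ≥0∞) ≤ ENNReal.ofReal (Real.exp h) := by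
    rw [← ENNReal.log_le_log_iff]
    refine hN.trans (le_of_eq ?_)
    rw [ENNReal.log_ofReal_of_pos (Real.exp_pos h), Real.log_exp]
  have hne : bracketingNumber size F ε ≠ ⊤ := fun h => by
    rw [h] at hexp
    simp at hexp
  obtain ⟨N, hN'⟩ := ENat.ne_top_iff_exists.1 hne
  have hNexp : (N : ℝ) ≤ Real.exp h := by
    rw [← hN'] at hexp
    have := ENNReal.toReal_mono ENNReal.ofReal_ne_top hexp
    rwa [ENNReal.toReal_ofReal (Real.exp_pos h).le] at this
  have hlt : bracketingNumber size F ε < ((N + 1 : ℕ) : ℕ∞) := by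
    rw [← hN']
    exact_mod_cast Nat.lt_succ_self N
  unfold bracketingNumber at hlt
  obtain ⟨B, hB⟩ := iInf_lt_iff.1 hlt
  obtain ⟨⟨hB1, hB2⟩, hB3⟩ := iInf_lt_iff.1 hB
  have hBfin : B.Finite := Set.encard_lt_top_iff.1 (hB3.trans (ENat.natCast_lt_top _))
  have hBcard : B.ncard ≤ N := by
    rw [← hBfin.cast_ncard_eq] at hB3
    exact Nat.lt_succ_iff.1 (by exact_mod_cast hB3)
  choose br hbr using hB2
  have hsub : (fun f => if h : f ∈ F then br f h else 0) '' F ⊆ B := by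
    rintro _ ⟨f, hf, rfl⟩
    simp only [hf, dif_pos]
    exact (hbr f hf).1
  refine ⟨fun f => if h : f ∈ F then br f h else 0, hBfin.subset hsub,
    (Nat.cast_le.2 ((Set.ncard_le_ncard hsub hBfin).trans hBcard)).trans hNexp, fun f hf => ?_⟩
  simp only [hf, dif_pos]
  exact ⟨hB1 _ (hbr f hf).1, (hbr f hf).2⟩

/-- Moments of a bounded function from its `L_p` norm. -/
theorem moments_of_lpSize_le [IsProbabilityMeasure P] {p s : ℝ} (hp : 1 ≤ p) (hs : 0 < s)
    {g : 𝒳 → ℝ} (hg : Measurable g) (hb : ∀ x, |g x| ≤ 2) (h : lpSize P p g ≤ ENNReal.ofReal s) :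
    ∫ x, g x ^ 2 ∂P ≤ 2 * s ^ (min p 2) ∧ ∫ x, g x ∂P ≤ s := by
  have hp0 : 0 < p := by linarith
  have key : ∀ q : ℝ, 1 ≤ q → q ≤ p → ∫ x, |g x| ^ q ∂P ≤ s ^ q := fun q hq hqp => by
    have hq0 : 0 < q := by linarith
    have hmem : MemLp g (ENNReal.ofReal q) P :=
      MemLp.of_bound hg.aestronglyMeasurable 2 (ae_of_all _ hb)
    have h1 : eLpNorm g (ENNReal.ofReal q) P ≤ ENNReal.ofReal s :=
      (eLpNorm_le_eLpNorm_of_exponent_le (ENNReal.ofReal_le_ofReal hqp)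
        hg.aestronglyMeasurable).trans h
    rw [hmem.eLpNorm_eq_integral_rpow_norm (by simpa using hq0) ENNReal.ofReal_ne_top,
      ENNReal.ofReal_le_ofReal_iff hs.le, ENNReal.toReal_ofReal hq0.le] at h1
    have h2 : 0 ≤ ∫ x, |g x| ^ q ∂P := integral_nonneg fun x => by positivity
    exact (Real.rpow_inv_le_iff_of_pos h2 hs.le hq0).1 h1
  constructor
  · rcases le_total 2 p with h2 | h2
    · rw [min_eq_right h2]
      have h3 := key 2 (by norm_num) h2
      have h4 : 0 ≤ s ^ (2 : ℝ) := by positivity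
      have h5 : ∫ x, g x ^ 2 ∂P = ∫ x, |g x| ^ (2 : ℝ) ∂P :=
        integral_congr_ae (ae_of_all _ fun x => by
          simp only
          rw [Real.rpow_two, sq_abs])
      rw [h5]
      linarith
    · rw [min_eq_left h2]
      have hi : ∀ q : ℝ, 0 ≤ q → Integrable (fun x => |g x| ^ q) P := fun q hq =>
        integrable_of_abs_le (by fun_prop) (b := 2 ^ q) fun x => by
          rw [abs_of_nonneg (by positivity)]
          exact Real.rpow_le_rpow (abs_nonneg _) (hb x) hq
      calc ∫ x, g x ^ 2 ∂P ≤ ∫ x, 2 * |g x| ^ p ∂P := by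
            refine integral_mono ?_ ((hi p hp0.le).const_mul 2) fun x => ?_
            · refine (hi 2 (by norm_num)).congr (ae_of_all _ fun x => ?_)
              simp only
              rw [Real.rpow_two, sq_abs]
            -- For `p ≤ 2` the excess power is absorbed by the sup bound: `|g| ^ (2 - p) ≤ 2`.
            · have h3 : g x ^ 2 = |g x| ^ (2 - p) * |g x| ^ p := by
                rw [← Real.rpow_add' (abs_nonneg _) (by norm_num)]
                norm_num
              simp only
              rw [h3]
              refine mul_le_mul_of_nonneg_right ?_ (by positivity)
              calc |g x| ^ (2 - p) ≤ 2 ^ (2 - p) :=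
                    Real.rpow_le_rpow (abs_nonneg _) (hb x) (by linarith)
                _ ≤ 2 ^ (1 : ℝ) := Real.rpow_le_rpow_of_exponent_le (by norm_num) (by linarith)
                _ = 2 := Real.rpow_one 2
        _ = 2 * ∫ x, |g x| ^ p ∂P := integral_const_mul _ _
        _ ≤ 2 * s ^ p := mul_le_mul_of_nonneg_left (key p hp le_rfl) (by norm_num)
  · have h3 := key 1 le_rfl hp
    simp only [Real.rpow_one] at h3
    exact (le_abs_self _).trans (abs_integral_le_integral_abs.trans h3)

/-- Brackets of a class of functions with values in `[-1, 1]` may be truncated to `[-1, 1]`. -/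
theorem exists_unitBrackets [IsProbabilityMeasure P] {p s ε h : ℝ} (hp : 1 ≤ p) (hs : 0 < s)
    {size : (𝒳 → ℝ) → ℝ≥0∞} {F : Set (𝒳 → ℝ)} (hF : IsUnitClass F)
    (hsize : ∀ g, size g < ENNReal.ofReal ε → lpSize P p g ≤ ENNReal.ofReal s)
    (hN : logNum (bracketingNumber size F ε) ≤ (h : EReal)) :
    ∃ br : (𝒳 → ℝ) → (𝒳 → ℝ) × (𝒳 → ℝ), (br '' F).Finite ∧
      ((br '' F).ncard : ℝ) ≤ Real.exp h ∧
      ∀ f ∈ F, IsUnitBracket f (br f) ∧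
        ∫ x, ((br f).2 x - (br f).1 x) ^ 2 ∂P ≤ 2 * s ^ (min p 2) ∧
        ∫ x, ((br f).2 x - (br f).1 x) ∂P ≤ s := by
  obtain ⟨br, hfin, hcard, hbr⟩ := exists_brackets hN
  obtain ⟨h1, h2⟩ := image_comp_finite hfin
    (fun b : (𝒳 → ℝ) × (𝒳 → ℝ) => (fun x => max (-1) (b.1 x), fun x => min 1 (b.2 x)))
  refine ⟨_, h1, (Nat.cast_le.2 h2).trans hcard, fun f hf => ?_⟩
  obtain ⟨⟨⟨hm1, -⟩, ⟨hm2, -⟩, hw⟩, hl, hu⟩ := hbr f hf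
  have hfb := fun x => abs_le.1 (hF.2.2 f hf x)
  have hub : IsUnitBracket f
      (fun x => max (-1) ((br f).1 x), fun x => min 1 ((br f).2 x)) :=
    ⟨measurable_const.max hm1, measurable_const.min hm2, fun x =>
      ⟨le_max_left _ _, max_le (hfb x).1 (hl x), le_min (hfb x).2 (hu x), min_le_left _ _⟩⟩
  refine ⟨hub, moments_of_lpSize_le hp hs (hub.2.1.sub hub.1) (fun x => ?_) ?_⟩
  · have := hub.2.2 x
    rw [abs_le]
    constructor <;> linarith
  -- Clipping both ends to `[-1, 1]` can only shrink the width pointwise.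
  · refine le_trans (eLpNorm_mono fun x => ?_) (hsize _ hw)
    have h3 := hub.2.2 x
    have h4 : (br f).1 x ≤ f x := hl x
    have h5 : f x ≤ (br f).2 x := hu x
    have h6 := le_max_right (-1) ((br f).1 x)
    have h7 := min_le_right 1 ((br f).2 x)
    simp only [Pi.sub_apply] at h3 ⊢
    rw [Real.norm_of_nonneg (by linarith), Real.norm_of_nonneg (by linarith)]
    linarith

end UpperBound

/-! ### The global and the localized upper bounds. -/

section UpperBounds

/-- Brackets of `L_p` size `δ ^ (1 / (p∧2))` have widths of second moment at most `2 * δ`, so the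
entropy exponent in terms of `δ` becomes `α / (p∧2)`. -/
theorem hasUnitBrackets_of_lp {𝒳 : Type*} [MeasurableSpace 𝒳] {P : Measure 𝒳}
    [IsProbabilityMeasure P] {F : Set (𝒳 → ℝ)} {p α L L' : ℝ} (hp : 1 ≤ p) (hL : L ≤ L')
    (hF : IsUnitClass F)
    (hN : ∀ ε : ℝ, 0 < ε →
      logNum (bracketingNumber (lpSize P p) F ε) ≤ ((L * ε ^ (-α) : ℝ) : EReal)) (δ₀ : ℝ) :
    HasUnitBrackets P F L' (α / min p 2) δ₀ fun δ => δ ^ (min p 2)⁻¹ := by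
  intro δ hδ _
  have ha : 0 < min p 2 := lt_min (by linarith) two_pos
  have hs : 0 < δ ^ (min p 2)⁻¹ := Real.rpow_pos_of_pos hδ _
  obtain ⟨br, h1, h2, h3⟩ := exists_unitBrackets (P := P) hp hs hF (fun g hg => hg.le) (hN _ hs)
  have h4 : (δ ^ (min p 2)⁻¹) ^ (min p 2) = δ := by
    rw [← Real.rpow_mul hδ.le, inv_mul_cancel₀ ha.ne', Real.rpow_one]
  rw [h4] at h3
  refine ⟨br, h1, h2.trans (Real.exp_le_exp.2 ?_), h3⟩
  rw [← Real.rpow_mul hδ.le, inv_mul_eq_div, neg_div]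
  exact mul_le_mul_of_nonneg_right hL (by positivity)

theorem exists_expectedSup_le_lp {p α L : ℝ} (hp : 1 ≤ p) (hα : 0 < α) (hαp : α ≠ min p 2) :
    ∃ C : ℝ, 0 < C ∧
      ∀ {𝒳 : Type u} {Ω : Type v} [MeasurableSpace 𝒳] [MeasurableSpace Ω]
        {P : Measure 𝒳} {μ : Measure Ω} [IsProbabilityMeasure P] [IsProbabilityMeasure μ]
        {n : ℕ} {X : Fin n → Ω → 𝒳} {F : Set (𝒳 → ℝ)} {σ γ : ℝ},
        1 ≤ n → IsIIDSample μ P X → IsUnitClass F →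
        (∀ f ∈ F, lpSize P p f ≤ ENNReal.ofReal σ) →
        (∀ ε : ℝ, 0 < ε →
          logNum (bracketingNumber (lpSize P p) F ε) ≤ ((L * ε ^ (-α) : ℝ) : EReal)) →
        0 < γ → γ ≤ σ →
        expectedSup μ P X F ≤ ENNReal.ofReal (C * ((if α < min p 2 then σ else γ)
          ^ ((min p 2 - α) / 2) + (√n)⁻¹ * σ ^ (-α) + √n * γ)) := by
  set a := min p 2 with ha
  have ha0 : 0 < a := lt_min (by linarith) two_pos
  have hαa : α / a ≠ 1 := fun h => hαp ((div_eq_one_iff_eq ha0.ne').1 h)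
  obtain ⟨C, hC, hmain⟩ := exists_expectedSup_le (L := max L 1) (div_pos hα ha0) hαa
    (le_max_right _ _)
  have hif : α / a < 1 ↔ α < a := div_lt_one ha0
  refine ⟨3 * C, by positivity, ?_⟩
  intro 𝒳 Ω _ _ P μ _ _ n X F σ γ hn hX hF hFσ hN hγ hγσ
  have hσ : 0 < σ := hγ.trans_le hγσ
  have hn1 : (1 : ℝ) ≤ n := by exact_mod_cast hn
  have hsn : 1 ≤ √(n : ℝ) := Real.one_le_sqrt.2 hn1
  -- The chaining bound needs scales at most `1`. Capping is harmless because the functions are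
  -- bounded by `1`; the comparison with the uncapped expression follows below.
  set σ₁ := min σ 1 with hσ₁
  set γ₁ := min γ 1 with hγ₁
  have hσ₁0 : 0 < σ₁ := lt_min hσ one_pos
  have hγ₁0 : 0 < γ₁ := lt_min hγ one_pos
  have hγσ₁ : γ₁ ≤ σ₁ := min_le_min_right 1 hγσ
  have hF2 : ∀ f ∈ F, ∫ x, f x ^ 2 ∂P ≤ 2 * σ₁ ^ a := fun f hf => by
    refine (moments_of_lpSize_le hp hσ₁0 (hF.2.1 f hf)
      (fun x => (hF.2.2 f hf x).trans one_le_two) ?_).1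
    rw [hσ₁, ENNReal.ofReal_min]
    refine le_min (hFσ f hf) ?_
    have := eLpNorm_le_of_ae_bound (μ := P) (p := ENNReal.ofReal p) (f := f) (C := 1)
      (ae_of_all _ fun x => hF.2.2 f hf x)
    simpa [lpSize] using this
  have h1 := hmain (γ := γ₁ ^ a) hn hX hF.2.1 hF2
    (hasUnitBrackets_of_lp hp (le_max_left L 1) hF hN (σ₁ ^ a))
    (fun x y hx hxy _ => Real.rpow_le_rpow hx.le hxy (inv_pos.2 ha0).le)
    (by positivity) (by positivity) (Real.rpow_le_rpow hγ₁0.le hγσ₁ ha0.le)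
    (Real.rpow_le_one hσ₁0.le (min_le_right _ _) ha0.le)
  refine h1.trans (ENNReal.ofReal_le_ofReal ?_)
  have e1 : (γ₁ ^ a) ^ a⁻¹ = γ₁ := Real.rpow_rpow_inv hγ₁0.le ha0.ne'
  have e2 : (σ₁ ^ a) ^ (-(α / a)) = σ₁ ^ (-α) := by
    rw [← Real.rpow_mul hσ₁0.le]
    congr 1
    field_simp
  have e3 : (if α / a < 1 then σ₁ ^ a else γ₁ ^ a) ^ ((1 - α / a) / 2)
      = (if α < a then σ₁ else γ₁) ^ ((a - α) / 2) := by
    have : (if α / a < 1 then σ₁ ^ a else γ₁ ^ a) = (if α < a then σ₁ else γ₁) ^ a := by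
      simp only [hif]
      split_ifs <;> rfl
    rw [this, ← Real.rpow_mul (by split_ifs <;> positivity)]
    congr 1
    field_simp
  have hb0 : 0 ≤ (if α < a then σ else γ) ^ ((a - α) / 2) :=
    Real.rpow_nonneg (by split_ifs <;> positivity) _
  have hγn : γ ≤ √n * γ := le_mul_of_one_le_left hγ.le hsn
  -- When `σ > 1`, the entropy and cutoff terms together already exceed `1`, which absorbs the
  -- capped term `(√n)⁻¹ * 1`.
  have i0 : 1 ≤ (if α < a then σ else γ) ^ ((a - α) / 2) + √n * γ ∨ σ ≤ 1 := by
    rcases le_or_gt σ 1 with h | h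
    · exact Or.inr h
    left
    by_cases hlt : α < a
    · rw [if_pos hlt]
      have := Real.one_le_rpow h.le (by linarith : 0 ≤ (a - α) / 2)
      linarith
    · rw [if_neg hlt]
      rcases le_or_gt γ 1 with h' | h'
      · have := Real.one_le_rpow_of_pos_of_le_one_of_nonpos hγ h'
          (by linarith : (a - α) / 2 ≤ 0)
        linarith
      · have : 0 ≤ γ ^ ((a - α) / 2) := by positivity
        linarith
  have i1 : (if α < a then σ₁ else γ₁) ^ ((a - α) / 2)
      ≤ (if α < a then σ else γ) ^ ((a - α) / 2) + √n * γ := by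
    by_cases hlt : α < a
    · simp only [if_pos hlt]
      have := Real.rpow_le_rpow hσ₁0.le (min_le_left σ 1) (by linarith : 0 ≤ (a - α) / 2)
      linarith
    · simp only [if_neg hlt]
      rcases le_total γ 1 with h | h
      · rw [hγ₁, min_eq_left h]
        linarith
      · rw [hγ₁, min_eq_right h, Real.one_rpow]
        have : 0 ≤ γ ^ ((a - α) / 2) := by positivity
        linarith
  have i2 : (√n)⁻¹ * σ₁ ^ (-α) ≤ (√n)⁻¹ * σ ^ (-α)
      + ((if α < a then σ else γ) ^ ((a - α) / 2) + √n * γ) := by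
    have h2 : 0 ≤ (√n)⁻¹ * σ ^ (-α) := by positivity
    rcases i0 with h | h
    · rcases le_total σ 1 with h' | h'
      · rw [hσ₁, min_eq_left h']
        linarith
      · rw [hσ₁, min_eq_right h', Real.one_rpow]
        have : (√(n : ℝ))⁻¹ ≤ 1 := inv_le_one_of_one_le₀ hsn
        linarith
    · rw [hσ₁, min_eq_left h]
      linarith
  have i3 : √n * γ₁ ≤ √n * γ := mul_le_mul_of_nonneg_left (min_le_left _ _) (by positivity)
  rw [e1, e2, e3]
  have h2 : 0 ≤ (√n)⁻¹ * σ ^ (-α) := by positivity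
  have := mul_le_mul_of_nonneg_left (add_le_add (add_le_add i1 i2) i3) hC.le
  nlinarith [mul_nonneg hC.le h2, mul_nonneg hC.le hb0]

theorem chainingTerm_eq {α a σ γ : ℝ} {n : ℕ} (hσ : 0 < σ) (hγ : 0 ≤ γ) (hαa : α ≠ a)
    (h : α < a ∨ 0 < γ) :
    ENNReal.ofReal ((if α < a then σ else 0) + (if a < α then γ else 0)) ^ ((a - α) / 2)
      + ENNReal.ofReal ((n : ℝ) ^ (-(1 / 2) : ℝ) * σ ^ (-α)) + ENNReal.ofReal (√n * γ)
    = ENNReal.ofReal ((if α < a then σ else γ) ^ ((a - α) / 2) + (√n)⁻¹ * σ ^ (-α) + √n * γ) := by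
  have h1 : (if α < a then σ else 0) + (if a < α then γ else 0) = if α < a then σ else γ := by
    rcases lt_or_gt_of_ne hαa with h | h
    · simp [h, h.not_gt]
    · rw [if_neg h.not_gt, if_pos h, if_neg h.not_gt, zero_add]
  have h2 : 0 < if α < a then σ else γ := by
    split_ifs with h'
    · exact hσ
    · exact h.resolve_left h'
  have h3 : (n : ℝ) ^ (-(1 / 2) : ℝ) = (√n)⁻¹ := by
    rw [Real.rpow_neg (Nat.cast_nonneg n), ← Real.sqrt_eq_rpow]
  rw [h1, h3, ENNReal.ofReal_rpow_of_pos h2, ENNReal.ofReal_add (by positivity) (by positivity),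
    ENNReal.ofReal_add (by positivity) (by positivity)]

theorem chainingTerm_zero {α a σ : ℝ} {n : ℕ} (hαa : a < α) :
    ENNReal.ofReal ((if α < a then σ else 0) + (if a < α then 0 else 0)) ^ ((a - α) / 2)
      + ENNReal.ofReal ((n : ℝ) ^ (-(1 / 2) : ℝ) * σ ^ (-α)) + ENNReal.ofReal (√n * 0) = ∞ := by
  rw [if_neg hαa.not_gt, if_pos hαa, add_zero, ENNReal.ofReal_zero,
    ENNReal.zero_rpow_of_neg (by linarith)]
  simp

/-- For `α > p∧2` the candidate `γ = 0` has value `∞`, so the infimum needs to be tested only where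
the real expression is meaningful. -/
theorem le_const_mul_chainingBound {α p σ C : ℝ} {n : ℕ} {E : ℝ≥0∞} (hσ : 0 < σ) (hC : 0 < C)
    (hαp : α ≠ min p 2)
    (h : ∀ γ : ℝ, 0 ≤ γ → γ ≤ σ / 2 → (α < min p 2 ∨ 0 < γ) →
      E ≤ ENNReal.ofReal (C * ((if α < min p 2 then σ else γ) ^ ((min p 2 - α) / 2)
        + (√n)⁻¹ * σ ^ (-α) + √n * γ))) :
    E ≤ ENNReal.ofReal C * chainingBound α p n σ := by
  have hC0 : ENNReal.ofReal C ≠ 0 := by simpa using hC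
  rw [← ENNReal.div_le_iff' hC0 ENNReal.ofReal_ne_top]
  refine le_iInf₂ fun γ hγ => ?_
  by_cases h' : α < min p 2 ∨ 0 < γ
  · rw [chainingTerm_eq hσ hγ.1 hαp h', ENNReal.div_le_iff' hC0 ENNReal.ofReal_ne_top,
      ← ENNReal.ofReal_mul hC.le]
    exact h γ hγ.1 hγ.2 h'
  · push Not at h'
    obtain rfl : γ = 0 := le_antisymm h'.2 hγ.1
    rw [chainingTerm_zero (lt_of_le_of_ne h'.1 hαp.symm)]
    exact le_top

theorem exists_expectedSup_le_chainingBound {p α L : ℝ} (hp : 1 ≤ p) (hα : 0 < α)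
    (hαp : α ≠ min p 2) :
    ∃ C : ℝ, 0 < C ∧
      ∀ {𝒳 : Type u} {Ω : Type v} [MeasurableSpace 𝒳] [MeasurableSpace Ω]
        {P : Measure 𝒳} {μ : Measure Ω} [IsProbabilityMeasure P] [IsProbabilityMeasure μ]
        {n : ℕ} {X : Fin n → Ω → 𝒳} {F : Set (𝒳 → ℝ)} {σ : ℝ},
        1 ≤ n → IsIIDSample μ P X → IsUnitClass F → 0 < σ →
        (∀ f ∈ F, lpSize P p f ≤ ENNReal.ofReal σ) →
        (∀ ε : ℝ, 0 < ε →
          logNum (bracketingNumber (lpSize P p) F ε) ≤ ((L * ε ^ (-α) : ℝ) : EReal)) →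
        expectedSup μ P X F ≤ ENNReal.ofReal C * chainingBound α p n σ := by
  obtain ⟨C, hC, hmain⟩ := exists_expectedSup_le_lp (L := L) hp hα hαp
  refine ⟨2 * C, by positivity, ?_⟩
  intro 𝒳 Ω _ _ P μ _ _ n X F σ hn hX hF hσ hFσ hN
  have hsn : 0 < √(n : ℝ) := Real.sqrt_pos.2 (by exact_mod_cast hn)
  refine le_const_mul_chainingBound hσ (by positivity) hαp fun γ hγ0 hγσ hγ => ?_
  by_cases hlt : α < min p 2
  · have h1 : 0 < σ ^ ((min p 2 - α) / 2) := by positivity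
    -- For `α < p∧2` the cutoff does not affect the entropy term. It is taken so small that `√n γ`
    -- is absorbed there; this also covers the value `γ = 0` in the infimum.
    refine (hmain (γ := min σ (σ ^ ((min p 2 - α) / 2) / √n)) hn hX hF hFσ hN
      (lt_min hσ (by positivity)) (min_le_left _ _)).trans (ENNReal.ofReal_le_ofReal ?_)
    simp only [if_pos hlt]
    have h2 : √n * min σ (σ ^ ((min p 2 - α) / 2) / √n) ≤ σ ^ ((min p 2 - α) / 2) := by
      refine (mul_le_mul_of_nonneg_left (min_le_right _ _) hsn.le).trans (le_of_eq ?_)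
      field_simp
    have h3 : 0 ≤ (√n)⁻¹ * σ ^ (-α) := by positivity
    have h4 : 0 ≤ √n * γ := by positivity
    nlinarith [mul_le_mul_of_nonneg_left h2 hC.le, mul_nonneg hC.le h3, mul_nonneg hC.le h4]
  · refine (hmain hn hX hF hFσ hN (hγ.resolve_left hlt) (by linarith)).trans
      (ENNReal.ofReal_le_ofReal ?_)
    refine mul_le_mul_of_nonneg_right (by linarith) ?_
    have h0 : 0 ≤ (if α < min p 2 then σ else γ) ^ ((min p 2 - α) / 2) :=
      Real.rpow_nonneg (by split_ifs <;> positivity) _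
    positivity

/-- The chaining bound has the order of its explicit form. -/
theorem chainingBound_equiv_explicitBound {p α : ℝ} (hαp : α ≠ min p 2) :
    ∃ C : ℝ, 0 < C ∧ ∀ (n : ℕ) (σ : ℝ), 1 ≤ n → 0 < σ →
      chainingBound α p n σ ≤ ENNReal.ofReal (C * explicitBound α p n σ) ∧
      ENNReal.ofReal (explicitBound α p n σ) ≤ ENNReal.ofReal C * chainingBound α p n σ := by
  set a := min p 2 with ha
  have hroot : ∀ n : ℕ, (n : ℝ) ^ (-(1 / 2) : ℝ) = (√n)⁻¹ := fun n => by
    rw [Real.rpow_neg (Nat.cast_nonneg n), ← Real.sqrt_eq_rpow]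
  rcases lt_or_gt_of_ne hαp with hlt | hgt
  · refine ⟨1, one_pos, fun n σ hn hσ => ⟨?_, ?_⟩⟩
    -- Only the last summand depends on `γ` in this regime, so `γ = 0` is optimal.
    · refine (iInf₂_le 0 ⟨le_rfl, by positivity⟩).trans ?_
      rw [← ha, chainingTerm_eq hσ le_rfl hαp (Or.inl hlt)]
      refine ENNReal.ofReal_le_ofReal (le_of_eq ?_)
      simp only [explicitBound, ← ha, if_pos hlt, hroot]
      ring
    · refine le_const_mul_chainingBound hσ one_pos hαp fun γ hγ _ _ =>
        ENNReal.ofReal_le_ofReal ?_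
      simp only [explicitBound, ← ha, if_pos hlt, hroot]
      have : 0 ≤ √n * γ := by positivity
      linarith
  · set b := (α - a) / 2 with hb
    have hb0 : 0 < b := by
      have := sub_pos.2 hgt
      positivity
    have hab : (a - α) / 2 = -b := by rw [hb]; ring
    have hex : ∀ n : ℕ, (n : ℝ) ^ ((α - a) / (2 * (α + 2 - a))) = (n : ℝ) ^ (b / (2 * (b + 1))) :=
      fun n => by
        congr 1
        rw [hb]
        have : α + 2 - a ≠ 0 := by linarith
        have : (α - a) / 2 + 1 ≠ 0 := by linarith
        field_simp
        ring
    have h2b : (1 : ℝ) ≤ 2 ^ b := Real.one_le_rpow (by norm_num) hb0.le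
    refine ⟨2 + 2 ^ b, by positivity, fun n σ hn hσ => ?_⟩
    have hn0 : (0 : ℝ) < n := by exact_mod_cast hn
    -- The unconstrained balance point: `ν ^ (-b) = √n * ν = N`. Clipping it to `σ / 2` produces the
    -- term `σ ^ (-b)` of the explicit form.
    set ν : ℝ := (n : ℝ) ^ (-(1 / (2 * (b + 1)))) with hν
    have hν0 : 0 < ν := by positivity
    set N : ℝ := (n : ℝ) ^ (b / (2 * (b + 1))) with hN
    have hN0 : 0 < N := by positivity
    have hνb : ν ^ (-b) = N := by
      rw [hν, ← Real.rpow_mul hn0.le]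
      congr 1
      field_simp
    have hνn : √n * ν = N := by
      rw [hν, Real.sqrt_eq_rpow, ← Real.rpow_add hn0]
      congr 1
      field_simp
      ring
    have hE : explicitBound α p n σ = N + σ ^ (-b) + (√n)⁻¹ * σ ^ (-α) := by
      simp only [explicitBound, ← ha, if_neg hgt.not_gt, hroot, hex, ← hb, ← hN]
    have hσb : 0 < σ ^ (-b) := by positivity
    have hσα : 0 ≤ (√n)⁻¹ * σ ^ (-α) := by positivity
    have hσ2 : (σ / 2) ^ (-b) = 2 ^ b * σ ^ (-b) := by
      rw [Real.div_rpow hσ.le (by norm_num), Real.rpow_neg (by norm_num : (0 : ℝ) ≤ 2), div_inv_eq_mul,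
        mul_comm]
    constructor
    · have hγ0 : 0 < min ν (σ / 2) := lt_min hν0 (by positivity)
      refine (iInf₂_le (min ν (σ / 2)) ⟨hγ0.le, min_le_right _ _⟩).trans ?_
      rw [← ha, chainingTerm_eq hσ hγ0.le hαp (Or.inr hγ0)]
      refine ENNReal.ofReal_le_ofReal ?_
      rw [if_neg hgt.not_gt, hab, hE]
      have h1 : (min ν (σ / 2)) ^ (-b) ≤ N + 2 ^ b * σ ^ (-b) := by
        rcases min_choice ν (σ / 2) with h | h <;> rw [h]
        · rw [hνb]
          have : 0 ≤ 2 ^ b * σ ^ (-b) := by positivity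
          linarith
        · rw [hσ2]
          linarith
      have h2 : √n * min ν (σ / 2) ≤ N :=
        hνn ▸ mul_le_mul_of_nonneg_left (min_le_left _ _) (Real.sqrt_nonneg _)
      have h3 : 0 ≤ 2 ^ b * N := by positivity
      have h4 : 0 ≤ 2 ^ b * ((√n)⁻¹ * σ ^ (-α)) := by positivity
      linarith
    · refine le_const_mul_chainingBound hσ (by positivity) hαp fun γ hγ hγσ hγ' =>
        ENNReal.ofReal_le_ofReal ?_
      have hγ0 : 0 < γ := hγ'.resolve_left hgt.not_gt
      rw [← ha, if_neg hgt.not_gt, hab, hE]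
      have h1 : σ ^ (-b) ≤ γ ^ (-b) :=
        Real.rpow_le_rpow_of_nonpos hγ0 (by linarith) (by linarith)
      have h0 : 0 ≤ γ ^ (-b) := by positivity
      have h00 : 0 ≤ √n * γ := by positivity
      -- The first summand decreases and the second increases in `γ`, and they cross at `ν` with
      -- value `N`; on either side one of them is at least `N`.
      have h2 : N ≤ γ ^ (-b) + √n * γ := by
        rcases le_total γ ν with h | h
        · have := Real.rpow_le_rpow_of_nonpos hγ0 h (by linarith : -b ≤ 0)
          rw [hνb] at this
          linarith
        · have := mul_le_mul_of_nonneg_left h (Real.sqrt_nonneg (n : ℝ))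
          rw [hνn] at this
          linarith
      have h3 : 0 ≤ (2 : ℝ) ^ b * (γ ^ (-b) + (√n)⁻¹ * σ ^ (-α) + √n * γ) := by positivity
      linarith

/-- The entropy condition is read at `ε = √δ`. In the `L₁` case the second moment follows from the
mean because widths are at most `2`; in the `L₂` case the mean follows from the second moment, at
the weaker order `√δ`. -/
theorem hasUnitBrackets_of_entropyUpper {𝒳 : Type*} [MeasurableSpace 𝒳] {P : Measure 𝒳}
    [IsProbabilityMeasure P] {F : Set (𝒳 → ℝ)} {α L L' : ℝ} (hL : L ≤ L')
    (hF : IsUnitClass F) (hN : EntropyUpper P F α L) {δ₀ : ℝ} (hδ₀ : δ₀ ≤ 1) :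
    HasUnitBrackets P F L' α δ₀ fun δ => if 1 < α then δ else √δ := by
  intro δ hδ hδδ₀
  have hsq : √δ ^ 2 = δ := Real.sq_sqrt hδ.le
  have hN' := hN (√δ) (Real.sqrt_pos.2 hδ) (Real.sqrt_le_one.2 (hδδ₀.trans hδ₀))
  have hh : L * √δ ^ (-2 * α) ≤ L' * δ ^ (-α) := by
    rw [Real.sqrt_eq_rpow, ← Real.rpow_mul hδ.le, show 1 / 2 * (-2 * α) = -α by ring]
    exact mul_le_mul_of_nonneg_right hL (by positivity)
  rw [hsq] at hN'
  by_cases h1 : 1 < α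
  · obtain ⟨br, h2, h3, h4⟩ := exists_unitBrackets (P := P) (p := 1) le_rfl hδ hF
      (fun g hg => by simpa [mixedSize, h1] using hg.le) hN'
    refine ⟨br, h2, h3.trans (Real.exp_le_exp.2 hh), fun f hf => ?_⟩
    have h5 := h4 f hf
    rw [min_eq_left (by norm_num : (1 : ℝ) ≤ 2), Real.rpow_one] at h5
    simpa only [if_pos h1] using h5
  · obtain ⟨br, h2, h3, h4⟩ := exists_unitBrackets (P := P) (p := 2) one_le_two
      (Real.sqrt_pos.2 hδ) hF (fun g hg => by
        simp only [mixedSize, h1, if_false] at hg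
        by_contra! hcon
        have := ENNReal.pow_lt_pow_left two_ne_zero hcon
        rw [← ENNReal.ofReal_pow (Real.sqrt_nonneg _), hsq] at this
        exact absurd hg this.not_gt) hN'
    refine ⟨br, h2, h3.trans (Real.exp_le_exp.2 hh), fun f hf => ?_⟩
    have h5 := h4 f hf
    rw [min_self, Real.rpow_two, hsq] at h5
    simpa only [if_neg h1] using h5

theorem HasUnitBrackets.mono {𝒳 : Type*} [MeasurableSpace 𝒳] {P : Measure 𝒳}
    {F G : Set (𝒳 → ℝ)} {α L δ₀ : ℝ} {e : ℝ → ℝ} (h : HasUnitBrackets P F L α δ₀ e)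
    (hG : G ⊆ F) : HasUnitBrackets P G L α δ₀ e := fun δ hδ hδ₀ => by
  obtain ⟨br, h1, h2, h3⟩ := h δ hδ hδ₀
  exact ⟨br, h1.subset (Set.image_mono hG), (Nat.cast_le.2 (Set.ncard_le_ncard
    (Set.image_mono hG) h1)).trans h2, fun f hf => h3 f (hG hf)⟩

theorem exists_expectedSup_localized_le {α L K : ℝ} (hα : 0 < α) (hα1 : α ≠ 1) (hK : 0 < K) :
    ∃ C : ℝ, 0 < C ∧
      ∀ {𝒳 : Type u} {Ω : Type v} [MeasurableSpace 𝒳] [MeasurableSpace Ω]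
        {P : Measure 𝒳} {μ : Measure Ω} [IsProbabilityMeasure P] [IsProbabilityMeasure μ]
        {n : ℕ} {X : Fin n → Ω → 𝒳} {F : Set (𝒳 → ℝ)} {σ : ℝ},
        1 ≤ n → IsIIDSample μ P X → IsUnitClass F → EntropyUpper P F α L →
        0 < σ → K * (n : ℝ) ^ (-(1 / (α + 1))) ≤ σ ^ 2 →
        expectedSup μ P X (localized P F σ) ≤ ENNReal.ofReal (C * localRate α n σ) := by
  obtain ⟨C, hC, hmain⟩ := exists_expectedSup_le (L := max L 1) hα hα1 (le_max_right _ _)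
  set K₁ := min K 1 with hK₁
  have hK₁0 : 0 < K₁ := lt_min hK one_pos
  refine ⟨C * (2 + K₁ ^ (-α) + K₁ ^ ((1 - α) / 2)), by positivity, ?_⟩
  intro 𝒳 Ω _ _ P μ _ _ n X F σ hn hX hF hN hσ hKσ
  have hn1 : (1 : ℝ) ≤ n := by exact_mod_cast hn
  have hn0 : (0 : ℝ) < n := by linarith
  have hsn : 0 < √(n : ℝ) := Real.sqrt_pos.2 hn0
  -- Critical scale of the second moment: `ν ^ ((1 - α) / 2)`, `√n * ν` and `(√n)⁻¹ * ν ^ (-α)` all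
  -- equal `N`.
  set ν : ℝ := (n : ℝ) ^ (-(1 / (α + 1))) with hν
  have hν0 : 0 < ν := by positivity
  have hν1 : ν ≤ 1 := Real.rpow_le_one_of_one_le_of_nonpos hn1 (by
    have : 0 < 1 / (α + 1) := by positivity
    linarith)
  set N : ℝ := (n : ℝ) ^ ((α - 1) / (2 * (α + 1))) with hNdef
  have hN0 : 0 < N := by positivity
  have hνN : ν ^ ((1 - α) / 2) = N := by
    rw [hν, ← Real.rpow_mul hn0.le]
    congr 1
    field_simp
    ring
  have hνn : √n * ν = N := by
    rw [hν, Real.sqrt_eq_rpow, ← Real.rpow_add hn0]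
    congr 1
    field_simp
    ring
  have hνα : (√n)⁻¹ * ν ^ (-α) = N := by
    rw [hν, Real.sqrt_eq_rpow, ← Real.rpow_mul hn0.le, ← Real.rpow_neg hn0.le,
      ← Real.rpow_add hn0]
    congr 1
    field_simp
    ring
  set δ₀ := min (σ ^ 2) 1 with hδ₀
  have hδ₀0 : 0 < δ₀ := lt_min (by positivity) one_pos
  have hKδ : K₁ * ν ≤ δ₀ := le_min
    ((mul_le_mul_of_nonneg_right (min_le_left _ _) hν0.le).trans hKσ)
    (mul_le_one₀ (min_le_right _ _) hν0.le hν1)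
  have hsub : localized P F σ ⊆ F := fun f hf => hf.1
  have hF2 : ∀ f ∈ localized P F σ, ∫ x, f x ^ 2 ∂P ≤ 2 * δ₀ := fun f hf => by
    have h1 : ∫ x, f x ^ 2 ∂P ≤ δ₀ := by
      refine le_min hf.2 ?_
      refine (le_abs_self _).trans (abs_integral_le_of_abs_le fun x => ?_)
      rw [abs_pow]
      exact pow_le_one₀ (abs_nonneg _) (hF.2.2 f hf.1 x)
    linarith
  have hmain' := fun γ hγ hγδ he => hmain (γ := γ) hn hX (fun f hf => hF.2.1 f (hsub hf)) hF2
    ((hasUnitBrackets_of_entropyUpper (le_max_left L 1) hF hN (min_le_right (σ ^ 2) 1)).mono hsub)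
    (fun x y hx hxy _ => by
      split_ifs
      · exact hxy
      · exact Real.sqrt_le_sqrt hxy) he hγ hγδ (min_le_right _ _)
  have hR1 : σ ^ (1 - α) ≤ localRate α n σ := le_max_left _ _
  have hR2 : N ≤ localRate α n σ := le_max_right _ _
  have hR0 : 0 ≤ localRate α n σ := hN0.le.trans hR2
  have hδα : (√n)⁻¹ * δ₀ ^ (-α) ≤ K₁ ^ (-α) * localRate α n σ := by
    have h1 : δ₀ ^ (-α) ≤ (K₁ * ν) ^ (-α) :=
      Real.rpow_le_rpow_of_nonpos (by positivity) hKδ (by linarith)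
    rw [Real.mul_rpow hK₁0.le hν0.le] at h1
    have h2 : K₁ ^ (-α) * N ≤ K₁ ^ (-α) * localRate α n σ :=
      mul_le_mul_of_nonneg_left hR2 (by positivity)
    calc (√n)⁻¹ * δ₀ ^ (-α) ≤ (√n)⁻¹ * (K₁ ^ (-α) * ν ^ (-α)) :=
          mul_le_mul_of_nonneg_left h1 (by positivity)
      _ = K₁ ^ (-α) * N := by rw [← hνα]; ring
      _ ≤ _ := h2
  have hKR : 0 ≤ K₁ ^ ((1 - α) / 2) * localRate α n σ := mul_nonneg (by positivity) hR0
  rcases lt_or_gt_of_ne hα1 with hlt | hgt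
  -- For `α < 1` the cutoff is free, and `γ ≤ N ^ 2 / n` makes the residual mean `√n * √γ` at most
  -- `N`.
  · have hγ0 : 0 < min δ₀ (N ^ 2 / n) := lt_min hδ₀0 (by positivity)
    refine (hmain' (min δ₀ (N ^ 2 / n)) hγ0 (min_le_left _ _)
      (by rw [if_neg hlt.not_gt]; positivity)).trans (ENNReal.ofReal_le_ofReal ?_)
    rw [if_pos hlt, if_neg hlt.not_gt, mul_assoc]
    refine mul_le_mul_of_nonneg_left ?_ hC.le
    have h1 : δ₀ ^ ((1 - α) / 2) ≤ σ ^ (1 - α) := by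
      refine (Real.rpow_le_rpow hδ₀0.le (min_le_left _ _) (by linarith)).trans (le_of_eq ?_)
      rw [← Real.rpow_two, ← Real.rpow_mul hσ.le]
      congr 1
      ring
    have h2 : √n * √(min δ₀ (N ^ 2 / n)) ≤ N := by
      rw [← Real.sqrt_mul hn0.le]
      refine Real.sqrt_le_iff.2 ⟨hN0.le, ?_⟩
      refine (mul_le_mul_of_nonneg_left (min_le_right _ _) hn0.le).trans (le_of_eq ?_)
      field_simp
    linarith
  -- For `α > 1` the cutoff governs the entropy sum, so it is placed at the critical scale; `hKδ`
  -- says that this is admissible.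
  · refine (hmain' (K₁ * ν) (by positivity) hKδ
      (by rw [if_pos hgt]; positivity)).trans (ENNReal.ofReal_le_ofReal ?_)
    rw [if_neg hgt.not_gt, if_pos hgt, mul_assoc]
    refine mul_le_mul_of_nonneg_left ?_ hC.le
    have h1 : (K₁ * ν) ^ ((1 - α) / 2) ≤ K₁ ^ ((1 - α) / 2) * localRate α n σ := by
      rw [Real.mul_rpow hK₁0.le hν0.le, hνN]
      exact mul_le_mul_of_nonneg_left hR2 (by positivity)
    have h2 : √n * (K₁ * ν) ≤ localRate α n σ := by
      rw [mul_left_comm, hνn]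
      exact (mul_le_of_le_one_left hN0.le (min_le_right _ _)).trans hR2
    linarith

end UpperBounds

/-! ### The soft maximum and its increments. -/

section SoftMax

variable {ι : Type*} [Fintype ι] [Nonempty ι]

/-- The soft maximum `β⁻¹ log ∑ᵢ exp (β zᵢ)`. -/
noncomputable def softMax (β : ℝ) (z : ι → ℝ) : ℝ := β⁻¹ * Real.log (∑ i, Real.exp (β * z i))

/-- The gradient of the soft maximum. -/
noncomputable def softWeight (β : ℝ) (z : ι → ℝ) (i : ι) : ℝ :=
  Real.exp (β * z i) / ∑ j, Real.exp (β * z j)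

theorem sum_exp_pos (β : ℝ) (z : ι → ℝ) : 0 < ∑ i, Real.exp (β * z i) :=
  Finset.sum_pos (fun _ _ => Real.exp_pos _) Finset.univ_nonempty

theorem softWeight_nonneg (β : ℝ) (z : ι → ℝ) (i : ι) : 0 ≤ softWeight β z i :=
  div_nonneg (Real.exp_pos _).le (sum_exp_pos β z).le

theorem sum_softWeight (β : ℝ) (z : ι → ℝ) : ∑ i, softWeight β z i = 1 := by
  unfold softWeight
  rw [← Finset.sum_div, div_self (sum_exp_pos β z).ne']

theorem softWeight_le_one (β : ℝ) (z : ι → ℝ) (i : ι) : softWeight β z i ≤ 1 := by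
  rw [← sum_softWeight β z]
  exact Finset.single_le_sum (fun j _ => softWeight_nonneg β z j) (Finset.mem_univ i)

theorem measurable_softWeight (β : ℝ) (i : ι) : Measurable fun z : ι → ℝ => softWeight β z i := by
  unfold softWeight
  fun_prop

theorem measurable_softMax (β : ℝ) : Measurable (softMax (ι := ι) β) := by
  unfold softMax
  fun_prop

theorem le_iSup_of_finite (z : ι → ℝ) (i : ι) : z i ≤ ⨆ j, z j :=
  le_ciSup (Set.finite_range z).bddAbove i

theorem softMax_zero (β : ℝ) : softMax β (0 : ι → ℝ) = β⁻¹ * Real.log (Fintype.card ι) := by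
  simp [softMax]

theorem le_softMax {β : ℝ} (hβ : 0 < β) (z : ι → ℝ) (i : ι) : z i ≤ softMax β z := by
  unfold softMax
  rw [le_inv_mul_iff₀ hβ, Real.le_log_iff_exp_le (sum_exp_pos β z)]
  exact Finset.single_le_sum (f := fun i => Real.exp (β * z i))
    (fun j _ => (Real.exp_pos _).le) (Finset.mem_univ i)

theorem softMax_le {β : ℝ} (hβ : 0 < β) (z : ι → ℝ) :
    softMax β z ≤ (⨆ i, z i) + β⁻¹ * Real.log (Fintype.card ι) := by
  have hc : (0 : ℝ) < Fintype.card ι := by exact_mod_cast Fintype.card_pos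
  have h1 : ∑ i, Real.exp (β * z i) ≤ Fintype.card ι * Real.exp (β * ⨆ i, z i) := by
    refine (Finset.sum_le_card_nsmul _ _ _ fun i _ => Real.exp_le_exp.2
      (mul_le_mul_of_nonneg_left (le_iSup_of_finite z i) hβ.le)).trans ?_
    simp
  have h2 := Real.log_le_log (sum_exp_pos β z) h1
  rw [Real.log_mul hc.ne' (Real.exp_pos _).ne', Real.log_exp] at h2
  unfold softMax
  rw [inv_mul_le_iff₀ hβ, mul_add, mul_inv_cancel_left₀ hβ.ne']
  linarith

/-- If the weights are concentrated, then the soft maximum is close to the maximum. -/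
theorem softMax_le_of_weight {β : ℝ} (hβ : 0 < β) (z : ι → ℝ) :
    softMax β z ≤ (⨆ i, z i) + β⁻¹ * (Real.log 2
      + 2 * Real.log (Fintype.card ι) * (1 - ∑ i, softWeight β z i ^ 2)) := by
  have hlog2 : 0 < Real.log 2 := Real.log_pos (by norm_num)
  have hlogc : 0 ≤ Real.log (Fintype.card ι) := Real.log_natCast_nonneg _
  rcases le_or_gt (1 / 2) (1 - ∑ i, softWeight β z i ^ 2) with h | h
  -- For spread weights the factor `2 * (1 - ∑ w²)` is at least `1` and the general bound suffices.
  -- Otherwise some weight exceeds `1 / 2` and one exponential carries more than half of the sum,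
  -- leaving only `log 2`.
  · refine (softMax_le hβ z).trans ?_
    gcongr
    nlinarith
  · have h1 : ∃ i, 1 / 2 < softWeight β z i := by
      by_contra! hcon
      have h2 : ∑ i, softWeight β z i ^ 2 ≤ ∑ i, 1 / 2 * softWeight β z i :=
        Finset.sum_le_sum fun i _ => by
          have := softWeight_nonneg β z i
          nlinarith [hcon i]
      rw [← Finset.mul_sum, sum_softWeight] at h2
      linarith
    obtain ⟨i, hi⟩ := h1
    have h3 : softMax β z ≤ z i + β⁻¹ * Real.log 2 := by
      unfold softMax
      rw [inv_mul_le_iff₀ hβ, mul_add, mul_inv_cancel_left₀ hβ.ne']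
      unfold softWeight at hi
      rw [lt_div_iff₀ (sum_exp_pos β z)] at hi
      have h4 := Real.log_le_log (sum_exp_pos β z)
        (by linarith : ∑ i, Real.exp (β * z i) ≤ 2 * Real.exp (β * z i))
      rw [Real.log_mul two_ne_zero (Real.exp_pos _).ne', Real.log_exp] at h4
      linarith
    have h5 : 0 ≤ 1 - ∑ i, softWeight β z i ^ 2 := by
      have : ∑ i, softWeight β z i ^ 2 ≤ ∑ i, softWeight β z i :=
        Finset.sum_le_sum fun i _ => by
          have := softWeight_nonneg β z i
          nlinarith [softWeight_le_one β z i]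
      rw [sum_softWeight] at this
      linarith
    have h6 : β⁻¹ * Real.log 2 ≤ β⁻¹ * (Real.log 2
        + 2 * Real.log (Fintype.card ι) * (1 - ∑ i, softWeight β z i ^ 2)) := by
      gcongr
      have : 0 ≤ 2 * Real.log (Fintype.card ι) * (1 - ∑ i, softWeight β z i ^ 2) := by positivity
      linarith
    linarith [le_iSup_of_finite z i]

/-- Factoring out the old exponential sum turns the increment into a log-Laplace transform under the
Gibbs weights, to which Jensen's inequality and its refinement apply. -/
theorem softMax_add (β : ℝ) (z x : ι → ℝ) :
    softMax β (z + x)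
      = softMax β z + β⁻¹ * Real.log (∑ i, softWeight β z i * Real.exp (β * x i)) := by
  have h1 : ∑ i, Real.exp (β * (z + x) i)
      = (∑ i, Real.exp (β * z i)) * ∑ i, softWeight β z i * Real.exp (β * x i) := by
    rw [Finset.mul_sum]
    refine Finset.sum_congr rfl fun i _ => ?_
    rw [Pi.add_apply, mul_add, Real.exp_add, softWeight]
    have := (sum_exp_pos β z).ne'
    field_simp
  have h2 : 0 < ∑ i, softWeight β z i * Real.exp (β * x i) := by
    have h3 := sum_exp_pos β (z + x)
    rw [h1] at h3
    exact (pos_iff_pos_of_mul_pos h3).1 (sum_exp_pos β z)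
  unfold softMax
  rw [h1, Real.log_mul (sum_exp_pos β z).ne' h2.ne', mul_add]

theorem le_log_sum_exp {w y : ι → ℝ} (hw : ∀ i, 0 ≤ w i) (hw1 : ∑ i, w i = 1) :
    ∑ i, w i * y i ≤ Real.log (∑ i, w i * Real.exp (y i)) := by
  set m := ∑ i, w i * y i with hm
  have h1 : Real.exp m ≤ ∑ i, w i * Real.exp (y i) := by
    calc Real.exp m = ∑ i, w i * (Real.exp m * (1 + (y i - m))) := by
          have : ∀ i, w i * (Real.exp m * (1 + (y i - m)))
              = Real.exp m * ((1 - m) * w i + w i * y i) := fun i => by ring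
          simp only [this]
          rw [← Finset.mul_sum, Finset.sum_add_distrib, ← Finset.mul_sum, hw1, ← hm]
          ring
      _ ≤ _ := Finset.sum_le_sum fun i _ => mul_le_mul_of_nonneg_left (by
          have h2 := Real.add_one_le_exp (y i - m)
          have h3 : Real.exp (y i) = Real.exp m * Real.exp (y i - m) := by
            rw [← Real.exp_add]
            congr 1
            ring
          rw [h3]
          exact mul_le_mul_of_nonneg_left (by linarith) (Real.exp_pos _).le) (hw i)
  rw [← Real.log_exp m]
  exact Real.log_le_log (Real.exp_pos _) h1

theorem one_add_add_sq_div_three_le_exp {u : ℝ} (hu : |u| ≤ 1) : 1 + u + u ^ 2 / 3 ≤ Real.exp u := by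
  have h := Real.exp_bound hu (n := 5) (by norm_num)
  norm_num [Finset.sum_range_succ, Nat.factorial] at h
  have h2 := (abs_le.1 h).1
  obtain ⟨h3, h4⟩ := abs_le.1 hu
  have h5 : |u| ^ 5 ≤ u ^ 4 := by
    have : |u| ^ 4 = u ^ 4 := by rw [← abs_pow, abs_of_nonneg (by positivity)]
    rw [← this]
    exact pow_le_pow_of_le_one (abs_nonneg _) hu (by norm_num)
  nlinarith [mul_nonneg (sq_nonneg u) (by linarith : 0 ≤ 1 + u), sq_nonneg (u ^ 2)]

/-- Jensen's inequality with a variance gain. Centering at the mean leaves deviations at most `1`,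
where `exp u ≥ 1 + u + u ^ 2 / 3`, and `log (1 + V / 3) ≥ V / 6` since `V ≤ 1`. The double sum
equals `2 * V`, which explains `1 / 12`. -/
theorem le_log_sum_exp_add_variance {w y : ι → ℝ} (hw : ∀ i, 0 ≤ w i) (hw1 : ∑ i, w i = 1)
    (hy : ∀ i, |y i| ≤ 1 / 2) :
    ∑ i, w i * y i + 1 / 12 * ∑ i, ∑ j, w i * w j * (y i - y j) ^ 2
      ≤ Real.log (∑ i, w i * Real.exp (y i)) := by
  set m := ∑ i, w i * y i with hm
  set V := ∑ i, w i * (y i - m) ^ 2 with hV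
  have hmb : |m| ≤ 1 / 2 := by
    refine (Finset.abs_sum_le_sum_abs _ _).trans ?_
    calc ∑ i, |w i * y i| ≤ ∑ i, w i * (1 / 2) := Finset.sum_le_sum fun i _ => by
          rw [abs_mul, abs_of_nonneg (hw i)]
          exact mul_le_mul_of_nonneg_left (hy i) (hw i)
      _ = 1 / 2 := by rw [← Finset.sum_mul, hw1, one_mul]
  have hu : ∀ i, |y i - m| ≤ 1 := fun i => (abs_sub _ _).trans (by linarith [hy i])
  have hV0 : 0 ≤ V := Finset.sum_nonneg fun i _ => mul_nonneg (hw i) (sq_nonneg _)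
  have hV1 : V ≤ 1 := by
    rw [← hw1]
    refine Finset.sum_le_sum fun i _ => mul_le_of_le_one_right (hw i) ?_
    rw [← sq_abs]
    exact pow_le_one₀ (abs_nonneg _) (hu i)
  have hVeq : V = ∑ i, w i * y i ^ 2 - m ^ 2 := by
    have : ∀ i, w i * (y i - m) ^ 2 = w i * y i ^ 2 - 2 * m * (w i * y i) + m ^ 2 * w i :=
      fun i => by ring
    rw [hV]
    simp only [this]
    rw [Finset.sum_add_distrib, Finset.sum_sub_distrib, ← Finset.mul_sum, ← Finset.mul_sum, ← hm,
      hw1]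
    ring
  have hpair : ∑ i, ∑ j, w i * w j * (y i - y j) ^ 2 = 2 * V := by
    have h1 : ∀ i j, w i * w j * (y i - y j) ^ 2
        = w i * y i ^ 2 * w j - 2 * (w i * y i) * (w j * y j) + w i * (w j * y j ^ 2) :=
      fun i j => by ring
    simp only [h1, Finset.sum_add_distrib, Finset.sum_sub_distrib, ← Finset.mul_sum, hw1, ← hm,
      ← Finset.sum_mul]
    rw [hVeq]
    ring
  have h1 : Real.exp m * (1 + V / 3) ≤ ∑ i, w i * Real.exp (y i) := by
    calc Real.exp m * (1 + V / 3)
        = ∑ i, w i * (Real.exp m * (1 + (y i - m) + (y i - m) ^ 2 / 3)) := by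
          have : ∀ i, w i * (Real.exp m * (1 + (y i - m) + (y i - m) ^ 2 / 3))
              = Real.exp m * ((1 - m) * w i + w i * y i + (w i * (y i - m) ^ 2) / 3) :=
            fun i => by ring
          simp only [this]
          rw [← Finset.mul_sum, Finset.sum_add_distrib, Finset.sum_add_distrib, ← Finset.mul_sum,
            hw1, ← hm, ← Finset.sum_div, ← hV]
          ring
      _ ≤ _ := Finset.sum_le_sum fun i _ => mul_le_mul_of_nonneg_left (by
          have h2 := one_add_add_sq_div_three_le_exp (hu i)
          have h3 : Real.exp (y i) = Real.exp m * Real.exp (y i - m) := by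
            rw [← Real.exp_add]
            congr 1
            ring
          rw [h3]
          exact mul_le_mul_of_nonneg_left h2 (Real.exp_pos _).le) (hw i)
  have h2 := Real.log_le_log (by positivity) h1
  rw [Real.log_mul (Real.exp_pos _).ne' (by positivity), Real.log_exp] at h2
  have h3 : V / 6 ≤ Real.log (1 + V / 3) := by
    have h4 := Real.one_sub_inv_le_log_of_pos (by positivity : 0 < 1 + V / 3)
    refine le_trans ?_ h4
    have h5 : (1 : ℝ) - (1 + V / 3)⁻¹ = V / 3 / (1 + V / 3) := by
      field_simp
      ring
    rw [h5, le_div_iff₀ (by positivity)]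
    nlinarith
  rw [hpair]
  linarith

end SoftMax

/-! ### Sudakov minoration for independent bounded increments. -/

section Sudakov

variable {Ω : Type*} [MeasurableSpace Ω] {μ : Measure Ω} [IsProbabilityMeasure μ]
  {ι : Type*} [Fintype ι] [Nonempty ι]

theorem abs_softMax_le {β R : ℝ} (hβ : 0 < β) {z : ι → ℝ} (hz : ∀ i, |z i| ≤ R) :
    |softMax β z| ≤ R + β⁻¹ * Real.log (Fintype.card ι) := by
  have h0 : 0 ≤ β⁻¹ * Real.log (Fintype.card ι) :=
    mul_nonneg (inv_nonneg.2 hβ.le) (Real.log_natCast_nonneg _)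
  obtain ⟨i⟩ := ‹Nonempty ι›
  have h1 := le_softMax hβ z i
  have : Nonempty ι := ⟨i⟩
  have h2 := softMax_le hβ z
  have h3 : ⨆ i, z i ≤ R := ciSup_le fun i => (abs_le.1 (hz i)).2
  rw [abs_le]
  constructor <;> linarith [(abs_le.1 (hz i)).1]

theorem integrable_softMax {β R : ℝ} (hβ : 0 < β) {S : Ω → ι → ℝ} (hS : Measurable S)
    (hSR : ∀ ω i, |S ω i| ≤ R) : Integrable (fun ω => softMax β (S ω)) μ :=
  integrable_of_abs_le ((measurable_softMax β).comp hS) fun ω => abs_softMax_le hβ (hSR ω)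

/-- The first-order term of the expansion vanishes: the weights depend on `S` only, and `ξ` is
centered and independent of `S`. -/
theorem integral_sum_softWeight_mul {β r : ℝ} {S ξ : Ω → ι → ℝ}
    (hS : Measurable S) (hξ : Measurable ξ) (hind : IndepFun S ξ μ)
    (hξr : ∀ ω i, |ξ ω i| ≤ r) (h0 : ∀ i, ∫ ω, ξ ω i ∂μ = 0) :
    Integrable (fun ω => ∑ i, softWeight β (S ω) i * (β * ξ ω i)) μ ∧
      ∫ ω, ∑ i, softWeight β (S ω) i * (β * ξ ω i) ∂μ = 0 := by
  have hwm : ∀ i, Measurable fun ω => softWeight β (S ω) i := fun i =>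
    (measurable_softWeight β i).comp hS
  have hξm : ∀ i, Measurable fun ω => ξ ω i := fun i => (measurable_pi_apply i).comp hξ
  have hi : ∀ i, Integrable (fun ω => softWeight β (S ω) i * (β * ξ ω i)) μ := fun i =>
    integrable_of_abs_le ((hwm i).mul ((hξm i).const_mul β)) (b := |β| * r) fun ω => by
      rw [abs_mul, abs_mul, abs_of_nonneg (softWeight_nonneg β _ i)]
      refine (mul_le_of_le_one_left (by positivity) (softWeight_le_one β _ i)).trans ?_
      exact mul_le_mul_of_nonneg_left (hξr ω i) (abs_nonneg _)
  refine ⟨integrable_finsetSum _ fun i _ => hi i, ?_⟩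
  rw [integral_finsetSum _ fun i _ => hi i]
  refine Finset.sum_eq_zero fun i _ => ?_
  have h1 : IndepFun (fun ω => softWeight β (S ω) i) (fun ω => β * ξ ω i) μ :=
    hind.comp (ψ := fun z : ι → ℝ => β * z i) (measurable_softWeight β i) (by fun_prop)
  have h2 := h1.integral_fun_mul_eq_mul_integral (hwm i).aestronglyMeasurable
    ((hξm i).const_mul β).aestronglyMeasurable
  rw [h2, integral_const_mul, h0, mul_zero, mul_zero]

theorem integral_softMax_le_add {β r R : ℝ} (hβ : 0 < β) {S ξ : Ω → ι → ℝ}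
    (hS : Measurable S) (hξ : Measurable ξ) (hind : IndepFun S ξ μ) (hSR : ∀ ω i, |S ω i| ≤ R)
    (hξr : ∀ ω i, |ξ ω i| ≤ r) (h0 : ∀ i, ∫ ω, ξ ω i ∂μ = 0) :
    ∫ ω, softMax β (S ω) ∂μ ≤ ∫ ω, softMax β (S ω + ξ ω) ∂μ := by
  obtain ⟨hi, hz⟩ := integral_sum_softWeight_mul (β := β) hS hξ hind hξr h0
  have h1 : ∫ ω, (softMax β (S ω) + β⁻¹ * ∑ i, softWeight β (S ω) i * (β * ξ ω i)) ∂μ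
      = ∫ ω, softMax β (S ω) ∂μ := by
    rw [integral_add (integrable_softMax hβ hS hSR) (hi.const_mul _), integral_const_mul, hz]
    ring
  rw [← h1]
  refine integral_mono ((integrable_softMax hβ hS hSR).add (hi.const_mul _))
    (integrable_softMax hβ (hS.add hξ) (R := R + r) fun ω i =>
      (abs_add_le _ _).trans (add_le_add (hSR ω i) (hξr ω i))) fun ω => ?_
  simp only
  rw [softMax_add]
  gcongr
  exact le_log_sum_exp (softWeight_nonneg β _) (sum_softWeight β _)

/-- Adding an independent centered increment with separated coordinates increases the soft
maximum. -/
theorem integral_softMax_add_le {β r R d : ℝ} (hβ : 0 < β) (hβr : β * r ≤ 1 / 2)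
    {S ξ : Ω → ι → ℝ}
    (hS : Measurable S) (hξ : Measurable ξ) (hind : IndepFun S ξ μ) (hSR : ∀ ω i, |S ω i| ≤ R)
    (hξr : ∀ ω i, |ξ ω i| ≤ r) (h0 : ∀ i, ∫ ω, ξ ω i ∂μ = 0)
    (hd : ∀ i j, i ≠ j → d ≤ ∫ ω, (ξ ω i - ξ ω j) ^ 2 ∂μ) :
    ∫ ω, softMax β (S ω) ∂μ
      + β * d / 12 * ∫ ω, (1 - ∑ i, softWeight β (S ω) i ^ 2) ∂μ
      ≤ ∫ ω, softMax β (S ω + ξ ω) ∂μ := by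
  classical
  obtain ⟨hi, hz⟩ := integral_sum_softWeight_mul (β := β) hS hξ hind hξr h0
  have hwm : ∀ i, Measurable fun ω => softWeight β (S ω) i := fun i =>
    (measurable_softWeight β i).comp hS
  have hξm : ∀ i, Measurable fun ω => ξ ω i := fun i => (measurable_pi_apply i).comp hξ
  have hwwi : ∀ i j, Integrable (fun ω => softWeight β (S ω) i * softWeight β (S ω) j) μ :=
    fun i j => integrable_of_abs_le ((hwm i).mul (hwm j)) (b := 1) fun ω => by
      rw [abs_of_nonneg (mul_nonneg (softWeight_nonneg β _ i) (softWeight_nonneg β _ j))]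
      exact mul_le_one₀ (softWeight_le_one β _ i) (softWeight_nonneg β _ j)
        (softWeight_le_one β _ j)
  have hqi : ∀ i j, Integrable (fun ω => softWeight β (S ω) i * softWeight β (S ω) j
      * (β * ξ ω i - β * ξ ω j) ^ 2) μ := fun i j =>
    integrable_of_abs_le (((hwm i).mul (hwm j)).mul
      ((((hξm i).const_mul β).sub ((hξm j).const_mul β)).pow_const 2)) (b := 1) fun ω => by
      have hle : ∀ i, |β * ξ ω i| ≤ 1 / 2 := fun i => by
        rw [abs_mul, abs_of_pos hβ]
        exact (mul_le_mul_of_nonneg_left (hξr ω i) hβ.le).trans hβr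
      rw [abs_mul, abs_of_nonneg (mul_nonneg (softWeight_nonneg β _ i)
        (softWeight_nonneg β _ j)), abs_pow]
      refine mul_le_one₀ (mul_le_one₀ (softWeight_le_one β _ i) (softWeight_nonneg β _ j)
        (softWeight_le_one β _ j)) (by positivity) (pow_le_one₀ (abs_nonneg _)
        ((abs_sub _ _).trans (by linarith [hle i, hle j])))
  have hqsum : Integrable (fun ω => ∑ i, ∑ j, softWeight β (S ω) i * softWeight β (S ω) j
      * (β * ξ ω i - β * ξ ω j) ^ 2) μ :=
    integrable_finsetSum _ fun i _ => integrable_finsetSum _ fun j _ => hqi i j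
  -- The quantity `1 - ∑ w²` is the off-diagonal sum of `wᵢ wⱼ`. Independence factors each
  -- off-diagonal expectation, and the separation `d` bounds its second factor from below.
  have hq : β ^ 2 * d * ∫ ω, (1 - ∑ i, softWeight β (S ω) i ^ 2) ∂μ
      ≤ ∫ ω, ∑ i, ∑ j, softWeight β (S ω) i * softWeight β (S ω) j
        * (β * ξ ω i - β * ξ ω j) ^ 2 ∂μ := by
    have h1 : ∀ ω, 1 - ∑ i, softWeight β (S ω) i ^ 2
        = ∑ i, ∑ j, if i = j then 0 else softWeight β (S ω) i * softWeight β (S ω) j := fun ω => by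
      have h2 : ∀ i, (∑ j, if i = j then 0 else softWeight β (S ω) i * softWeight β (S ω) j)
          = softWeight β (S ω) i - softWeight β (S ω) i ^ 2 := fun i => by
        have h3 : ∀ j, (if i = j then 0 else softWeight β (S ω) i * softWeight β (S ω) j)
            = softWeight β (S ω) i * softWeight β (S ω) j
              - if i = j then softWeight β (S ω) i * softWeight β (S ω) j else 0 := fun j => by
          split_ifs <;> ring
        simp only [h3, Finset.sum_sub_distrib, ← Finset.mul_sum, sum_softWeight,
          Finset.sum_ite_eq, Finset.mem_univ, if_true]
        ring
      simp only [h2, Finset.sum_sub_distrib, sum_softWeight]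
    have hite : ∀ i j, Integrable (fun ω =>
        if i = j then (0 : ℝ) else softWeight β (S ω) i * softWeight β (S ω) j) μ := fun i j => by
      split_ifs
      · exact integrable_const 0
      · exact hwwi i j
    simp only [h1]
    rw [integral_finsetSum _ fun i _ => integrable_finsetSum _ fun j _ => hite i j,
      integral_finsetSum _ fun i _ => integrable_finsetSum _ fun j _ => hqi i j, Finset.mul_sum]
    refine Finset.sum_le_sum fun i _ => ?_
    rw [integral_finsetSum _ fun j _ => hite i j, integral_finsetSum _ fun j _ => hqi i j,
      Finset.mul_sum]
    refine Finset.sum_le_sum fun j _ => ?_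
    split_ifs with hij
    · simp [hij]
    · have h2 : IndepFun (fun ω => softWeight β (S ω) i * softWeight β (S ω) j)
          (fun ω => (β * ξ ω i - β * ξ ω j) ^ 2) μ :=
        hind.comp (φ := fun z => softWeight β z i * softWeight β z j)
          (ψ := fun z : ι → ℝ => (β * z i - β * z j) ^ 2)
          ((measurable_softWeight β i).mul (measurable_softWeight β j)) (by fun_prop)
      have h3 := h2.integral_fun_mul_eq_mul_integral ((hwm i).mul (hwm j)).aestronglyMeasurable
        ((((hξm i).const_mul β).sub ((hξm j).const_mul β)).pow_const 2).aestronglyMeasurable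
      rw [h3]
      have h4 : ∀ ω, (β * ξ ω i - β * ξ ω j) ^ 2 = β ^ 2 * (ξ ω i - ξ ω j) ^ 2 := fun ω => by ring
      simp only [h4]
      rw [integral_const_mul, mul_comm]
      refine mul_le_mul_of_nonneg_left (mul_le_mul_of_nonneg_left (hd i j hij) (sq_nonneg β)) ?_
      exact integral_nonneg fun ω =>
        mul_nonneg (softWeight_nonneg β _ i) (softWeight_nonneg β _ j)
  have hlow : Integrable (fun ω => ∑ i, softWeight β (S ω) i * (β * ξ ω i)
      + 1 / 12 * ∑ i, ∑ j, softWeight β (S ω) i * softWeight β (S ω) j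
        * (β * ξ ω i - β * ξ ω j) ^ 2) μ := hi.add (hqsum.const_mul _)
  have h1 : ∫ ω, (softMax β (S ω) + β⁻¹ * (∑ i, softWeight β (S ω) i * (β * ξ ω i)
      + 1 / 12 * ∑ i, ∑ j, softWeight β (S ω) i * softWeight β (S ω) j
        * (β * ξ ω i - β * ξ ω j) ^ 2)) ∂μ
      = ∫ ω, softMax β (S ω) ∂μ + β⁻¹ * (1 / 12 * ∫ ω, ∑ i, ∑ j, softWeight β (S ω) i
        * softWeight β (S ω) j * (β * ξ ω i - β * ξ ω j) ^ 2 ∂μ) := by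
    rw [integral_add (integrable_softMax hβ hS hSR) (hlow.const_mul _), integral_const_mul,
      integral_add hi (hqsum.const_mul _), hz, integral_const_mul, zero_add]
  have h2 : β * d / 12 * ∫ ω, (1 - ∑ i, softWeight β (S ω) i ^ 2) ∂μ
      ≤ β⁻¹ * (1 / 12 * ∫ ω, ∑ i, ∑ j, softWeight β (S ω) i
        * softWeight β (S ω) j * (β * ξ ω i - β * ξ ω j) ^ 2 ∂μ) := by
    rw [le_inv_mul_iff₀ hβ]
    nlinarith [hq]
  refine (add_le_add le_rfl h2).trans ?_
  rw [← h1]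
  refine integral_mono ((integrable_softMax hβ hS hSR).add (hlow.const_mul _))
    (integrable_softMax hβ (hS.add hξ) (R := R + r) fun ω i =>
      (abs_add_le _ _).trans (add_le_add (hSR ω i) (hξr ω i))) fun ω => ?_
  simp only
  rw [softMax_add]
  gcongr
  refine le_log_sum_exp_add_variance (softWeight_nonneg β _) (sum_softWeight β _) fun i => ?_
  rw [abs_mul, abs_of_pos hβ]
  exact (mul_le_mul_of_nonneg_left (hξr ω i) hβ.le).trans hβr

/-- Sudakov's minoration for sums of independent bounded random vectors. -/
theorem sudakov_minoration {n : ℕ} {ξ : Fin n → Ω → ι → ℝ} (hm : ∀ k, Measurable (ξ k))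
    (hind : iIndepFun ξ μ) {β r d : ℝ} (hb : ∀ k ω i, |ξ k ω i| ≤ r)
    (h0 : ∀ k i, ∫ ω, ξ k ω i ∂μ = 0)
    (hd0 : 0 ≤ d) (hd : ∀ k i j, i ≠ j → d ≤ ∫ ω, (ξ k ω i - ξ k ω j) ^ 2 ∂μ)
    (hβ : 0 < β) (hβr : β * r ≤ 1 / 2)
    (hcard : 4 * Real.log 2 ≤ Real.log (Fintype.card ι)) :
    min (β⁻¹ * (Real.log (Fintype.card ι) / 4)) (n * (β * d / 48))
      ≤ ∫ ω, ⨆ i, ∑ k, ξ k ω i ∂μ := by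
  classical
  set S : Finset (Fin n) → Ω → ι → ℝ := fun s => ∑ k ∈ s, ξ k with hS
  have hSm : ∀ s, Measurable (S s) := fun s => by
    convert Finset.measurable_sum s fun k _ => hm k using 1
    ext
    simp [hS]
  have hSap : ∀ s ω i, S s ω i = ∑ k ∈ s, ξ k ω i := fun s ω i => by
    simp [hS, Finset.sum_apply]
  have hSR : ∀ s ω i, |S s ω i| ≤ s.card * r := fun s ω i => by
    rw [hSap]
    refine (Finset.abs_sum_le_sum_abs _ _).trans ?_
    refine (Finset.sum_le_card_nsmul _ _ r fun k _ => hb k ω i).trans (by simp)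
  have hindS : ∀ s k, k ∉ s → IndepFun (S s) (ξ k) μ := fun s k hk =>
    hind.indepFun_finsetSum_of_notMem hm hk
  have hins : ∀ s k, k ∉ s → ∀ ω, S (insert k s) ω = S s ω + ξ k ω := fun s k hk ω => by
    simp only [hS, Finset.sum_insert hk, Pi.add_apply]
    rw [add_comm]
  have hMm : ∀ s, Measurable fun ω => ⨆ i, S s ω i := fun s =>
    Measurable.iSup fun i => (measurable_pi_apply i).comp (hSm s)
  have hMi : ∀ s, Integrable (fun ω => ⨆ i, S s ω i) μ := fun s =>
    integrable_of_abs_le (hMm s) (b := s.card * r) fun ω => by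
      obtain ⟨i⟩ := ‹Nonempty ι›
      have h1 := le_iSup_of_finite (S s ω) i
      have : Nonempty ι := ⟨i⟩
      have h2 : ⨆ i, S s ω i ≤ s.card * r := ciSup_le fun i => (abs_le.1 (hSR s ω i)).2
      rw [abs_le]
      constructor <;> linarith [(abs_le.1 (hSR s ω i)).1]
  have hsi : ∀ b, 0 < b → ∀ s, Integrable (fun ω => softMax b (S s ω)) μ := fun b hb s =>
    integrable_softMax hb (hSm s) (hSR s)
  have hlog0 : 0 ≤ Real.log (Fintype.card ι) := Real.log_natCast_nonneg _
  have hup : ∀ b, 0 < b → ∀ s, ∫ ω, softMax b (S s ω) ∂μ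
      ≤ ∫ ω, ⨆ i, S s ω i ∂μ + b⁻¹ * Real.log (Fintype.card ι) := fun b hb s => by
    refine (integral_mono (hsi b hb s) ((hMi s).add (integrable_const _))
      fun ω => softMax_le hb _).trans (le_of_eq ?_)
    simp only [Pi.add_apply]
    rw [integral_add (hMi s) (integrable_const _)]
    simp
  have hmono : ∀ b, 0 < b → Monotone fun s => ∫ ω, softMax b (S s ω) ∂μ := fun b hb' => by
    rw [Finset.monotone_iff_forall_le_insert]
    intro s k hk
    simp only [hins s k hk]
    exact integral_softMax_le_add hb' (hSm s) (hm k) (hindS s k hk) (hSR s) (hb k) (h0 k)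
  -- Expected maxima of partial sums grow with the index set, because soft maxima do and approximate
  -- the maximum within `b⁻¹ log |ι|`; the inverse temperature `b` makes this error at most `ε`.
  have hmax : ∀ s, ∫ ω, ⨆ i, S s ω i ∂μ ≤ ∫ ω, ⨆ i, S Finset.univ ω i ∂μ := fun s => by
    refine le_of_forall_pos_le_add fun ε hε => ?_
    set b := (Real.log (Fintype.card ι) + 1) / ε with hbdef
    have hb0 : 0 < b := by positivity
    have h1 : ∫ ω, ⨆ i, S s ω i ∂μ ≤ ∫ ω, softMax b (S s ω) ∂μ :=
      integral_mono (hMi s) (hsi b hb0 s) fun ω => ciSup_le fun i => le_softMax hb0 _ i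
    have h2 := hmono b hb0 (Finset.subset_univ s)
    have h3 := hup b hb0 Finset.univ
    have h4 : b⁻¹ * Real.log (Fintype.card ι) ≤ ε := by
      rw [inv_mul_le_iff₀ hb0, hbdef, div_mul_cancel₀ _ hε.ne']
      linarith
    simp only at h2
    linarith
  have hgoal : ∀ ω, (⨆ i, ∑ k, ξ k ω i) = ⨆ i, S Finset.univ ω i := fun ω => by
    simp only [hSap]
  simp only [hgoal]
  have hz : ∫ ω, softMax β (S ∅ ω) ∂μ = β⁻¹ * Real.log (Fintype.card ι) := by
    have : ∀ ω, S ∅ ω = 0 := fun ω => by simp [hS]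
    simp only [this, softMax_zero]
    simp
  have hwi : ∀ s, Integrable (fun ω => 1 - ∑ i, softWeight β (S s ω) i ^ 2) μ := fun s =>
    (integrable_const 1).sub (integrable_finsetSum _ fun i _ =>
      integrable_of_abs_le (((measurable_softWeight β i).comp (hSm s)).pow_const 2) (b := 1)
        fun ω => by
          rw [abs_pow]
          refine pow_le_one₀ (abs_nonneg _) ?_
          rw [abs_of_nonneg (softWeight_nonneg β _ i)]
          exact softWeight_le_one β _ i)
  -- If the weights concentrate for some partial sum, its soft maximum exceeds the expected maximum
  -- by at most `3/4` of the initial value `β⁻¹ log |ι|`, leaving one quarter. Otherwise each of the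
  -- `n` summands raises the soft maximum by `β * d / 48`, and the initial value cancels the final
  -- approximation error.
  by_cases hcase : ∃ s, ∫ ω, (1 - ∑ i, softWeight β (S s ω) i ^ 2) ∂μ ≤ 1 / 4
  · obtain ⟨s, hs⟩ := hcase
    refine (min_le_left _ _).trans (le_trans ?_ (hmax s))
    have h1 := hmono β hβ (Finset.empty_subset s)
    simp only [hz] at h1
    have h2 : ∫ ω, softMax β (S s ω) ∂μ ≤ ∫ ω, ⨆ i, S s ω i ∂μ + β⁻¹ * (Real.log 2
        + 2 * Real.log (Fintype.card ι) * ∫ ω, (1 - ∑ i, softWeight β (S s ω) i ^ 2) ∂μ) := by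
      have h3 : Integrable (fun ω => Real.log 2 + 2 * Real.log (Fintype.card ι)
          * (1 - ∑ i, softWeight β (S s ω) i ^ 2)) μ :=
        (integrable_const _).add ((hwi s).const_mul _)
      refine (integral_mono (hsi β hβ s) ((hMi s).add (h3.const_mul β⁻¹))
        fun ω => softMax_le_of_weight hβ _).trans (le_of_eq ?_)
      simp only [Pi.add_apply]
      rw [integral_add (hMi s) (h3.const_mul _), integral_const_mul,
        integral_add (integrable_const _) ((hwi s).const_mul _), integral_const_mul]
      simp
    have h4 : β⁻¹ * (Real.log 2
        + 2 * Real.log (Fintype.card ι) * ∫ ω, (1 - ∑ i, softWeight β (S s ω) i ^ 2) ∂μ)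
        ≤ β⁻¹ * (3 / 4 * Real.log (Fintype.card ι)) := by
      refine mul_le_mul_of_nonneg_left ?_ (inv_nonneg.2 hβ.le)
      nlinarith
    nlinarith
  · push Not at hcase
    refine (min_le_right _ _).trans ?_
    have hgrow : ∀ s : Finset (Fin n), β⁻¹ * Real.log (Fintype.card ι) + s.card * (β * d / 48)
        ≤ ∫ ω, softMax β (S s ω) ∂μ := fun s => by
      induction s using Finset.induction_on with
      | empty => simp [hz]
      | insert k s hk ih =>
        have h1 := integral_softMax_add_le hβ hβr (hSm s) (hm k) (hindS s k hk) (hSR s) (hb k)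
          (h0 k) (hd k)
        simp only [hins s k hk]
        rw [Finset.card_insert_of_notMem hk]
        push_cast
        have h2 : β * d / 12 * (1 / 4)
            ≤ β * d / 12 * ∫ ω, (1 - ∑ i, softWeight β (S s ω) i ^ 2) ∂μ :=
          mul_le_mul_of_nonneg_left (hcase s).le (by positivity)
        linarith
    have h1 := hgrow Finset.univ
    have h2 := hup β hβ Finset.univ
    rw [Finset.card_univ, Fintype.card_fin] at h1
    linarith

end Sudakov

/-! ### Separated subsets modulo constants and the lower bound at one radius. -/

section Packing

variable {𝒳 Ω : Type*} [MeasurableSpace 𝒳] [MeasurableSpace Ω]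
  {P : Measure 𝒳} {μ : Measure Ω} {n : ℕ} {X : Fin n → Ω → 𝒳}

/-- Bias-variance decomposition; it relates `L₂(P)` distances to distances modulo constants. -/
theorem integral_sub_sq_eq [IsProbabilityMeasure P] {h : 𝒳 → ℝ} (hm : Measurable h) {b : ℝ}
    (hb : ∀ x, |h x| ≤ b) (c : ℝ) :
    ∫ x, (h x - c) ^ 2 ∂P = ∫ x, (h x - ∫ y, h y ∂P) ^ 2 ∂P + (∫ y, h y ∂P - c) ^ 2 := by
  have hi : Integrable h P := integrable_of_abs_le hm hb
  have hi2 : Integrable (fun x => h x ^ 2) P :=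
    integrable_of_abs_le (hm.pow_const 2) (b := b ^ 2) fun x => by
      rw [abs_pow]
      exact pow_le_pow_left₀ (abs_nonneg _) (hb x) 2
  have key : ∀ c : ℝ, ∫ x, (h x - c) ^ 2 ∂P
      = ∫ x, h x ^ 2 ∂P - 2 * c * ∫ x, h x ∂P + c ^ 2 := fun c => by
    have h1 : ∀ x, (h x - c) ^ 2 = h x ^ 2 - 2 * c * h x + c ^ 2 := fun x => by ring
    have i1 : Integrable (fun x => 2 * c * h x) P := hi.const_mul _
    have i2 : Integrable (fun x => h x ^ 2 - 2 * c * h x) P := hi2.sub i1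
    simp only [h1]
    rw [integral_add i2 (integrable_const _), integral_sub hi2 i1, integral_const_mul]
    simp
  rw [key c, key (∫ y, h y ∂P)]
  ring

theorem lpSize_two_lt [IsProbabilityMeasure P] {h : 𝒳 → ℝ} (hm : Measurable h) {b s : ℝ}
    (hb : ∀ x, |h x| ≤ b) (hs : 0 < s) (hlt : ∫ x, h x ^ 2 ∂P < s ^ 2) :
    lpSize P 2 h < ENNReal.ofReal s := by
  have hmem : MemLp h (ENNReal.ofReal 2) P :=
    MemLp.of_bound hm.aestronglyMeasurable b (ae_of_all _ hb)
  unfold lpSize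
  rw [hmem.eLpNorm_eq_integral_rpow_norm (by simp) ENNReal.ofReal_ne_top,
    ENNReal.toReal_ofReal zero_le_two, ENNReal.ofReal_lt_ofReal_iff hs]
  have h1 : ∫ x, ‖h x‖ ^ (2 : ℝ) ∂P = ∫ x, h x ^ 2 ∂P :=
    integral_congr_ae (ae_of_all _ fun x => by
      simp only
      rw [Real.rpow_two, Real.norm_eq_abs, sq_abs])
  rw [h1, Real.rpow_inv_lt_iff_of_pos (integral_nonneg fun x => sq_nonneg _) hs.le two_pos,
    Real.rpow_two]
  exact hlt

/-- The squared distance of `f` and `g` in `L₂(P)` modulo constants. -/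
noncomputable def centeredSqDist (P : Measure 𝒳) (f g : 𝒳 → ℝ) : ℝ :=
  ∫ x, (f x - g x - ∫ y, (f y - g y) ∂P) ^ 2 ∂P

theorem centeredSqDist_comm (f g : 𝒳 → ℝ) : centeredSqDist P f g = centeredSqDist P g f := by
  unfold centeredSqDist
  have h : ∫ y, (f y - g y) ∂P = -∫ y, (g y - f y) ∂P := by
    rw [← integral_neg]
    simp
  rw [h]
  refine integral_congr_ae (ae_of_all _ fun x => ?_)
  simp only
  ring

theorem abs_integral_le_of_localized [IsProbabilityMeasure P] {F : Set (𝒳 → ℝ)}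
    (hF : IsUnitClass F) {ε : ℝ} (hε : 0 < ε) {f : 𝒳 → ℝ} (hf : f ∈ localized P F ε) :
    |∫ x, f x ∂P| ≤ ε := by
  have h1 := integral_sub_sq_eq (P := P) (hF.2.1 f hf.1) (hF.2.2 f hf.1) 0
  simp only [sub_zero] at h1
  have h2 : 0 ≤ ∫ x, (f x - ∫ y, f y ∂P) ^ 2 ∂P := integral_nonneg fun x => sq_nonneg _
  exact abs_le_of_sq_le_sq (by linarith [hf.2]) hε.le

/-- A class with a large covering number has a large subset separated modulo constants. -/
theorem exists_separated_or_coveringNumber_le [IsProbabilityMeasure P] {F : Set (𝒳 → ℝ)}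
    (hF : IsUnitClass F) {ε : ℝ} (hε : 0 < ε) (m : ℕ) :
    (∃ T : Finset (𝒳 → ℝ), ↑T ⊆ localized P F ε ∧ T.card = m ∧
      ∀ f ∈ T, ∀ g ∈ T, f ≠ g → (ε / 4) ^ 2 ≤ centeredSqDist P f g) ∨
    coveringNumber (lpSize P 2) (localized P F ε) (ε / 2) ≤ ((17 * m : ℕ) : ℕ∞) := by
  classical
  induction m with
  | zero => exact Or.inl ⟨∅, by simp⟩
  | succ m ih =>
    rcases ih with ⟨T, hT, hcard, hsep⟩ | h
    swap
    · exact Or.inr (h.trans (by exact_mod_cast (by omega)))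
    -- Greedy step: either the translates of `T` by `17` grid constants of mesh `ε / 4` form an `ε /
    -- 2` net, or some function is far from all of them and can be added to `T`.
    set φ : (𝒳 → ℝ) × ℤ → 𝒳 → ℝ := fun p x => p.1 x + p.2 * (ε / 4) with hφ
    set T' : Finset (𝒳 → ℝ) := (T ×ˢ Finset.Icc (-8 : ℤ) 8).image φ with hT'
    by_cases hcov : ∀ f ∈ localized P F ε, ∃ g ∈ (T' : Set (𝒳 → ℝ)),
        lpSize P 2 (f - g) < ENNReal.ofReal (ε / 2)
    · right
      have hT'm : ∀ g ∈ (T' : Set (𝒳 → ℝ)), Measurable g ∧ lpSize P 2 g < ∞ := fun g hg => by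
        simp only [hT', Finset.coe_image, Set.mem_image] at hg
        obtain ⟨⟨g₀, j⟩, hp, rfl⟩ := hg
        have hg₀ := hT (Finset.mem_product.1 hp).1
        have hm := hF.2.1 g₀ hg₀.1
        have hφm : Measurable (φ (g₀, j)) := hm.add_const _
        refine ⟨hφm, (MemLp.of_bound hφm.aestronglyMeasurable (1 + |j * (ε / 4)|)
          (ae_of_all _ fun x => (abs_add_le _ _).trans ?_)).2⟩
        exact add_le_add_left (hF.2.2 g₀ hg₀.1 x) _
      refine (iInf₂_le (T' : Set (𝒳 → ℝ)) ⟨hT'm, hcov⟩).trans ?_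
      rw [Set.encard_coe_eq_coe_finsetCard]
      have : T'.card ≤ 17 * m := by
        refine Finset.card_image_le.trans ?_
        rw [Finset.card_product, hcard, mul_comm]
        simp
      exact_mod_cast this.trans (by omega)
    · left
      push Not at hcov
      obtain ⟨f, hf, hfar⟩ := hcov
      -- Means in `F(ε)` are at most `ε` in absolute value, so `|D| ≤ 2ε`, that is `8` mesh widths.
      -- Rounding `D` down to the grid leaves an error below `ε / 4`; were `f` also within `ε / 4`
      -- of `g` modulo constants, the translate would lie within `ε / 2`.
      have hfT : ∀ g ∈ T, (ε / 4) ^ 2 ≤ centeredSqDist P f g := fun g hg => by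
        by_contra! hlt
        have hgF := hT hg
        have hfm := hF.2.1 f hf.1
        have hgm := hF.2.1 g hgF.1
        have hfb := hF.2.2 f hf.1
        have hgb := hF.2.2 g hgF.1
        set D := ∫ y, (f y - g y) ∂P with hD
        have hDeq : D = ∫ y, f y ∂P - ∫ y, g y ∂P :=
          integral_sub (integrable_of_abs_le hfm hfb) (integrable_of_abs_le hgm hgb)
        have h1 := abs_le.1 (abs_integral_le_of_localized hF hε hf)
        have h2 := abs_le.1 (abs_integral_le_of_localized hF hε hgF)
        set j := ⌊D / (ε / 4)⌋ with hj
        have hε4 : 0 < ε / 4 := by positivity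
        have hj1 : (j : ℝ) * (ε / 4) ≤ D := (le_div_iff₀ hε4).1 (Int.floor_le _)
        have hj2 : D < (j + 1) * (ε / 4) := (div_lt_iff₀ hε4).1 (Int.lt_floor_add_one _)
        have hjm : j ∈ Finset.Icc (-8 : ℤ) 8 := by
          rw [Finset.mem_Icc]
          constructor
          · refine Int.le_floor.2 ((le_div_iff₀ hε4).2 ?_)
            push_cast
            linarith
          · refine Int.floor_le_iff.2 ((div_lt_iff₀ hε4).2 ?_)
            push_cast
            linarith
        have hmem : φ (g, j) ∈ (T' : Set (𝒳 → ℝ)) := by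
          rw [hT', Finset.coe_image]
          exact ⟨(g, j), Finset.mem_coe.2 (Finset.mem_product.2 ⟨hg, hjm⟩), rfl⟩
        refine absurd (hfar _ hmem) (not_le.2 ?_)
        have hb2 : ∀ x, |f x - g x| ≤ 2 := fun x =>
          (abs_sub _ _).trans (by linarith [hfb x, hgb x])
        have h3 := integral_sub_sq_eq (P := P) (hfm.sub hgm) hb2 (j * (ε / 4))
        have h4 : ∀ x, f x - (g x + j * (ε / 4)) = f x - g x - j * (ε / 4) := fun x => by ring
        refine lpSize_two_lt (hfm.sub (hgm.add_const _)) (b := 2 + |j * (ε / 4)|) (fun x => ?_)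
          (by positivity) ?_
        · change |f x - (g x + j * (ε / 4))| ≤ _
          rw [h4]
          exact (abs_sub _ _).trans (add_le_add_left (hb2 x) _)
        · change ∫ x, (f x - (g x + j * (ε / 4))) ^ 2 ∂P < _
          simp only [h4]
          simp only [Pi.sub_apply] at h3
          rw [h3]
          unfold centeredSqDist at hlt
          rw [← hD] at hlt ⊢
          nlinarith
      have hfnot : f ∉ T := fun h => by
        have := hfT f h
        simp only [centeredSqDist, sub_self, integral_zero] at this
        norm_num at this
        exact absurd this (by positivity)
      refine ⟨insert f T, ?_, by rw [Finset.card_insert_of_notMem hfnot, hcard], ?_⟩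
      · rw [Finset.coe_insert]
        exact Set.insert_subset hf hT
      · intro g hg h hh hne
        rcases Finset.mem_insert.1 hg with rfl | hgT <;>
          rcases Finset.mem_insert.1 hh with rfl | hhT
        · exact absurd rfl hne
        · exact hfT h hhT
        · rw [centeredSqDist_comm]
          exact hfT g hgT
        · exact hsep g hgT h hhT hne

theorem exists_separated_of_alphaFull [IsProbabilityMeasure P] {F : Set (𝒳 → ℝ)} {α L ε : ℝ}
    (hF : IsUnitClass F) (hfull : AlphaFull P F α L) (hε : 0 < ε) (hε1 : ε ≤ 1)
    (hE : 16 ≤ L⁻¹ * ε ^ (-2 * α)) :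
    ∃ T : Finset (𝒳 → ℝ), ↑T ⊆ localized P F ε ∧
      L⁻¹ * ε ^ (-2 * α) / 4 ≤ Real.log T.card ∧
      ∀ f ∈ T, ∀ g ∈ T, f ≠ g → (ε / 4) ^ 2 ≤ centeredSqDist P f g := by
  set E := L⁻¹ * ε ^ (-2 * α) with hEdef
  -- The covering alternative would force `E ≤ log (17 * m) ≤ 6 * log 2 + E / 4`, impossible for `E
  -- ≥ 16`; the same bound excludes the value `1` in the maximum.
  set m := ⌈Real.exp (E / 4)⌉₊ with hm
  have hm1 : Real.exp (E / 4) ≤ m := Nat.le_ceil _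
  have hm0 : (0 : ℝ) < m := (Real.exp_pos _).trans_le hm1
  have hm2 : (m : ℝ) ≤ 2 * Real.exp (E / 4) := by
    have h1 := Nat.ceil_lt_add_one (Real.exp_pos (E / 4)).le
    have h2 := Real.one_le_exp (by linarith : 0 ≤ E / 4)
    linarith
  rcases exists_separated_or_coveringNumber_le (P := P) hF hε m with ⟨T, h1, h2, h3⟩ | h
  · refine ⟨T, h1, ?_, h3⟩
    rw [h2]
    exact (Real.le_log_iff_exp_le hm0).2 hm1
  · exfalso
    have h1 := hfull ε hε hε1
    rw [← hEdef, le_max_iff] at h1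
    rcases h1 with h1 | h1
    · have : E ≤ 1 := by exact_mod_cast h1
      linarith
    · have h2 : logNum (coveringNumber (lpSize P 2) (localized P F ε) (ε / 2))
          ≤ ((Real.log (17 * m) : ℝ) : EReal) := by
        unfold logNum
        have h3 : ((coveringNumber (lpSize P 2) (localized P F ε) (ε / 2) : ℕ∞) : ℝ≥0∞)
            ≤ ENNReal.ofReal (17 * m) := by
          have h4 : (((17 * m : ℕ) : ℕ∞) : ℝ≥0∞) = ENNReal.ofReal (17 * m) := by
            rw [ENat.toENNReal_coe, ← ENNReal.ofReal_natCast]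
            push_cast
            rfl
          rw [← h4]
          exact ENat.toENNReal_mono h
        rw [← ENNReal.log_ofReal_of_pos (by positivity)]
        exact ENNReal.log_monotone h3
      have h3 : E ≤ Real.log (17 * m) := by exact_mod_cast h1.trans h2
      have h4 : Real.log (17 * m) ≤ Real.log (2 ^ 6 * Real.exp (E / 4)) :=
        Real.log_le_log (by positivity) (by nlinarith [Real.exp_pos (E / 4)])
      rw [Real.log_mul (by norm_num) (Real.exp_pos _).ne', Real.log_exp, Real.log_pow] at h4
      have := Real.log_two_lt_d9
      push_cast at h4
      linarith

theorem expectedSup_mono {S T : Set (𝒳 → ℝ)} (h : S ⊆ T) :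
    expectedSup μ P X S ≤ expectedSup μ P X T :=
  lintegral_mono fun _ => biSup_mono h

theorem localized_mono {F : Set (𝒳 → ℝ)} {ε σ : ℝ} (hε : 0 ≤ ε) (h : ε ≤ σ) :
    localized P F ε ⊆ localized P F σ := fun _ hf =>
  ⟨hf.1, hf.2.trans (pow_le_pow_left₀ hε h 2)⟩

/-- Sudakov's minoration for the empirical process. -/
theorem le_expectedSup_of_separated [IsProbabilityMeasure P] [IsProbabilityMeasure μ]
    (hX : IsIIDSample μ P X) (hn : 1 ≤ n) {T : Finset (𝒳 → ℝ)} {S : Set (𝒳 → ℝ)}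
    (hTS : ↑T ⊆ S) (hTm : ∀ f ∈ T, Measurable f) (hTb : ∀ f ∈ T, ∀ x, |f x| ≤ 1) {d β : ℝ}
    (hd0 : 0 ≤ d) (hd : ∀ f ∈ T, ∀ g ∈ T, f ≠ g → d ≤ centeredSqDist P f g)
    (hβ : 0 < β) (hβn : β ≤ √n / 4) (hcard : 4 * Real.log 2 ≤ Real.log T.card) :
    ENNReal.ofReal (min (β⁻¹ * (Real.log T.card / 4)) (β * d / 48)) ≤ expectedSup μ P X S := by
  obtain ⟨hXm, hXi, hXP⟩ := hX
  have hn0 : (0 : ℝ) < n := by exact_mod_cast hn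
  have hsn : 0 < √(n : ℝ) := Real.sqrt_pos.2 hn0
  have hne : T.Nonempty := by
    rw [Finset.nonempty_iff_ne_empty]
    rintro rfl
    have := Real.log_pos (by norm_num : (1 : ℝ) < 2)
    simp at hcard
    linarith
  have : Nonempty T := hne.to_subtype
  set Φ : 𝒳 → T → ℝ := fun x f => (√n)⁻¹ * (f.1 x - ∫ y, f.1 y ∂P) with hΦ
  have hΦm : Measurable Φ := measurable_pi_lambda _ fun f =>
    ((hTm f.1 f.2).sub_const _).const_mul _
  have hΦi : ∀ f : T, Measurable fun x => Φ x f := fun f => (measurable_pi_apply f).comp hΦm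
  have hTi : ∀ f ∈ T, Integrable f P := fun f hf => integrable_of_abs_le (hTm f hf) (hTb f hf)
  have h1 := sudakov_minoration (ξ := fun k ω => Φ (X k ω)) (fun k => hΦm.comp (hXm k))
    (hXi.comp (fun _ => Φ) fun _ => hΦm) (r := (√n)⁻¹ * 2) (d := d / n) (β := β) (μ := μ)
    (fun k ω f => by
      simp only [hΦ]
      rw [abs_mul, abs_of_pos (inv_pos.2 hsn)]
      refine mul_le_mul_of_nonneg_left ?_ (inv_pos.2 hsn).le
      exact (abs_sub _ _).trans (by
        linarith [hTb f.1 f.2 (X k ω), abs_integral_le_of_abs_le (P := P) (hTb f.1 f.2)]))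
    (fun k f => by
      have h2 := integral_map (hXm k).aemeasurable (μ := μ) (f := fun x => Φ x f)
        (hΦi f).aestronglyMeasurable
      rw [← h2, hXP k]
      simp only [hΦ]
      rw [integral_const_mul, integral_sub (hTi f.1 f.2) (integrable_const _)]
      simp)
    (by positivity)
    (fun k f g hfg => by
      have h2 := integral_map (hXm k).aemeasurable (μ := μ) (f := fun x => (Φ x f - Φ x g) ^ 2)
        (((hΦi f).sub (hΦi g)).pow_const 2).aestronglyMeasurable
      rw [← h2, hXP k]
      have h3 : ∀ x, (Φ x f - Φ x g) ^ 2
          = (n : ℝ)⁻¹ * (f.1 x - g.1 x - ∫ y, (f.1 y - g.1 y) ∂P) ^ 2 := fun x => by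
        simp only [hΦ]
        rw [integral_sub (hTi f.1 f.2) (hTi g.1 g.2), ← mul_sub, mul_pow, inv_pow,
          Real.sq_sqrt hn0.le]
        ring
      simp only [h3]
      rw [integral_const_mul, div_eq_inv_mul]
      exact mul_le_mul_of_nonneg_left (hd f.1 f.2 g.1 g.2 fun h => hfg (Subtype.ext h))
        (by positivity))
    hβ (by
      rw [← div_eq_inv_mul, ← mul_div_assoc, div_le_iff₀ hsn]
      linarith) (by simpa using hcard)
  have h2 : (n : ℝ) * (β * (d / n) / 48) = β * d / 48 := by field_simp
  have h3 : ∀ ω, ∀ f : T, ∑ k, Φ (X k ω) f = empG P X f.1 ω := fun ω f => by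
    simp only [hΦ, empG, Finset.mul_sum]
  simp only [h2, h3, Fintype.card_coe] at h1
  refine (ENNReal.ofReal_le_ofReal (h1.trans (le_abs_self _))).trans ?_
  rw [← Real.enorm_eq_ofReal_abs]
  refine (enorm_integral_le_lintegral_enorm _).trans (lintegral_mono fun ω => ?_)
  obtain ⟨f, hf⟩ := exists_eq_ciSup_of_finite (f := fun f : T => empG P X f.1 ω)
  rw [← hf, Real.enorm_eq_ofReal_abs]
  exact le_iSup₂ (f := fun f (_ : f ∈ S) => ENNReal.ofReal |empG P X f ω|) f.1 (hTS f.2)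

theorem le_expectedSup_localized [IsProbabilityMeasure P] [IsProbabilityMeasure μ]
    (hX : IsIIDSample μ P X) (hn : 1 ≤ n) {F : Set (𝒳 → ℝ)} {α L ε κ : ℝ}
    (hF : IsUnitClass F) (hfull : AlphaFull P F α L) (hε : 0 < ε) (hε1 : ε ≤ 1)
    (hE : 16 ≤ L⁻¹ * ε ^ (-2 * α)) (hκ : κ ≤ √n * ε ^ (1 + α)) :
    ENNReal.ofReal (min (L⁻¹ / 16) (min (1 / 768) (κ / 3072)) * ε ^ (1 - α))
      ≤ expectedSup μ P X (localized P F ε) := by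
  obtain ⟨T, hT, hlog, hsep⟩ := exists_separated_of_alphaFull hF hfull hε hε1 hE
  have hsn : 0 < √(n : ℝ) := Real.sqrt_pos.2 (by exact_mod_cast hn)
  -- The first entry balances `β⁻¹ * ε ^ (-2 * α)` with `β * ε ^ 2`, both then `ε ^ (1 - α)`. The
  -- second is the cap imposed by bounded summands; when it is active, `hκ` keeps `β * ε ^ 2` of the
  -- same order.
  set β := min (ε ^ (-(1 + α))) (√n / 4) with hβdef
  have hβ : 0 < β := lt_min (by positivity) (by positivity)
  have hlog2 := Real.log_two_lt_d9
  refine le_trans (ENNReal.ofReal_le_ofReal ?_) (le_expectedSup_of_separated hX hn hT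
    (fun f hf => hF.2.1 f (hT hf).1) (fun f hf => hF.2.2 f (hT hf).1) (by positivity) hsep hβ
    (min_le_right _ _) (by linarith))
  have hp : 0 < ε ^ (1 - α) := by positivity
  have hp1 : ε ^ (1 + α) * ε ^ (-2 * α) = ε ^ (1 - α) := by
    rw [← Real.rpow_add hε]
    congr 1
    ring
  have hp2 : ε ^ (-(1 + α)) * ε ^ 2 = ε ^ (1 - α) := by
    rw [← Real.rpow_two, ← Real.rpow_add hε]
    congr 1
    ring
  have hp3 : ε ^ (1 + α) * ε ^ (1 - α) = ε ^ 2 := by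
    rw [← Real.rpow_two, ← Real.rpow_add hε]
    congr 1
    ring
  refine le_min ?_ ?_
  · have h1 : ε ^ (1 + α) ≤ β⁻¹ := by
      rw [le_inv_comm₀ (by positivity) hβ, ← Real.rpow_neg hε.le]
      exact min_le_left _ _
    calc _ ≤ L⁻¹ / 16 * ε ^ (1 - α) := mul_le_mul_of_nonneg_right (min_le_left _ _) hp.le
      _ = ε ^ (1 + α) * (L⁻¹ * ε ^ (-2 * α) / 4 / 4) := by
          rw [← hp1]
          ring
      _ ≤ β⁻¹ * (Real.log T.card / 4) :=
          mul_le_mul h1 (by linarith) (by linarith) (inv_pos.2 hβ).le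
  · rcases min_choice (ε ^ (-(1 + α))) (√n / 4) with h | h
    · rw [← hβdef] at h
      rw [h]
      calc _ ≤ 1 / 768 * ε ^ (1 - α) := mul_le_mul_of_nonneg_right
            ((min_le_right _ _).trans (min_le_left _ _)) hp.le
        _ = _ := by
            rw [← hp2]
            ring
    · rw [← hβdef] at h
      rw [h]
      calc _ ≤ κ / 3072 * ε ^ (1 - α) := mul_le_mul_of_nonneg_right
            ((min_le_right _ _).trans (min_le_right _ _)) hp.le
        _ ≤ √n * ε ^ (1 + α) / 3072 * ε ^ (1 - α) :=
            mul_le_mul_of_nonneg_right (by linarith) hp.le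
        _ = √n * (ε ^ (1 + α) * ε ^ (1 - α)) / 3072 := by ring
        _ = _ := by
            rw [hp3]
            ring

end Packing

/-! ### Choice of radius and the localized lower bound. -/

section LowerBound

theorem exists_le_expectedSup_localized {α L K : ℝ} (hα : 0 < α) (hα1 : α ≠ 1) (hL : 0 < L)
    (hK : 0 < K) :
    ∃ c : ℝ, 0 < c ∧
      ∀ {𝒳 : Type u} {Ω : Type v} [MeasurableSpace 𝒳] [MeasurableSpace Ω]
        {P : Measure 𝒳} {μ : Measure Ω} [IsProbabilityMeasure P] [IsProbabilityMeasure μ]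
        {n : ℕ} {X : Fin n → Ω → 𝒳} {F : Set (𝒳 → ℝ)} {σ : ℝ},
        1 ≤ n → IsIIDSample μ P X → IsUnitClass F → AlphaFull P F α L →
        0 < σ → (α < 1 → σ ≤ 1) → K * (n : ℝ) ^ (-(1 / (α + 1))) ≤ σ ^ 2 →
        ENNReal.ofReal (c * localRate α n σ) ≤ expectedSup μ P X (localized P F σ) := by
  set K₁ := min K 1 with hK₁
  have hK₁0 : 0 < K₁ := lt_min hK one_pos
  -- Shrinking the radius by this factor makes the entropy lower bound `L⁻¹ ε^{-2α}` at least `16`.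
  set ε₀ := min 1 ((16 * L) ^ (-(2 * α)⁻¹)) with hε₀
  have hε₀0 : 0 < ε₀ := lt_min one_pos (by positivity)
  have hε₀1 : ε₀ ≤ 1 := min_le_left _ _
  set κ := ε₀ ^ (1 + α) * K₁ ^ ((1 + α) / 2) with hκ
  have hκ0 : 0 < κ := by positivity
  set c₀ := min (L⁻¹ / 16) (min (1 / 768) (κ / 3072)) with hc₀
  have hc₀0 : 0 < c₀ := lt_min (by positivity) (lt_min (by norm_num) (by positivity))
  set A := 1 + K₁ ^ ((α - 1) / 2) with hA
  have hA0 : 0 < A := by positivity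
  refine ⟨c₀ * ε₀ ^ (1 - α) / A, by positivity, ?_⟩
  intro 𝒳 Ω _ _ P μ _ _ n X F σ hn hX hF hfull hσ hσ1 hKσ
  have hn1 : (1 : ℝ) ≤ n := by exact_mod_cast hn
  have hn0 : (0 : ℝ) < n := by linarith
  have hsn : 0 < √(n : ℝ) := Real.sqrt_pos.2 hn0
  set ν : ℝ := (n : ℝ) ^ (-(1 / (α + 1))) with hν
  have hν0 : 0 < ν := by positivity
  have hν1 : ν ≤ 1 := Real.rpow_le_one_of_one_le_of_nonpos hn1 (by
    have : 0 < 1 / (α + 1) := by positivity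
    linarith)
  set N : ℝ := (n : ℝ) ^ ((α - 1) / (2 * (α + 1))) with hNdef
  have hN0 : 0 < N := by positivity
  have hνN : ν ^ ((1 - α) / 2) = N := by
    rw [hν, ← Real.rpow_mul hn0.le]
    congr 1
    field_simp
    ring
  have hνn : √n * ν ^ ((1 + α) / 2) = 1 := by
    rw [hν, Real.sqrt_eq_rpow, ← Real.rpow_mul hn0.le, ← Real.rpow_add hn0]
    have : (1 : ℝ) / 2 + -(1 / (α + 1)) * ((1 + α) / 2) = 0 := by
      field_simp
      ring
    rw [this, Real.rpow_zero]
  have hK₁σ : K₁ * ν ≤ σ ^ 2 :=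
    (mul_le_mul_of_nonneg_right (min_le_left _ _) hν0.le).trans hKσ
  have hKK : K₁ ^ ((α - 1) / 2) * K₁ ^ ((1 - α) / 2) = 1 := by
    rw [← Real.rpow_add hK₁0]
    have : (α - 1) / 2 + (1 - α) / 2 = 0 := by ring
    rw [this, Real.rpow_zero]
  -- the radius at which the class is localized
  obtain ⟨τ, hτ0, hτ1, hτσ, hKτ, hτR⟩ : ∃ τ : ℝ, 0 < τ ∧ τ ≤ 1 ∧ τ ≤ σ ∧ K₁ * ν ≤ τ ^ 2 ∧
      localRate α n σ ≤ A * τ ^ (1 - α) := by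
    have hpow : ∀ τ : ℝ, 0 < τ → (τ ^ 2) ^ ((1 - α) / 2) = τ ^ (1 - α) := fun τ hτ => by
      rw [← Real.rpow_two, ← Real.rpow_mul hτ.le]
      congr 1
      ring
    have hNle : ∀ τ : ℝ, 0 < τ → (K₁ * ν) ^ ((1 - α) / 2) ≤ τ ^ (1 - α) →
        N ≤ K₁ ^ ((α - 1) / 2) * τ ^ (1 - α) := fun τ hτ h => by
      rw [Real.mul_rpow hK₁0.le hν0.le, hνN] at h
      have := mul_le_mul_of_nonneg_left h (by positivity : 0 ≤ K₁ ^ ((α - 1) / 2))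
      rwa [← mul_assoc, hKK, one_mul] at this
    have hfin : ∀ τ : ℝ, 0 < τ → σ ^ (1 - α) ≤ τ ^ (1 - α) →
        N ≤ K₁ ^ ((α - 1) / 2) * τ ^ (1 - α) → localRate α n σ ≤ A * τ ^ (1 - α) :=
      fun τ hτ h1 h2 => by
        have h3 : 0 < τ ^ (1 - α) := by positivity
        have h4 : 0 < K₁ ^ ((α - 1) / 2) * τ ^ (1 - α) := by positivity
        exact max_le (by rw [hA]; linarith) (by rw [← hNdef, hA]; linarith)
    rcases lt_or_gt_of_ne hα1 with hlt | hgt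
    · refine ⟨σ, hσ, hσ1 hlt, le_rfl, hK₁σ, hfin σ hσ le_rfl (hNle σ hσ ?_)⟩
      rw [← hpow σ hσ]
      exact Real.rpow_le_rpow (by positivity) hK₁σ (by linarith)
    · have hτ : 0 < √(K₁ * ν) := Real.sqrt_pos.2 (by positivity)
      have hsq : √(K₁ * ν) ^ 2 = K₁ * ν := Real.sq_sqrt (by positivity)
      have hle : √(K₁ * ν) ≤ σ := Real.sqrt_le_iff.2 ⟨hσ.le, hK₁σ⟩
      refine ⟨√(K₁ * ν), hτ, Real.sqrt_le_one.2 (mul_le_one₀ (min_le_right _ _) hν0.le hν1), hle,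
        hsq.ge, hfin _ hτ (Real.rpow_le_rpow_of_nonpos hτ hle (by linarith)) (hNle _ hτ ?_)⟩
      rw [← hpow _ hτ, hsq]
  have hετ : ε₀ * τ ≤ τ := mul_le_of_le_one_left hτ0.le hε₀1
  have hε0 : 0 < ε₀ * τ := by positivity
  have hE : 16 ≤ L⁻¹ * (ε₀ * τ) ^ (-2 * α) := by
    rw [le_inv_mul_iff₀ hL, mul_comm]
    have h1 : ε₀ * τ ≤ (16 * L) ^ (-(2 * α)⁻¹) :=
      (mul_le_of_le_one_right hε₀0.le hτ1).trans (min_le_right _ _)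
    have h2 := Real.rpow_le_rpow_of_nonpos hε0 h1 (by linarith : -2 * α ≤ 0)
    rwa [← Real.rpow_mul (by positivity), show -(2 * α)⁻¹ * (-2 * α) = 1 by field_simp,
      Real.rpow_one] at h2
  have hκle : κ ≤ √n * (ε₀ * τ) ^ (1 + α) := by
    have h1 : (K₁ * ν) ^ ((1 + α) / 2) ≤ τ ^ (1 + α) := by
      refine (Real.rpow_le_rpow (by positivity) hKτ (by positivity)).trans (le_of_eq ?_)
      rw [← Real.rpow_two, ← Real.rpow_mul hτ0.le]
      congr 1
      ring
    rw [Real.mul_rpow hK₁0.le hν0.le] at h1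
    rw [Real.mul_rpow hε₀0.le hτ0.le]
    calc κ = √n * (ε₀ ^ (1 + α) * (K₁ ^ ((1 + α) / 2) * ν ^ ((1 + α) / 2))) := by
          rw [hκ]
          linear_combination (-(ε₀ ^ (1 + α) * K₁ ^ ((1 + α) / 2))) * hνn
      _ ≤ _ := by gcongr
  refine le_trans (ENNReal.ofReal_le_ofReal ?_) ((le_expectedSup_localized hX hn hF hfull hε0
    (hετ.trans hτ1) hE hκle).trans (expectedSup_mono (localized_mono hε0.le (hετ.trans hτσ))))
  rw [← hc₀, Real.mul_rpow hε₀0.le hτ0.le, div_mul_eq_mul_div, div_le_iff₀ hA0]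
  have h1 : 0 ≤ c₀ * ε₀ ^ (1 - α) := by positivity
  have h2 := mul_le_mul_of_nonneg_left hτR h1
  linarith

end LowerBound

end EmpProc

theorem theorem1 :
    -- (1) the maximal inequality under an `L_p` bracketing condition
    (∀ p α L : ℝ, 1 ≤ p → 0 < α → α ≠ min p 2 → 0 < L →
      ∃ C : ℝ, 0 < C ∧
        ∀ (𝒳 : Type u) (Ω : Type v) [MeasurableSpace 𝒳] [MeasurableSpace Ω]
          (P : Measure 𝒳) (μ : Measure Ω) [IsProbabilityMeasure P] [IsProbabilityMeasure μ]
          (n : ℕ) (X : Fin n → Ω → 𝒳) (F : Set (𝒳 → ℝ)) (σ : ℝ),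
          1 ≤ n → EmpProc.IsIIDSample μ P X → EmpProc.IsUnitClass F → 0 < σ →
          (∀ f ∈ F, EmpProc.lpSize P p f ≤ ENNReal.ofReal σ) →
          (∀ ε : ℝ, 0 < ε →
            EmpProc.logNum (EmpProc.bracketingNumber (EmpProc.lpSize P p) F ε)
              ≤ ((L * ε ^ (-α) : ℝ) : EReal)) →
          EmpProc.expectedSup μ P X F ≤ ENNReal.ofReal C * EmpProc.chainingBound α p n σ) ∧
    -- the bound in (1) is equivalent to its explicit form
    (∀ p α : ℝ, 1 ≤ p → 0 < α → α ≠ min p 2 →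
      ∃ C : ℝ, 0 < C ∧ ∀ (n : ℕ) (σ : ℝ), 1 ≤ n → 0 < σ →
        EmpProc.chainingBound α p n σ ≤ ENNReal.ofReal (C * EmpProc.explicitBound α p n σ) ∧
        ENNReal.ofReal (EmpProc.explicitBound α p n σ)
          ≤ ENNReal.ofReal C * EmpProc.chainingBound α p n σ) ∧
    -- (2) the upper bound for the localized class
    (∀ α L K : ℝ, 0 < α → α ≠ 1 → 0 < L → 0 < K →
      ∃ C : ℝ, 0 < C ∧
        ∀ (𝒳 : Type u) (Ω : Type v) [MeasurableSpace 𝒳] [MeasurableSpace Ω]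
          (P : Measure 𝒳) (μ : Measure Ω) [IsProbabilityMeasure P] [IsProbabilityMeasure μ]
          (n : ℕ) (X : Fin n → Ω → 𝒳) (F : Set (𝒳 → ℝ)) (σ : ℝ),
          1 ≤ n → EmpProc.IsIIDSample μ P X → EmpProc.IsUnitClass F →
          EmpProc.EntropyUpper P F α L →
          0 < σ → K * (n : ℝ) ^ (-(1 / (α + 1))) ≤ σ ^ 2 →
          EmpProc.expectedSup μ P X (EmpProc.localized P F σ)
            ≤ ENNReal.ofReal (C * EmpProc.localRate α n σ)) ∧
    -- (3) the lower bound for the localized class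
    (∀ α L K : ℝ, 0 < α → α ≠ 1 → 0 < L → 0 < K →
      ∃ c : ℝ, 0 < c ∧
        ∀ (𝒳 : Type u) (Ω : Type v) [MeasurableSpace 𝒳] [MeasurableSpace Ω]
          (P : Measure 𝒳) (μ : Measure Ω) [IsProbabilityMeasure P] [IsProbabilityMeasure μ]
          (n : ℕ) (X : Fin n → Ω → 𝒳) (F : Set (𝒳 → ℝ)) (σ : ℝ),
          1 ≤ n → EmpProc.IsIIDSample μ P X → EmpProc.IsUnitClass F →
          EmpProc.EntropyUpper P F α L → EmpProc.AlphaFull P F α L →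
          0 < σ → (α < 1 → σ ≤ 1) → K * (n : ℝ) ^ (-(1 / (α + 1))) ≤ σ ^ 2 →
          ENNReal.ofReal (c * EmpProc.localRate α n σ)
            ≤ EmpProc.expectedSup μ P X (EmpProc.localized P F σ)) := by
  refine ⟨fun p α L hp hα hαp _ => ?_, fun p α _ _ hαp =>
    EmpProc.chainingBound_equiv_explicitBound hαp, fun α L K hα hα1 _ hK => ?_,
    fun α L K hα hα1 hL hK => ?_⟩
  · obtain ⟨C, hC, h⟩ := EmpProc.exists_expectedSup_le_chainingBound.{u, v} (L := L) hp hα hαp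
    exact ⟨C, hC, fun 𝒳 Ω _ _ P μ _ _ n X F σ hn hX hF hσ hFσ hN =>
      h hn hX hF hσ hFσ hN⟩
  · obtain ⟨C, hC, h⟩ := EmpProc.exists_expectedSup_localized_le.{u, v} (L := L) hα hα1 hK
    exact ⟨C, hC, fun 𝒳 Ω _ _ P μ _ _ n X F σ hn hX hF hN hσ hKσ =>
      h hn hX hF hN hσ hKσ⟩
  · obtain ⟨c, hc, h⟩ := EmpProc.exists_le_expectedSup_localized.{u, v} hα hα1 hL hK
    exact ⟨c, hc, fun 𝒳 Ω _ _ P μ _ _ n X F σ hn hX hF _ hfull hσ hσ1 hKσ =>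
      h hn hX hF hfull hσ hσ1 hKσ⟩
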